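/- **Setting.** Let $d\ge 2$ and let $\Omega\subset\mathbb R^d$ be a bounded open polyhedral domain. Let $0=t_0<\dots<t_N=T_f$, $k_n=t_n-t_{n-1}$, and for each $n$ let $\mathcal T_h^n$ be a finite conforming simplicial triangulation with $\Omega=\operatorname{int}\bigcup_{\tau\in\mathcal T_h^n}\tau$, shape regular with constant $c_\varrho$: $h_\tau\le c_\varrho\varrho_\tau$, where $h_\tau=\operatorname{diam}\tau$ and $\varrho_\tau$ is the largest diameter of a ball inscribed in $\tau$. The domain is not pinched: any two elements with a common node $z$ are linked by a chain of elements containing $z$, consecutive ones sharing an edge (automatic for Lipschitz $\Omega$). "Edge" means $(d-1)$-dimensional face; $\mathcal E_h$ is the set of all edges of $\mathcal T^n_h$, interior and boundary ones, and $h_e=\operatorname{diam} e$. Let $\mu,\varepsilon,\lambda_c,c_w,\varrho>0$, $0<\kappa<1$, $\eta\ge0$, $\rho=2\lambda_c\varepsilon/c_w$, $\nu=\lambda_c/(c_w\varepsilon)$, and let $\|\cdot\|$ be the norm of $L^2(\Omega)$. Let $\mathbb V_h^n$ be the continuous piecewise affine functions on $\mathcal T_h^n$. For an open set $\Omega_D\subset\Omega$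 let $\mathbb U_{g,h}^n$ (resp. $\mathbb U^n_{d,h}$) be the set of $u\in\mathbb V_h^n$ whose value at every node $x\in\overline{\Omega_D}$ is $g(t_n,x)$ (resp. $0$). Let $v_h^m\in\mathbb V_h^m$ for $0\le m\le N$, and let $(u_h^m)$ solve the discrete wave problem: $u_h^0,\tilde u_h^0\in\mathbb V_h^0$ are given, $u_h^m\in\mathbb U_{g,h}^m$ for $1\le m\le N$, $u_h^1=u_h^0+k_1\tilde u_h^0$, and for $2\le m\le N$ and all $\psi_h\in\mathbb U_{d,h}^m$ $$\varrho(\delta^2u_h^m,\psi_h)+(\mu\,a_h^{m-1}\nabla u_h^m,\nabla\psi_h)+(\eta\,a_h^{m-1}\nabla\delta u_h^m,\nabla\psi_h)=(f_h^m,\psi_h),\qquad a_h^{m}=(1-\kappa)(v_h^{m})^2+\kappa,$$ where $\delta u_h^m=(u_h^m-u_h^{m-1})/k_m$ for $m\ge1$, $\delta u_h^0=\tilde u_h^0$, $\delta^2u_h^m=(\delta u_h^m-\delta u_h^{m-1})/k_m$, $f_h^m=\frac1{k_m}\int_{t_{m-1}}^{t_m}f_h\,dt$ and $f_h\in L^2((0,T_f)\times\Omega)$.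 Fix $1\le n\le N$. Let $CR_h$ be the union of the closed edges $e\in\mathcal E_h$ with $v_h^{n-1}\le\Xi_{CR}$ on $e$, where $\Xi_{CR}\in\mathbb R$ is a given tolerance, and let $\mathbb V_{c,h}^n=\{\varphi_h\in\mathbb V_h^n:\varphi_h=0\text{ on }CR_h\}$. Let $CR$ be a set with $CR_h\subseteq CR$ (for example $CR=CR_h$) and $\mathbb V_c=\{\varphi\in H^1(\Omega):\varphi=0\text{ on }CR\text{ in the sense of traces}\}$. Put $$\mathcal J'(u;v)(\varphi)=\int_\Omega\big[\rho\,\nabla v\cdot\nabla\varphi-\nu\,\varphi+\mu(1-\kappa)\,v\,\varphi\,|\nabla u|^2\big]\,dx .$$ **Statement.** For all $d\ge 2$ and $c_\varrho>0$ there is a constant $c_{44}>0$, depending only on $d$ and the shape-regularity constant $c_\varrho$, such that in every setting as above, if $v_h^n\in\mathbb V_{c,h}^n$ is a discrete critical point, i.e. $\mathcal J'(u_h^n;v_h^n)(\varphi_h)=0$ for all $\varphi_h\in\mathbb V_{c,h}^n$, then $$|\mathcal J'(u_h^n;v_h^n)(\varphi)|\le c_{44}\,\mathcal R_h\,\|\nabla\varphi\|\qquad\text{for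 all }\varphi\in\mathbb V_c,$$ and consequently $$\|\mathcal J'(u_h^n;v_h^n)\|_{\mathbb V_c^*}=\sup_{0\neq\varphi\in\mathbb V_c}\frac{|\mathcal J'(u_h^n;v_h^n)(\varphi)|}{\|\varphi\|_{H^1(\Omega)}}\le c_{44}\,\mathcal R_h .$$ Here $\mathcal R_h=\big\{\sum_{\tau\in\mathcal T_h^n}|\mathcal R_\tau|^2\big\}^{1/2}$ with $$|\mathcal R_\tau|^2=\int_\tau h_\tau^2\,\big|\mu(1-\kappa)|\nabla u_h^n|^2v_h^n-\nu\big|^2\,dx+\sum_{e\in\mathcal E_h,\ e\subset\partial\tau}\int_e\rho^2h_e\,\big|[\nabla v_h^n]\big|^2\,ds,$$ where $[\nabla v_h^n]$ is the difference of the gradients on the two sides of an interior edge, and $\nabla v_h^n\cdot\mathbf n$ on a boundary edge. -/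

import Mathlib

open Set Filter Topology MeasureTheory
open scoped ENNReal ContDiff

noncomputable section

namespace PhaseField

/-- The Euclidean space `ℝ^d`. -/
abbrev E (d : ℕ) := EuclideanSpace ℝ (Fin d)

/-! ### Sobolev functions -/

/-- `G` is the weak (distributional) gradient of `φ` on the open set `Ω`. -/
def HasWeakGradient {d : ℕ} (Ω : Set (E d)) (φ : E d → ℝ) (G : E d → E d) : Prop :=
  ∀ η : E d → ℝ, ContDiff ℝ ∞ η → HasCompactSupport η → tsupport η ⊆ Ω →
    ∫ x in Ω, φ x • gradient η x = - ∫ x in Ω, η x • G x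

/-- `φ ∈ H¹(Ω)`, with weak gradient `G`. -/
structure IsH1 {d : ℕ} (Ω : Set (E d)) (φ : E d → ℝ) (G : E d → E d) : Prop where
  memLp : MemLp φ 2 (volume.restrict Ω)
  grad_memLp : MemLp G 2 (volume.restrict Ω)
  weak : HasWeakGradient Ω φ G

/-- `‖∇φ‖_{L²(Ω)}`, where `G = ∇φ`. -/
def gradNorm {d : ℕ} (Ω : Set (E d)) (G : E d → E d) : ℝ :=
  Real.sqrt (∫ x in Ω, ‖G x‖ ^ 2)

/-- The norm `‖φ‖_{H¹(Ω)}`, where `G = ∇φ`. -/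
def h1Norm {d : ℕ} (Ω : Set (E d)) (φ : E d → ℝ) (G : E d → E d) : ℝ :=
  Real.sqrt ((∫ x in Ω, φ x ^ 2) + ∫ x in Ω, ‖G x‖ ^ 2)

/-! ### Simplicial meshes -/

/-- A finite conforming simplicial mesh in `ℝ^d`. An element is given by its `d + 1` vertices, the
closed simplex being their convex hull; two elements meet in the common face spanned by their
common vertices (possibly empty). -/
structure Mesh (d : ℕ) where
  elements : Finset (Finset (E d))
  card_eq : ∀ τ ∈ elements, τ.card = d + 1
  indep : ∀ τ ∈ elements, AffineIndependent ℝ ((↑) : τ → E d)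
  conforming : ∀ τ ∈ elements, ∀ τ' ∈ elements,
    convexHull ℝ (τ : Set (E d)) ∩ convexHull ℝ (τ' : Set (E d)) ⊆
      convexHull ℝ ((τ : Set (E d)) ∩ (τ' : Set (E d)))

/-- The closed simplex with the given vertices. -/
def cell {d : ℕ} (s : Finset (E d)) : Set (E d) := convexHull ℝ (s : Set (E d))

/-- The largest diameter of a closed ball inscribed in the simplex `τ`. -/
def inDiam {d : ℕ} (τ : Finset (E d)) : ℝ :=
  sSup {δ : ℝ | 0 ≤ δ ∧ ∃ x : E d, Metric.closedBall x (δ / 2) ⊆ cell τ}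

namespace Mesh

variable {d : ℕ} (T : Mesh d)

/-- The nodes of the mesh. -/
def nodes : Set (E d) := {x | ∃ τ ∈ T.elements, x ∈ τ}

/-- The `(d-1)`-dimensional faces (edges, if `d = 2`), interior and boundary ones,
given by their `d` vertices. -/
def edges : Set (Finset (E d)) := {e | e.card = d ∧ ∃ τ ∈ T.elements, e ⊆ τ}

/-- Two elements are neighbours at the node `z` if they contain `z` and share an edge. -/
def NeighboursAt (z : E d) (τ τ' : Finset (E d)) : Prop :=
  τ ∈ T.elements ∧ τ' ∈ T.elements ∧ z ∈ τ ∧ z ∈ τ' ∧ ∃ e : Finset (E d), e.card = d ∧ e ⊆ τ ∧ e ⊆ τ'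

/-- `T` is a triangulation of `Ω`, exact at the boundary: `Ω` is the interior of the union of the
closed elements. The second field excludes domains that are pinched at a node, so that they have
no Lipschitz boundary: it says that any two elements at a node are linked
by a chain of elements at that node, consecutive ones sharing an edge. -/
structure Triangulates (Ω : Set (E d)) : Prop where
  exact : Ω = interior (⋃ τ ∈ T.elements, cell τ)
  linked : ∀ z : E d, ∀ τ ∈ T.elements, ∀ τ' ∈ T.elements, z ∈ τ → z ∈ τ' →
    Relation.ReflTransGen (T.NeighboursAt z) τ τ'

/-- Shape regularity, `h_τ / ϱ_τ ≤ c` for every element. -/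
def ShapeRegular (c : ℝ) : Prop :=
  ∀ τ ∈ T.elements, Metric.diam (cell τ) ≤ c * inDiam τ

/-- The continuous piecewise affine finite element space. Only the values on the union of the
closed elements matter; continuity there is automatic, since the affine pieces agree wherever
closed elements meet. -/
def FESpace : Set (E d → ℝ) :=
  {v | ∀ τ ∈ T.elements, ∃ A : E d →ᵃ[ℝ] ℝ, EqOn v A (cell τ)}

/-- Finite element functions with the nodal values of `g` at the nodes in the closure of `ΩD`. -/
def FEDirichlet (ΩD : Set (E d)) (g : E d → ℝ) : Set (E d → ℝ) :=
  {u | u ∈ T.FESpace ∧ ∀ x ∈ T.nodes, x ∈ closure ΩD → u x = g x}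

/-- The discrete crack: the union of the closed edges of the mesh on which `w ≤ tol`. -/
def crackSet (w : E d → ℝ) (tol : ℝ) : Set (E d) :=
  ⋃ e ∈ {e ∈ T.edges | ∀ x ∈ cell e, w x ≤ tol}, cell e

/-- Finite element functions that vanish on the set `C`. -/
def FEVanishing (C : Set (E d)) : Set (E d → ℝ) :=
  {v | v ∈ T.FESpace ∧ ∀ x ∈ C, v x = 0}

/-- `φ = 0` on `C` in the sense of traces, for an `H¹` function `φ` with weak gradient `G`: the
trace on `C` of the restriction of `φ` to any element `τ` is zero. The trace is the `L²(C ∩ τ)`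
limit (for the `(d-1)`-dimensional surface measure) of the restrictions of smooth functions
that converge to `φ` in `H¹(τ)`. -/
def VanishesOn (C : Set (E d)) (φ : E d → ℝ) (G : E d → E d) : Prop :=
  ∀ τ ∈ T.elements, ∃ Φ : ℕ → E d → ℝ, (∀ k, ContDiff ℝ ∞ (Φ k)) ∧
    Tendsto (fun k => eLpNorm (Φ k - φ) 2 (volume.restrict (cell τ))) atTop (𝓝 0) ∧
    Tendsto (fun k => eLpNorm (gradient (Φ k) - G) 2 (volume.restrict (cell τ))) atTop (𝓝 0) ∧
    Tendsto (fun k => eLpNorm (Φ k) 2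
      ((μHE[d - 1] : Measure (E d)).restrict (C ∩ cell τ))) atTop (𝓝 0)

/-- The space `V_c`: `φ ∈ H¹(Ω)` (with weak gradient `G`) and `φ = 0` on `C`. -/
structure InVc (Ω C : Set (E d)) (φ : E d → ℝ) (G : E d → E d) : Prop where
  isH1 : IsH1 Ω φ G
  vanishes : T.VanishesOn C φ G

/-- The constant gradient of a finite element function on the element `τ`. -/
def elemGrad (v : E d → ℝ) (τ : Finset (E d)) : E d :=
  gradient v (τ.centroid ℝ id)

open Classical in
/-- The elements on the other side of the edge `e` of the element `τ`: one if `e` is an interior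
edge, none if `e` is a boundary edge. -/
def across (τ e : Finset (E d)) : Finset (Finset (E d)) :=
  T.elements.filter (fun τ' => τ' ≠ τ ∧ e ⊆ τ')

open Classical in
/-- `|[∇v]|²` on the edge `e` of `τ`. On an interior edge `[∇v]` is the difference of the gradients
on the two sides; on a boundary edge it is the normal derivative, whose modulus is the length of the
projection of `∇v` to the orthogonal complement of the directions of `e`. -/
def jumpSq (v : E d → ℝ) (τ e : Finset (E d)) : ℝ :=
  if (T.across τ e).Nonempty then ∑ τ' ∈ T.across τ e, ‖elemGrad v τ - elemGrad v τ'‖ ^ 2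
  else ‖(vectorSpan ℝ (e : Set (E d)))ᗮ.starProjection (elemGrad v τ)‖ ^ 2

end Mesh

/-! ### The energy -/

/-- The physical and regularization parameters. -/
structure Params where
  mu : ℝ
  kappa : ℝ
  eps : ℝ
  lamc : ℝ
  cw : ℝ
  eta : ℝ
  dens : ℝ
  mu_pos : 0 < mu
  kappa_pos : 0 < kappa
  kappa_lt_one : kappa < 1
  eps_pos : 0 < eps
  lamc_pos : 0 < lamc
  cw_pos : 0 < cw
  eta_nonneg : 0 ≤ eta
  dens_pos : 0 < dens

namespace Params

variable (p : Params)

/-- `ρ = 2 λ_c ε / c_w`. -/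
def rho : ℝ := 2 * p.lamc * p.eps / p.cw

/-- `ν = λ_c / (c_w ε)`. -/
def nu : ℝ := p.lamc / (p.cw * p.eps)

/-- The degradation coefficient `a = (1 - κ) v² + κ`. -/
def deg (s : ℝ) : ℝ := (1 - p.kappa) * s ^ 2 + p.kappa

/-- `J'(u; v)(φ) = ∫_Ω ρ ∇v·∇φ - ν φ + μ (1-κ) v φ |∇u|²`, where `Du`, `Dv`, `Dφ` stand for the
gradients of `u`, `v`, `φ`. For finite element functions the gradient is the
classical one, which exists almost everywhere. -/
def energyDeriv {d : ℕ} (Ω : Set (E d)) (Du : E d → E d) (v : E d → ℝ) (Dv : E d → E d)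
    (φ : E d → ℝ) (Dφ : E d → E d) : ℝ :=
  ∫ x in Ω, (p.rho * inner ℝ (Dv x) (Dφ x) - p.nu * φ x
    + p.mu * (1 - p.kappa) * (v x * φ x) * ‖Du x‖ ^ 2)

/-- The local indicator `|R_τ(u, v)|²`. -/
def indicatorSq {d : ℕ} (T : Mesh d) (u v : E d → ℝ) (τ : Finset (E d)) : ℝ :=
  (∫ x in cell τ, Metric.diam (cell τ) ^ 2 *
      |p.mu * (1 - p.kappa) * ‖gradient u x‖ ^ 2 * v x - p.nu| ^ 2)
    + ∑ e ∈ τ.powersetCard d, ∫ _x in cell e,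
        p.rho ^ 2 * Metric.diam (cell e) * T.jumpSq v τ e ∂(μHE[d - 1] : Measure (E d))

/-- The residual estimator `R_h = (∑_τ |R_τ(u, v)|²)^{1/2}`. -/
def estimator {d : ℕ} (T : Mesh d) (u v : E d → ℝ) : ℝ :=
  Real.sqrt (∑ τ ∈ T.elements, p.indicatorSq T u v τ)

/-- The `V_c`-dual norm `sup_{φ ∈ V_c} |J'(u; v)(φ)| / ‖φ‖_{H¹(Ω)}` of `J'(u; v)` for finite element
functions `u`, `v`, as an extended nonnegative number. -/
def dualNorm {d : ℕ} (T : Mesh d) (Ω C : Set (E d)) (u v : E d → ℝ) : ℝ≥0∞ :=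
  ⨆ (φ : E d → ℝ) (G : E d → E d) (_ : T.InVc Ω C φ G),
    ENNReal.ofReal (|p.energyDeriv Ω (gradient u) v (gradient v) φ G| / h1Norm Ω φ G)

end Params

/-! ### The fully discrete problem -/

/-- The data of the fully discrete problem: domain, Dirichlet region and boundary data, discrete
load, time grid, one mesh for each time level, and the crack tolerance. -/
structure Problem (d : ℕ) where
  p : Params
  Ω : Set (E d)
  ΩD : Set (E d)
  g : ℝ → E d → ℝ
  fh : ℝ → E d → ℝ
  Tf : ℝ
  N : ℕ
  t : ℕ → ℝ
  mesh : ℕ → Mesh d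
  tol : ℝ
  ΩD_open : IsOpen ΩD
  ΩD_subset : ΩD ⊆ Ω
  t_zero : t 0 = 0
  t_last : t N = Tf
  t_lt : ∀ n < N, t n < t (n + 1)
  fh_memLp : MemLp (Function.uncurry fh) 2 (volume.restrict (Icc 0 Tf ×ˢ Ω))
  triangulates : ∀ n ≤ N, (mesh n).Triangulates Ω

namespace Problem

variable {d : ℕ} (P : Problem d)

/-- The time step `k_n = t_n - t_{n-1}`. -/
def step (n : ℕ) : ℝ := P.t n - P.t (n - 1)

/-- The backward difference `δ u^n`, with `δ u^0` the given discrete initial velocity. -/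
def delta (u : ℕ → E d → ℝ) (w0 : E d → ℝ) (n : ℕ) : E d → ℝ :=
  if n = 0 then w0 else fun x => (u n x - u (n - 1) x) / P.step n

/-- The second backward difference `δ² u^n`. -/
def delta2 (u : ℕ → E d → ℝ) (w0 : E d → ℝ) (n : ℕ) : E d → ℝ :=
  fun x => (P.delta u w0 n x - P.delta u w0 (n - 1) x) / P.step n

/-- The time average `f_h^n` of the load over `(t_{n-1}, t_n]`. -/
def load (n : ℕ) : E d → ℝ :=
  fun x => (1 / P.step n) * ∫ s in (P.t (n - 1))..(P.t n), P.fh s x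

/-- The wave equation at time level `n`, with the phase field `v^{n-1}` of the previous level. -/
def WaveEq (u v : ℕ → E d → ℝ) (w0 : E d → ℝ) (n : ℕ) : Prop :=
  ∀ ψ ∈ (P.mesh n).FEDirichlet P.ΩD 0,
    P.p.dens * (∫ x in P.Ω, P.delta2 u w0 n x * ψ x)
      + (∫ x in P.Ω, P.p.mu * P.p.deg (v (n - 1) x) * inner ℝ (gradient (u n) x) (gradient ψ x))
      + (∫ x in P.Ω, P.p.eta * P.p.deg (v (n - 1) x)
          * inner ℝ (gradient (P.delta u w0 n) x) (gradient ψ x))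
      = ∫ x in P.Ω, P.load n x * ψ x

/-- `u` solves the discrete wave problem for the phase fields `v`: `u^0` and `w0` are the discrete
initial displacement and velocity, the first step is `u^1 = u^0 + k_1 w0`, and the wave
equation holds at the later levels. -/
structure IsWaveSolution (u v : ℕ → E d → ℝ) (w0 : E d → ℝ) : Prop where
  init_mem : u 0 ∈ (P.mesh 0).FESpace
  velocity_mem : w0 ∈ (P.mesh 0).FESpace
  mem : ∀ n, 1 ≤ n → n ≤ P.N → u n ∈ (P.mesh n).FEDirichlet P.ΩD (P.g (P.t n))
  first : 1 ≤ P.N → EqOn (u 1) (fun x => u 0 x + P.step 1 * w0 x) (closure P.Ω)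
  wave : ∀ n, 2 ≤ n → n ≤ P.N → P.WaveEq u v w0 n

/-- The discrete crack set `CR_h(t_{n-1})`, made of edges of the mesh at level `n`. -/
def CRh (v : ℕ → E d → ℝ) (n : ℕ) : Set (E d) :=
  (P.mesh n).crackSet (v (n - 1)) P.tol

/-- The space `V_{c,h}^n`. -/
def Vch (v : ℕ → E d → ℝ) (n : ℕ) : Set (E d → ℝ) :=
  (P.mesh n).FEVanishing (P.CRh v n)

/-- `v^n` is a critical point of `J_h^n(u^n; ·)` in `V_{c,h}^n`. -/
def IsCritical (u v : ℕ → E d → ℝ) (n : ℕ) : Prop :=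
  v n ∈ P.Vch v n ∧ ∀ φ ∈ P.Vch v n,
    P.p.energyDeriv P.Ω (gradient (u n)) (v n) (gradient (v n)) φ (gradient φ) = 0

end Problem

end PhaseField

end

/-! The bound is a residual estimate based on Galerkin orthogonality. From $\varphi\in\mathbb V_c$
one subtracts a quasi-interpolant $\varphi_h\in\mathbb V_{c,h}^n$; since $v_h^n$ is critical, this
does not change the value of $\mathcal J'$. Integration by parts on each element, where $\nabla
v_h^n$ is constant, leaves the volume residual tested with $\varphi-\varphi_h$ and, on each edge,
the normal derivative times the integral of $\varphi-\varphi_h$ over that edge. The local bound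
$\|\varphi-\varphi_h\|_\tau\lesssim h_\tau\|\nabla\varphi\|_{\text{patch}}$, its counterpart on
edges, the Cauchy-Schwarz inequality and the finite overlap of the patches give the result.

Only mean values over faces enter, so no general trace theory is needed. For the face $e$ of $\tau$
opposite to $a$, the mean of $f$ over $e$ is $|\tau|^{-1}\int_\tau(f+d^{-1}(x-a)\cdot\nabla f)$.
This volume integral (`faceMean`) makes sense for $H^1$ functions and is continuous in $H^1(\tau)$;
`IsSimplex.face_formula` identifies it for smooth functions by slicing the cone with apex $a$. Three
facts carry the argument. The integral of a gradient over $\tau$ is a combination of face means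
(`IsSimplex.integral_inner_grad`). Face means of $\varphi$ vanish on crack faces
(`Mesh.InVc.faceMean_eq_zero`). The face means from the two sides of a face agree
(`Mesh.InVc.faceMean_eq`), which follows by testing the weak gradient with cut-offs concentrated
near the relative interior of the face. By the last fact the contributions of the two sides of an
interior edge combine to the jump (`Mesh.abs_sum_normal_le`).

At a node the quasi-interpolant takes the mean of $\varphi$ over some element at the node, or $0$ if
the node lies on the crack. That $0$ is itself the face mean of a crack face at the node, so one
estimate covers both cases (`Mesh.InVc.node_deviation_le`): cell mean and face mean of one element
differ by at most $h_\tau|\tau|^{-1/2}\|\nabla\varphi\|_\tau$, neighbours share a face mean, and any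
two elements at a node are linked by a chain of neighbours. Shape regularity bounds the number of
elements at a node by a volume count (`Mesh.card_star_le`), hence the length of the chains, hence
the ratio of the diameters (`Mesh.Triangulates.diam_le`). Together with the Poincaré inequality on a
simplex (`IsSimplex.poincare_smooth`) and $|\nabla\lambda_z|\lesssim h_\tau^{-1}$ for barycentric
coordinates, this yields the local estimates with constants depending only on $d$ and the shape
regularity. -/

noncomputable section

namespace PhaseField

variable {d : ℕ}

/-! ### Affine functions -/

/-- The gradient of an affine function. -/
def affGrad (A : E d →ᵃ[ℝ] ℝ) : E d :=
  (InnerProductSpace.toDual ℝ (E d)).symm (LinearMap.toContinuousLinearMap A.linear)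

theorem inner_affGrad (A : E d →ᵃ[ℝ] ℝ) (w : E d) : inner ℝ (affGrad A) w = A.linear w := by
  simp [affGrad]

theorem affine_eq (A : E d →ᵃ[ℝ] ℝ) (x y : E d) :
    A x = A y + inner ℝ (affGrad A) (x - y) := by
  rw [inner_affGrad]
  have := A.linearMap_vsub x y
  simp only [vsub_eq_sub] at this
  linarith

theorem hasGradientAt_affine (A : E d →ᵃ[ℝ] ℝ) (x : E d) : HasGradientAt A (affGrad A) x := by
  have h1 : HasFDerivAt A (LinearMap.toContinuousLinearMap A.linear) x := by
    have : (A : E d → ℝ) = fun y => LinearMap.toContinuousLinearMap A.linear y + A 0 := by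
      funext y
      have := affine_eq A y 0
      rw [inner_affGrad, sub_zero] at this
      simp [this, add_comm]
    rw [this]
    exact (ContinuousLinearMap.hasFDerivAt _).add_const _
  rw [hasGradientAt_iff_hasFDerivAt]
  simpa [affGrad] using h1

theorem gradient_affine (A : E d →ᵃ[ℝ] ℝ) (x : E d) : gradient A x = affGrad A :=
  (hasGradientAt_affine A x).gradient

theorem contDiff_affine (A : E d →ᵃ[ℝ] ℝ) : ContDiff ℝ ∞ A := by
  have : (A : E d → ℝ) = fun y => A 0 + inner ℝ (affGrad A) (y - 0) :=
    funext fun y => affine_eq A y 0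
  rw [this]
  exact contDiff_const.add (contDiff_const.inner ℝ (contDiff_id.sub contDiff_const))

theorem continuous_affine (A : E d →ᵃ[ℝ] ℝ) : Continuous A := (contDiff_affine A).continuous

theorem affine_centroid (A : E d →ᵃ[ℝ] ℝ) {s : Finset (E d)} (hs : s.Nonempty) :
    A (s.centroid ℝ id) = ∑ y ∈ s, (s.card : ℝ)⁻¹ * A y := by
  rw [Finset.centroid_def, Finset.map_affineCombination _ _ _
    (Finset.sum_centroidWeights_eq_one_of_nonempty ℝ _ hs),
    Finset.affineCombination_eq_linear_combination _ _ _
    (Finset.sum_centroidWeights_eq_one_of_nonempty ℝ _ hs)]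
  simp [Finset.centroidWeights_apply]

/-! ### Simplices and barycentric coordinates -/

/-- `τ` consists of the `d + 1` vertices of a nondegenerate simplex in `ℝ^d`. -/
structure IsSimplex (τ : Finset (E d)) : Prop where
  card_eq : τ.card = d + 1
  indep : AffineIndependent ℝ ((↑) : τ → E d)

theorem Mesh.isSimplex (T : Mesh d) {τ : Finset (E d)} (h : τ ∈ T.elements) : IsSimplex τ :=
  ⟨T.card_eq τ h, T.indep τ h⟩

/-- The affine basis formed by the vertices of a simplex. -/
def IsSimplex.basis {τ : Finset (E d)} (h : IsSimplex τ) : AffineBasis τ ℝ (E d) where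
  toFun := (↑)
  ind' := h.indep
  tot' := by
    rw [h.indep.affineSpan_eq_top_iff_card_eq_finrank_add_one]
    simp [h.card_eq]

open Classical in
/-- The barycentric coordinate of the simplex `τ` for its vertex `z`. -/
def bary (τ : Finset (E d)) (z : E d) : E d →ᵃ[ℝ] ℝ :=
  if h : IsSimplex τ ∧ z ∈ τ then h.1.basis.coord ⟨z, h.2⟩ else 0

namespace IsSimplex

variable {τ : Finset (E d)} (h : IsSimplex τ)
include h

theorem bary_eq {z : E d} (hz : z ∈ τ) : bary τ z = h.basis.coord ⟨z, hz⟩ := by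
  rw [bary, dif_pos ⟨h, hz⟩]

theorem bary_self {z : E d} (hz : z ∈ τ) : bary τ z z = 1 := by
  rw [h.bary_eq hz]; exact h.basis.coord_apply_eq ⟨z, hz⟩

theorem bary_ne {z z' : E d} (hz : z ∈ τ) (hz' : z' ∈ τ) (hne : z ≠ z') : bary τ z z' = 0 := by
  rw [h.bary_eq hz]
  exact h.basis.coord_apply_ne (i := ⟨z, hz⟩) (j := ⟨z', hz'⟩) (by simpa using hne)

theorem sum_bary (x : E d) : ∑ z ∈ τ, bary τ z x = 1 := by
  rw [← Finset.sum_coe_sort, ← h.basis.sum_coord_apply_eq_one x]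
  exact Finset.sum_congr rfl fun i _ => by rw [h.bary_eq i.2]

theorem sum_bary_smul (x : E d) : ∑ z ∈ τ, bary τ z x • z = x := by
  rw [← Finset.sum_coe_sort]
  conv_rhs => rw [← h.basis.linear_combination_coord_eq_self x]
  exact Finset.sum_congr rfl fun i _ => by rw [h.bary_eq i.2]; rfl

theorem range_basis : range h.basis = (τ : Set (E d)) := by
  change range ((↑) : τ → E d) = _
  simp

theorem mem_cell {x : E d} : x ∈ cell τ ↔ ∀ z ∈ τ, 0 ≤ bary τ z x := by
  rw [cell, ← h.range_basis, h.basis.convexHull_eq_nonneg_coord]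
  constructor
  · intro hx z hz; rw [h.bary_eq hz]; exact hx _
  · intro hx i; have := hx i i.2; rwa [h.bary_eq i.2] at this

theorem mem_interior_cell {x : E d} : x ∈ interior (cell τ) ↔ ∀ z ∈ τ, 0 < bary τ z x := by
  rw [cell, ← h.range_basis, h.basis.interior_convexHull]
  constructor
  · intro hx z hz; rw [h.bary_eq hz]; exact hx _
  · intro hx i; have := hx i i.2; rwa [h.bary_eq i.2] at this

theorem affine_eq_sum (A : E d →ᵃ[ℝ] ℝ) (x : E d) : A x = ∑ z ∈ τ, bary τ z x * A z := by
  have h1 : ∀ z ∈ τ, bary τ z x * A z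
      = bary τ z x * A x + inner ℝ (affGrad A) (bary τ z x • z - bary τ z x • x) := by
    intro z _
    rw [affine_eq A z x, ← smul_sub, inner_smul_right]; ring
  rw [Finset.sum_congr rfl h1, Finset.sum_add_distrib, ← Finset.sum_mul, h.sum_bary, ← inner_sum,
    Finset.sum_sub_distrib, h.sum_bary_smul, ← Finset.sum_smul, h.sum_bary]
  simp

theorem affGrad_eq_sum (A : E d →ᵃ[ℝ] ℝ) : affGrad A = ∑ z ∈ τ, A z • affGrad (bary τ z) := by
  refine ext_inner_right ℝ fun w => ?_
  have e1 := affine_eq A w 0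
  have e2 := h.affine_eq_sum A w
  have e3 := h.affine_eq_sum A 0
  rw [sum_inner]
  simp only [sub_zero] at e1
  have : inner ℝ (affGrad A) w = A w - A 0 := by linarith
  rw [this, e2, e3, ← Finset.sum_sub_distrib]
  refine Finset.sum_congr rfl fun z _ => ?_
  rw [affine_eq (bary τ z) w 0, inner_smul_left, sub_zero]
  simp; ring

theorem sum_affGrad_bary : ∑ z ∈ τ, affGrad (bary τ z) = 0 := by
  have := h.affGrad_eq_sum (AffineMap.const ℝ (E d) 1)
  simp only [AffineMap.const_apply, one_smul] at this
  rw [← this]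
  simp [affGrad]

/-- Apply `affGrad_eq_sum` to the linear function $\langle w,\cdot\rangle$; the terms with $x$
cancel because the gradients of the barycentric coordinates sum to zero. This is the algebra behind
the divergence theorem below. -/
theorem sum_inner_smul_affGrad (x w : E d) :
    ∑ z ∈ τ, inner ℝ (x - z) w • affGrad (bary τ z) = -w := by
  have key := h.affGrad_eq_sum ((innerSL ℝ w).toLinearMap.toAffineMap)
  have hg : affGrad ((innerSL ℝ w).toLinearMap.toAffineMap) = w := by
    refine ext_inner_right ℝ fun v => ?_
    rw [inner_affGrad]; simp
  rw [hg] at key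
  have h2 : ∀ z ∈ τ, inner ℝ (x - z) w • affGrad (bary τ z) =
      inner ℝ x w • affGrad (bary τ z) -
        (innerSL ℝ w).toLinearMap.toAffineMap z • affGrad (bary τ z) := by
    intro z _
    rw [inner_sub_left, sub_smul]
    simp [real_inner_comm]
  rw [Finset.sum_congr rfl h2, Finset.sum_sub_distrib, ← key, ← Finset.smul_sum,
    h.sum_affGrad_bary]
  simp

theorem bary_le_one {x : E d} (hx : x ∈ cell τ) {z : E d} (hz : z ∈ τ) : bary τ z x ≤ 1 := by
  rw [← h.sum_bary x]
  exact Finset.single_le_sum (f := fun z => bary τ z x) (fun i hi => h.mem_cell.1 hx i hi) hz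

/-- Faces of a simplex in barycentric coordinates. -/
theorem mem_cell_subset {s : Finset (E d)} (hs : s ⊆ τ) {x : E d} :
    x ∈ cell s ↔ x ∈ cell τ ∧ ∀ z ∈ τ, z ∉ s → bary τ z x = 0 := by
  constructor
  · intro hx
    refine ⟨convexHull_mono (by exact_mod_cast hs) hx, fun z hz hzs => ?_⟩
    have hconv : Convex ℝ {y | bary τ z y = 0} :=
      (convex_singleton (0 : ℝ)).affine_preimage (bary τ z)
    have : cell s ⊆ {y | bary τ z y = 0} := by
      refine convexHull_min (fun y hy => ?_) hconv
      exact h.bary_ne hz (hs hy) (fun hzy => hzs (hzy ▸ hy))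
    exact this hx
  · rintro ⟨hx, h0⟩
    have e1 := h.sum_bary_smul x
    have e2 := h.sum_bary x
    rw [← Finset.sum_subset hs (fun z hz hzs => by rw [h0 z hz hzs, zero_smul])] at e1
    rw [← Finset.sum_subset hs (fun z hz hzs => h0 z hz hzs)] at e2
    rw [← e1]
    exact (convex_convexHull ℝ _).sum_mem (fun z hz => h.mem_cell.1 hx z (hs hz)) e2
      (fun z hz => subset_convexHull ℝ _ hz)

end IsSimplex

/-! ### Topology and volume of closed simplices -/

theorem subset_cell (s : Finset (E d)) : (s : Set (E d)) ⊆ cell s := subset_convexHull ℝ _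

theorem isCompact_cell (s : Finset (E d)) : IsCompact (cell s) :=
  s.finite_toSet.isCompact_convexHull ℝ

theorem measurableSet_cell (s : Finset (E d)) : MeasurableSet (cell s) :=
  (isCompact_cell s).isClosed.measurableSet

theorem convex_cell (s : Finset (E d)) : Convex ℝ (cell s) := convex_convexHull ℝ _

theorem norm_sub_le_diam {s : Finset (E d)} {x y : E d} (hx : x ∈ cell s) (hy : y ∈ cell s) :
    ‖x - y‖ ≤ Metric.diam (cell s) := by
  rw [← dist_eq_norm]
  exact Metric.dist_le_diam_of_mem (isCompact_cell s).isBounded hx hy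

theorem volume_frontier_cell (s : Finset (E d)) : volume (frontier (cell s)) = 0 :=
  (convex_cell s).addHaar_frontier volume

theorem ae_mem_interior_cell (s : Finset (E d)) :
    ∀ᵐ x ∂(volume.restrict (cell s)), x ∈ interior (cell s) := by
  rw [ae_restrict_iff' (measurableSet_cell s)]
  filter_upwards [compl_mem_ae_iff.2 (volume_frontier_cell s)] with x hx hxc
  by_contra hxi
  exact hx ⟨subset_closure hxc, hxi⟩

theorem volume_cell_lt_top (s : Finset (E d)) : volume (cell s) < ⊤ :=
  (isCompact_cell s).measure_lt_top

namespace IsSimplex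

variable {τ : Finset (E d)} (h : IsSimplex τ)
include h

theorem nonempty : τ.Nonempty := by
  rw [← Finset.card_pos, h.card_eq]; omega

theorem centroid_mem_interior : τ.centroid ℝ id ∈ interior (cell τ) := by
  rw [h.mem_interior_cell]
  intro z hz
  rw [affine_centroid _ h.nonempty]
  have hc : (0 : ℝ) < (τ.card : ℝ)⁻¹ := by
    have := h.nonempty.card_pos
    positivity
  refine Finset.sum_pos' (fun y hy => mul_nonneg hc.le ?_) ⟨z, hz, ?_⟩
  · exact h.mem_cell.1 (subset_cell τ hy) z hz
  · rw [h.bary_self hz]; simpa using hc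

theorem volume_cell_pos : 0 < volume (cell τ) :=
  lt_of_lt_of_le (isOpen_interior.measure_pos volume ⟨_, h.centroid_mem_interior⟩)
    (measure_mono interior_subset)

theorem volReal_pos : 0 < volume.real (cell τ) :=
  ENNReal.toReal_pos h.volume_cell_pos.ne' (volume_cell_lt_top τ).ne

end IsSimplex

/-! ### Integration over a simplex by slices parallel to a face -/

/-- Orthogonal coordinates: the coordinate along the unit vector `n`, and the component in the
orthogonal complement. -/
def splitEquiv (n : E d) (hn : ‖n‖ = 1) (p : E d) : ℝ × (Submodule.span ℝ {n})ᗮ ≃ᵐ E d :=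
  (MeasurableEquiv.prodCongr (LinearIsometryEquiv.toSpanUnitSingleton n hn).toMeasurableEquiv
    (MeasurableEquiv.refl _)).trans ((Submodule.span ℝ {n}).measurableEquivProd p).symm

theorem splitEquiv_apply (n : E d) (hn : ‖n‖ = 1) (p : E d) (q : ℝ × (Submodule.span ℝ {n})ᗮ) :
    splitEquiv n hn p q = p + (q.1 • n + q.2) := by
  simp only [splitEquiv, MeasurableEquiv.trans_apply, Submodule.measurableEquivProd_symm_apply,
    vadd_eq_add]
  rw [add_comm]
  rfl

theorem measurePreserving_splitEquiv (n : E d) (hn : ‖n‖ = 1) (p : E d) :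
    MeasurePreserving (splitEquiv n hn p) (volume.prod volume) volume := by
  refine MeasurePreserving.trans (μb := volume.prod volume) ?_ ?_
  · exact ((LinearIsometryEquiv.toSpanUnitSingleton n hn).measurePreserving).prod
      (MeasurePreserving.id _)
  · have := ((Submodule.span ℝ {n}).measurePreserving_measurableEquivProd p).symm
    rwa [InnerProductSpace.euclideanHausdorffMeasure_eq_volume] at this

/-- `e` is the face of the simplex `τ` opposite to the vertex `a`. -/
structure IsFace (τ e : Finset (E d)) (a : E d) : Prop where
  mem : a ∈ τ
  subset : e ⊆ τ
  notMem : a ∉ e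
  card_eq : e.card = d

theorem IsSimplex.eq_or_mem {τ e : Finset (E d)} {a : E d} (h : IsSimplex τ) (hf : IsFace τ e a)
    {z : E d} (hz : z ∈ τ) : z = a ∨ z ∈ e := by
  classical
  have : insert a e = τ := by
    refine Finset.eq_of_subset_of_card_le (Finset.insert_subset hf.mem hf.subset) ?_
    rw [Finset.card_insert_of_notMem hf.notMem, hf.card_eq, h.card_eq]
  rwa [← this, Finset.mem_insert] at hz

theorem IsSimplex.mem_face {τ e : Finset (E d)} {a : E d} (h : IsSimplex τ) (hf : IsFace τ e a)
    {x : E d} : x ∈ cell e ↔ x ∈ cell τ ∧ bary τ a x = 0 := by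
  rw [h.mem_cell_subset hf.subset]
  refine and_congr_right fun _ => ⟨fun H => H a hf.mem hf.notMem, fun H z hz hzs => ?_⟩
  rcases h.eq_or_mem hf hz with rfl | h'
  · exact H
  · exact absurd h' hzs

theorem IsSimplex.exists_isFace {τ e : Finset (E d)} (h : IsSimplex τ) (he : e ⊆ τ)
    (hc : e.card = d) : ∃ a, IsFace τ e a := by
  have : ∃ a ∈ τ, a ∉ e := by
    by_contra! H
    have := Finset.card_le_card (show τ ⊆ e from H)
    rw [h.card_eq, hc] at this
    omega
  obtain ⟨a, ha, hae⟩ := this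
  exact ⟨a, ha, he, hae, hc⟩

theorem IsSimplex.affGrad_ne_zero {τ e : Finset (E d)} {a : E d} (h : IsSimplex τ)
    (hf : IsFace τ e a) (hd : 1 ≤ d) : affGrad (bary τ a) ≠ 0 := by
  intro h0
  have hne : e.Nonempty := by rw [← Finset.card_pos, hf.card_eq]; omega
  obtain ⟨b, hb⟩ := hne
  have h1 := affine_eq (bary τ a) a b
  rw [h0, inner_zero_left, h.bary_self hf.mem,
    h.bary_ne hf.mem (hf.subset hb) (fun hab => hf.notMem (hab ▸ hb))] at h1
  norm_num at h1

theorem contDiff_one_continuous_gradient {ψ : E d → ℝ} (hψ : ContDiff ℝ 1 ψ) :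
    Continuous (gradient ψ) := by
  have : Continuous (fderiv ℝ ψ) := hψ.continuous_fderiv one_ne_zero
  exact (InnerProductSpace.toDual ℝ (E d)).symm.continuous.comp this

theorem hasDerivAt_comp_line {ψ : E d → ℝ} (hψ : ContDiff ℝ 1 ψ) (a w : E d) (t : ℝ) :
    HasDerivAt (fun t : ℝ => ψ (a + t • w)) (inner ℝ w (gradient ψ (a + t • w))) t := by
  have h1 : HasFDerivAt ψ (fderiv ℝ ψ (a + t • w)) (a + t • w) :=
    ((hψ.differentiable one_ne_zero) _).hasFDerivAt
  have h2 : HasDerivAt (fun t : ℝ => a + t • w) w t := by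
    simpa using ((hasDerivAt_id t).smul_const w).const_add a
  have h3 := h1.comp_hasDerivAt t h2
  have h4 : inner ℝ w (gradient ψ (a + t • w)) = fderiv ℝ ψ (a + t • w) w := by
    rw [real_inner_comm]; simp [gradient]
  rw [h4]
  exact h3

/-- The integrand is the derivative of $t^d\psi(a+tw)$, whose value at $0$ vanishes since $d\ge1$.
-/
theorem integral_cone_line (hd : 1 ≤ d) {ψ : E d → ℝ} (hψ : ContDiff ℝ 1 ψ) (a w : E d) :
    ∫ t in (0 : ℝ)..1, t ^ (d - 1) *
      (d * ψ (a + t • w) + inner ℝ (a + t • w - a) (gradient ψ (a + t • w))) = ψ (a + w) := by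
  have hder : ∀ t ∈ uIcc (0 : ℝ) 1, HasDerivAt (fun t : ℝ => t ^ d * ψ (a + t • w))
      (t ^ (d - 1) * (d * ψ (a + t • w)
        + inner ℝ (a + t • w - a) (gradient ψ (a + t • w)))) t := by
    intro t _
    have := (hasDerivAt_pow d t).mul (hasDerivAt_comp_line hψ a w t)
    convert! this using 1
    rw [add_sub_cancel_left, real_inner_smul_left]
    obtain ⟨m, rfl⟩ : ∃ m, d = m + 1 := ⟨d - 1, by omega⟩
    simp only [Nat.add_sub_cancel, pow_succ]
    ring
  rw [intervalIntegral.integral_eq_sub_of_hasDerivAt hder]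
  · have : (0 : ℝ) ^ d = 0 := zero_pow (by omega)
    simp [this]
  · apply Continuous.intervalIntegrable
    have := contDiff_one_continuous_gradient hψ
    have h2 := hψ.continuous
    fun_prop

/-- The face formula: `∫_e ψ ds`, for the face `e` opposite to `a`, as an integral over `τ`. -/
theorem IsSimplex.face_formula {τ e : Finset (E d)} {a : E d} (h : IsSimplex τ)
    (hf : IsFace τ e a) (hd : 1 ≤ d) {ψ : E d → ℝ} (hψ : ContDiff ℝ 1 ψ) :
    ‖affGrad (bary τ a)‖ * ∫ x in cell τ, (d * ψ x + inner ℝ (x - a) (gradient ψ x)) =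
      ∫ x in cell e, ψ x ∂(μHE[d - 1] : Measure (E d)) := by
  set g := affGrad (bary τ a) with hg
  have hg0 : 0 < ‖g‖ := norm_pos_iff.2 (h.affGrad_ne_zero hf hd)
  -- The gradient of the coordinate of $a$ is normal to $e$ and points towards $a$, so `n` points
  -- from $a$ to the plane of $e$. The distance from $a$ to this plane is `hh`, the inverse length
  -- of the gradient.
  set n : E d := (-‖g‖⁻¹) • g with hn
  have hn1 : ‖n‖ = 1 := by rw [hn, norm_smul, norm_neg, norm_inv, norm_norm, inv_mul_cancel₀ hg0.ne']
  set f : E d → ℝ := fun x => d * ψ x + inner ℝ (x - a) (gradient ψ x) with hfdef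
  have hfc : Continuous f := by
    have := contDiff_one_continuous_gradient hψ
    have h2 := hψ.continuous
    fun_prop
  let V := (Submodule.span ℝ {n})ᗮ
  have hVfin : Module.finrank ℝ V = d - 1 := by
    have h1 := (Submodule.span ℝ {n}).finrank_add_finrank_orthogonal
    rw [finrank_span_singleton (by rw [← norm_ne_zero_iff, hn1]; norm_num),
      finrank_euclideanSpace_fin] at h1
    change Module.finrank ℝ (Submodule.span ℝ {n})ᗮ = d - 1
    omega
  let hh := ‖g‖⁻¹
  have hhpos : 0 < hh := inv_pos.2 hg0
  have hgn : inner ℝ g n = -‖g‖ := by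
    rw [hn, inner_smul_right, real_inner_self_eq_norm_sq]; field_simp
  have hgV : ∀ y : V, inner ℝ g (y : E d) = 0 := by
    intro y
    have h1 : inner ℝ n (y : E d) = 0 :=
      Submodule.mem_orthogonal_singleton_iff_inner_right.1 y.2
    rw [hn, inner_smul_left] at h1
    simpa [hg0.ne'] using h1
  -- Cone coordinates: $y\mapsto a+w(y)$ parametrizes the plane of $e$, and $a+t\,w(y)$ with
  -- $0<t\le1$, $y\in\Delta$ runs through $\tau$ without the apex.
  let w : V → E d := fun y => hh • n + y
  have hwc : Continuous w := by fun_prop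
  have hba : ∀ (t : ℝ) (y : V), bary τ a (a + t • w y) = 1 - t := by
    intro t y
    rw [affine_eq (bary τ a) _ a, h.bary_self hf.mem, add_sub_cancel_left, ← hg, inner_smul_right,
      inner_add_right, inner_smul_right, hgV, hgn]
    simp only [hh]; field_simp; ring
  have hbz : ∀ (t : ℝ) (y : V), ∀ z ∈ e,
      bary τ z (a + t • w y) = t * bary τ z (a + w y) := by
    intro t y z hz
    have hza := h.bary_ne (hf.subset hz) hf.mem (fun hab => hf.notMem (hab ▸ hz))
    rw [affine_eq (bary τ z) _ a, affine_eq (bary τ z) (a + w y) a, hza, add_sub_cancel_left,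
      add_sub_cancel_left, inner_smul_right]
    ring
  let Δ : Set V := {y | a + w y ∈ cell e}
  have hcell : ∀ t : ℝ, 0 < t → t ≤ 1 → ∀ y : V, (a + t • w y ∈ cell τ ↔ y ∈ Δ) := by
    intro t ht0 ht1 y
    change _ ↔ a + w y ∈ cell e
    rw [h.mem_face hf, h.mem_cell, h.mem_cell]
    have h1 : bary τ a (a + w y) = 0 := by simpa using hba 1 y
    constructor
    · intro H
      refine ⟨fun z hz => ?_, h1⟩
      rcases h.eq_or_mem hf hz with rfl | hze
      · rw [h1]
      · have := H z hz
        rw [hbz t y z hze] at this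
        exact nonneg_of_mul_nonneg_right this ht0
    · rintro ⟨H, -⟩ z hz
      rcases h.eq_or_mem hf hz with rfl | hze
      · rw [hba]; linarith
      · rw [hbz t y z hze]; exact mul_nonneg ht0.le (H z hz)
  have hout : ∀ t : ℝ, t ∉ Icc (0 : ℝ) 1 → ∀ y : V, a + (t * hh) • n + y ∉ cell τ := by
    intro t ht y hy
    have hb : bary τ a (a + (t * hh) • n + y) = 1 - t := by
      rw [affine_eq (bary τ a) _ a, h.bary_self hf.mem, add_assoc, add_sub_cancel_left, ← hg,
        inner_add_right, inner_smul_right, hgV, hgn]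
      simp only [hh]; field_simp; ring
    have h1 := h.mem_cell.1 hy a hf.mem
    have h2 := h.bary_le_one hy hf.mem
    rw [hb] at h1 h2
    exact ht ⟨by linarith, by linarith⟩
  have hΔc : IsCompact Δ := by
    have hiso : Isometry (fun y : V => a + w y) := by
      refine Isometry.of_dist_eq fun y y' => ?_
      simp [w, Subtype.dist_eq]
    exact hiso.isClosedEmbedding.isCompact_preimage (isCompact_cell e)
  -- slices
  have hint : ∫ x in cell τ, f x = hh * ∫ t in Ioc (0 : ℝ) 1, ∫ y in Δ, t ^ (d - 1) * f (a + t • w y) := by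
    have hfi : Integrable ((cell τ).indicator f) :=
      (hfc.continuousOn.integrableOn_compact (isCompact_cell τ)).integrable_indicator
        (measurableSet_cell τ)
    have hmp := measurePreserving_splitEquiv n hn1 a
    rw [← integral_indicator (measurableSet_cell τ),
      ← hmp.integral_comp' ((cell τ).indicator f), integral_prod]
    · have hsub := Measure.integral_comp_mul_right
        (fun s : ℝ => ∫ y : V, (cell τ).indicator f (splitEquiv n hn1 a (s, y))) hh
      rw [abs_of_pos (inv_pos.2 hhpos), smul_eq_mul] at hsub
      have hsub' : ∫ s : ℝ, ∫ y : V, (cell τ).indicator f (splitEquiv n hn1 a (s, y)) =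
          hh * ∫ t : ℝ, ∫ y : V, (cell τ).indicator f (splitEquiv n hn1 a (t * hh, y)) := by
        rw [hsub]; field_simp
      refine hsub'.trans ?_
      congr 1
      rw [← integral_indicator measurableSet_Ioc]
      refine integral_congr_ae ?_
      have h0 : ∀ᵐ t : ℝ, t ≠ 0 := by
        rw [ae_iff]; simp
      filter_upwards [h0] with t ht0
      by_cases ht : t ∈ Ioc (0 : ℝ) 1
      · rw [indicator_of_mem ht]
        -- The slice at height $t$ is $t\Delta$; rescaling it to $\Delta$, of dimension $d-1$,
        -- produces the factor $t^{d-1}$.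
        have hsc := Measure.integral_comp_smul (volume : Measure V)
          (fun y : V => (cell τ).indicator f (splitEquiv n hn1 a (t * hh, y))) t
        rw [hVfin, abs_of_pos (inv_pos.2 (pow_pos ht.1 _)), smul_eq_mul] at hsc
        have hsc' : ∫ y : V, (cell τ).indicator f (splitEquiv n hn1 a (t * hh, y)) =
            t ^ (d - 1) * ∫ y : V, (cell τ).indicator f (splitEquiv n hn1 a (t * hh, t • y)) := by
          rw [hsc, ← mul_assoc, mul_inv_cancel₀ (pow_pos ht.1 _).ne', one_mul]
        refine hsc'.trans ?_
        rw [integral_const_mul]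
        congr 1
        rw [← integral_indicator hΔc.isClosed.measurableSet]
        refine integral_congr_ae (Eventually.of_forall fun y => ?_)
        have he1 : splitEquiv n hn1 a (t * hh, t • y) = a + t • w y := by
          rw [splitEquiv_apply]
          simp [w, smul_add, mul_smul]
        simp only [he1]
        by_cases hy : y ∈ Δ
        · rw [indicator_of_mem hy, indicator_of_mem ((hcell t ht.1 ht.2 y).2 hy)]
        · rw [indicator_of_notMem hy,
            indicator_of_notMem (fun H => hy ((hcell t ht.1 ht.2 y).1 H))]
      · rw [indicator_of_notMem ht]
        have ht' : t ∉ Icc (0 : ℝ) 1 := fun H => ht ⟨lt_of_le_of_ne H.1 ht0.symm, H.2⟩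
        refine (integral_congr_ae (Eventually.of_forall fun y => ?_)).trans (integral_zero _ _)
        have := hout t ht' y
        simp only [splitEquiv_apply]
        rw [indicator_of_notMem]
        simpa [add_assoc] using this
    · exact hmp.integrable_comp_of_integrable hfi
  -- After Fubini each ray contributes, by `integral_cone_line`, only the value of $\psi$ at its end
  -- point on $e$.
  have hswap : ∫ t in Ioc (0 : ℝ) 1, ∫ y in Δ, t ^ (d - 1) * f (a + t • w y) =
      ∫ y in Δ, ψ (a + w y) := by
    rw [integral_integral_swap]
    · refine integral_congr_ae (Eventually.of_forall fun y => ?_)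
      have := integral_cone_line hd hψ a (w y)
      rw [intervalIntegral.integral_of_le zero_le_one] at this
      exact this
    · rw [Measure.prod_restrict]
      have hc : Continuous (Function.uncurry fun (t : ℝ) (y : V) => t ^ (d - 1) * f (a + t • w y)) := by
        unfold Function.uncurry
        fun_prop
      refine IntegrableOn.mono_set ?_ (prod_mono Ioc_subset_Icc_self subset_rfl)
      exact hc.continuousOn.integrableOn_compact (isCompact_Icc.prod hΔc)
  -- The parametrization of the plane is an isometry, so it carries Lebesgue measure on the
  -- $(d-1)$-dimensional space $V$ to the surface measure.
  have hsurf : ∫ y in Δ, ψ (a + w y) = ∫ x in cell e, ψ x ∂(μHE[d - 1] : Measure (E d)) := by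
    have hiso : Isometry (fun y : V => a + w y) := by
      refine Isometry.of_dist_eq fun y y' => ?_
      simp [w, Subtype.dist_eq]
    have hmap := hiso.map_euclideanHausdorffMeasure (d := d - 1)
    have hvol : (μHE[d - 1] : Measure V) = volume := by
      rw [← hVfin]; exact InnerProductSpace.euclideanHausdorffMeasure_eq_volume
    rw [hvol] at hmap
    have hsub : cell e ⊆ range (fun y : V => a + w y) := by
      intro x hx
      have hx0 := ((h.mem_face hf).1 hx).2
      rw [affine_eq (bary τ a) _ a, h.bary_self hf.mem, ← hg] at hx0
      refine ⟨⟨x - a - hh • n, ?_⟩, ?_⟩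
      · rw [Submodule.mem_orthogonal_singleton_iff_inner_right, hn, inner_smul_left, inner_sub_right,
          ← hn, inner_smul_right, hgn]
        have : inner ℝ g (x - a) = -1 := by linarith
        rw [this]; simp only [hh]; field_simp; simp
      · simp [w]
    have hres : (μHE[d - 1] : Measure (E d)).restrict (cell e) =
        ((volume : Measure V).map (fun y : V => a + w y)).restrict (cell e) := by
      rw [hmap, Measure.restrict_restrict (measurableSet_cell e), inter_eq_left.2 hsub]
    rw [hres, hiso.isClosedEmbedding.measurableEmbedding.setIntegral_map]
    rfl
  rw [hint, hswap, hsurf, ← mul_assoc]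
  simp only [hh]
  rw [mul_inv_cancel₀ hg0.ne', one_mul]

/-! ### Mean values over faces -/

/-- The mean value over the face opposite to the vertex `a` of the simplex `τ` of a function `f`
with gradient `F`, written as an integral over `τ`. -/
def faceMean (τ : Finset (E d)) (a : E d) (f : E d → ℝ) (F : E d → E d) : ℝ :=
  (volume.real (cell τ))⁻¹ * ∫ x in cell τ, (f x + (d : ℝ)⁻¹ * inner ℝ (x - a) (F x))

/-- The surface measure of a face. -/
def surf (e : Finset (E d)) : ℝ := (μHE[d - 1] : Measure (E d)).real (cell e)

theorem continuousOn_integrable_cell {F : Type*} [NormedAddCommGroup F] {f : E d → F}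
    (hf : Continuous f) (s : Finset (E d)) : IntegrableOn f (cell s) :=
  hf.continuousOn.integrableOn_compact (isCompact_cell s)

namespace IsSimplex

variable {τ e : Finset (E d)} {a : E d} (h : IsSimplex τ)
include h

/-- The face formula with $\psi=1$: base measure equals $d$ times volume over height, the height
being the inverse of the gradient length. -/
theorem surf_eq (hf : IsFace τ e a) (hd : 1 ≤ d) :
    surf e = d * volume.real (cell τ) * ‖affGrad (bary τ a)‖ := by
  have := h.face_formula hf hd (ψ := fun _ => 1) contDiff_const
  have hg : ∀ x : E d, gradient (fun _ : E d => (1 : ℝ)) x = 0 := fun x => by simp [gradient]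
  simp only [hg, inner_zero_right, mul_one, add_zero, setIntegral_const, smul_eq_mul] at this
  rw [surf, ← this]; ring

theorem surf_pos (hf : IsFace τ e a) (hd : 1 ≤ d) : 0 < surf e := by
  rw [h.surf_eq hf hd]
  have h1 := h.volReal_pos
  have h2 := norm_pos_iff.2 (h.affGrad_ne_zero hf hd)
  have h3 : (0 : ℝ) < d := by exact_mod_cast hd
  positivity

/-- The real value of an infinite measure is $0$, so positivity of `surf` already excludes this
case. -/
theorem surf_lt_top (hf : IsFace τ e a) (hd : 1 ≤ d) :
    (μHE[d - 1] : Measure (E d)) (cell e) < ⊤ := by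
  by_contra hc
  have := h.surf_pos hf hd
  rw [surf, Measure.real, not_lt_top_iff.1 hc] at this
  simp at this

theorem surf_mul_faceMean (hf : IsFace τ e a) (hd : 1 ≤ d) {ψ : E d → ℝ} (hψ : ContDiff ℝ 1 ψ) :
    surf e * faceMean τ a ψ (gradient ψ) = ∫ x in cell e, ψ x ∂(μHE[d - 1] : Measure (E d)) := by
  rw [← h.face_formula hf hd hψ, h.surf_eq hf hd, faceMean]
  have h1 := h.volReal_pos
  have h3 : (0 : ℝ) < d := by exact_mod_cast hd
  have : ∫ x in cell τ, (d * ψ x + inner ℝ (x - a) (gradient ψ x)) =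
      d * ∫ x in cell τ, (ψ x + (d : ℝ)⁻¹ * inner ℝ (x - a) (gradient ψ x)) := by
    rw [← integral_const_mul]
    congr 1; funext x; field_simp
  rw [this]
  field_simp

/-- The divergence theorem on a simplex: the integral of a gradient as a sum over the faces. -/
theorem integral_inner_grad (hd : 1 ≤ d) {f : E d → ℝ} {F : E d → E d}
    (hfi : IntegrableOn f (cell τ)) (hFi : IntegrableOn F (cell τ)) (w : E d) :
    ∫ x in cell τ, inner ℝ w (F x) =
      -∑ z ∈ τ, d * volume.real (cell τ) * inner ℝ w (affGrad (bary τ z)) * faceMean τ z f F := by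
  have h1 := h.volReal_pos
  have h3 : (0 : ℝ) < d := by exact_mod_cast hd
  have hint : ∀ z : E d, IntegrableOn (fun x => inner ℝ (x - z) (F x)) (cell τ) := by
    intro z
    have hc : Continuous fun x : E d => x - z := by fun_prop
    obtain ⟨C, hC⟩ := (isCompact_cell τ).exists_bound_of_continuousOn hc.continuousOn
    refine Integrable.mono' (hFi.norm.const_mul C) ?_ ?_
    · exact hc.aestronglyMeasurable.inner hFi.aestronglyMeasurable
    · filter_upwards [ae_restrict_mem (measurableSet_cell τ)] with x hx
      exact (norm_inner_le_norm _ _).trans (mul_le_mul_of_nonneg_right (hC x hx) (norm_nonneg _))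
  -- This identity is pointwise and purely algebraic: the terms with $f$ drop out since the
  -- gradients of the barycentric coordinates sum to zero. Hence $f$ and $F$ need not be related
  -- here; the relation enters only through the meaning of `faceMean`.
  have hpt : ∀ x, inner ℝ w (F x) = -∑ z ∈ τ, inner ℝ w (affGrad (bary τ z)) *
      (d * f x + inner ℝ (x - z) (F x)) := by
    intro x
    have e1 := congrArg (fun v => inner ℝ w v) (h.sum_inner_smul_affGrad x (F x))
    have e2 := congrArg (fun v => inner ℝ w v) h.sum_affGrad_bary
    simp only [inner_sum, inner_neg_right, inner_smul_right, inner_zero_right] at e1 e2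
    simp only [mul_add, Finset.sum_add_distrib, ← Finset.sum_mul, e2]
    rw [zero_mul, zero_add, eq_neg_iff_add_eq_zero, add_comm, ← eq_neg_iff_add_eq_zero, ← e1]
    exact Finset.sum_congr rfl fun z _ => by ring
  have hE : ∀ z ∈ τ, ∫ x in cell τ, inner ℝ w (affGrad (bary τ z)) *
      (d * f x + inner ℝ (x - z) (F x)) =
      d * volume.real (cell τ) * inner ℝ w (affGrad (bary τ z)) * faceMean τ z f F := by
    intro z _
    rw [faceMean]
    have : ∀ x, inner ℝ w (affGrad (bary τ z)) * (d * f x + inner ℝ (x - z) (F x)) =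
      (inner ℝ w (affGrad (bary τ z)) * d) * (f x + (d : ℝ)⁻¹ * inner ℝ (x - z) (F x)) := by
      intro x; field_simp
    simp_rw [this]
    rw [integral_const_mul]; field_simp
  simp_rw [hpt]
  rw [integral_neg, integral_finsetSum _ fun z _ => ?_]
  · rw [Finset.sum_congr rfl hE]
  · exact ((hfi.const_mul (d : ℝ)).add (hint z)).const_mul _

/-- If `ψ` vanishes on all faces but one, then the integral of `ψ` over this face is an integral of
a directional derivative. -/
theorem integral_face_eq_neg (hf : IsFace τ e a) (hd : 1 ≤ d) {ψ : E d → ℝ}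
    (hψ : ContDiff ℝ 1 ψ) (h0 : ∀ z ∈ e, ∀ x, bary τ z x = 0 → ψ x = 0) :
    ∫ x in cell e, ψ x ∂(μHE[d - 1] : Measure (E d)) =
      -∫ x in cell τ, inner ℝ (‖affGrad (bary τ a)‖⁻¹ • affGrad (bary τ a)) (gradient ψ x) := by
  classical
  set g := affGrad (bary τ a)
  have hg0 : 0 < ‖g‖ := norm_pos_iff.2 (h.affGrad_ne_zero hf hd)
  rw [h.integral_inner_grad hd (continuousOn_integrable_cell hψ.continuous τ)
    (continuousOn_integrable_cell (contDiff_one_continuous_gradient hψ) τ), neg_neg,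
    Finset.sum_eq_single_of_mem a hf.mem]
  · rw [← h.surf_mul_faceMean hf hd hψ, h.surf_eq hf hd, inner_smul_left,
      real_inner_self_eq_norm_sq]
    simp only [map_inv₀, conj_trivial, show ‖affGrad (bary τ a)‖ = ‖g‖ from rfl]
    field_simp
  -- The face opposite to any other vertex $z$ lies in the zero set of the coordinate of $z$, where
  -- $\psi$ vanishes.
  · intro z hz hza
    have hze : z ∈ e := (h.eq_or_mem hf hz).resolve_left hza
    have hf' : IsFace τ (τ.erase z) z :=
      ⟨hz, Finset.erase_subset _ _, by simp, by rw [Finset.card_erase_of_mem hz, h.card_eq]; rfl⟩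
    have h1 := h.surf_mul_faceMean hf' hd hψ
    have h2 : ∫ x in cell (τ.erase z), ψ x ∂(μHE[d - 1] : Measure (E d)) = 0 := by
      rw [setIntegral_congr_fun (g := fun _ => (0 : ℝ)) (measurableSet_cell _), integral_zero]
      intro x hx
      exact h0 z hze x ((h.mem_face hf').1 hx).2
    rw [h2, mul_eq_zero] at h1
    rw [h1.resolve_left (h.surf_pos hf' hd).ne', mul_zero]

/-- The relative boundary of a face has surface measure zero. -/
theorem surface_null (hf : IsFace τ e a) (hd : 1 ≤ d) {z : E d} (hz : z ∈ e) :
    (μHE[d - 1] : Measure (E d)) (cell e ∩ {x | bary τ z x = 0}) = 0 := by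
  set σ : Measure (E d) := μHE[d - 1]
  set S := cell e ∩ {x | bary τ z x = 0}
  have hzτ := hf.subset hz
  have hza : z ≠ a := fun H => hf.notMem (H ▸ hz)
  have hS : MeasurableSet S := (measurableSet_cell e).inter
    (isClosed_eq (continuous_affine _) continuous_const).measurableSet
  have hfin : σ S < ⊤ := (measure_mono inter_subset_left).trans_lt (h.surf_lt_top hf hd)
  -- Test the face formula with $(1-\lambda_z)^m$, which equals $1$ on $S$. Since $\lambda_z(a)=0$,
  -- the radial derivative $(x-a)\cdot\nabla$ of this function is
  -- $-m(1-\lambda_z)^{m-1}\lambda_z\le0$ and can be dropped. The remaining volume integral tends to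
  -- $0$ as $m\to\infty$, because $\lambda_z>0$ in the interior.
  have hle : ∀ m : ℕ, σ.real S ≤ ‖affGrad (bary τ a)‖ *
      ∫ x in cell τ, d * (1 - bary τ z x) ^ m := by
    intro m
    have hcd : ContDiff ℝ 1 (fun x => (1 - bary τ z x) ^ m) :=
      (contDiff_const.sub ((contDiff_affine _).of_le (by exact_mod_cast le_top))).pow m
    have hb := h.face_formula hf hd hcd
    have h1 : σ.real S ≤ ∫ x in cell e, (1 - bary τ z x) ^ m ∂σ := by
      have : IsFiniteMeasure (σ.restrict (cell e)) := ⟨by simpa using h.surf_lt_top hf hd⟩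
      have e1 : σ.real S = ∫ x in cell e, S.indicator (fun _ => (1 : ℝ)) x ∂σ := by
        rw [integral_indicator hS, Measure.restrict_restrict hS, inter_eq_left.2 inter_subset_left,
          setIntegral_const]; simp [S]
      rw [e1]
      refine setIntegral_mono_on ?_ ?_ (measurableSet_cell e) fun x hx => ?_
      · exact (integrable_const (1 : ℝ)).indicator hS
      · have hc : ContinuousOn (fun x => (1 - bary τ z x) ^ m) (cell e) := hcd.continuous.continuousOn
        obtain ⟨C, hC⟩ := (isCompact_cell e).exists_bound_of_continuousOn hc
        exact Integrable.mono' (integrable_const C) hcd.continuous.aestronglyMeasurable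
          ((ae_restrict_mem (measurableSet_cell e)).mono hC)
      · by_cases hxS : x ∈ S
        · rw [indicator_of_mem hxS, hxS.2]; simp
        · rw [indicator_of_notMem hxS]
          exact pow_nonneg (sub_nonneg.2 (h.bary_le_one ((h.mem_face hf).1 hx).1 hzτ)) _
    refine h1.trans (hb.symm.le.trans (mul_le_mul_of_nonneg_left ?_ (norm_nonneg _)))
    refine setIntegral_mono_on ?_ ?_ (measurableSet_cell τ) fun x hx => ?_
    · refine continuousOn_integrable_cell ?_ τ
      have := contDiff_one_continuous_gradient hcd
      have := hcd.continuous
      fun_prop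
    · exact continuousOn_integrable_cell (hcd.continuous.const_mul _) τ
    · have hgr : inner ℝ (x - a) (gradient (fun x => (1 - bary τ z x) ^ m) x) =
          -(m * (1 - bary τ z x) ^ (m - 1) * bary τ z x) := by
        have hd1 := hasDerivAt_comp_line hcd x (x - a) 0
        simp only [zero_smul, add_zero] at hd1
        rw [← hd1.deriv]
        have e3 : bary τ z x = inner ℝ (affGrad (bary τ z)) (x - a) := by
          rw [affine_eq (bary τ z) x a, h.bary_ne hzτ hf.mem hza, zero_add]
        have e2 : (fun t : ℝ => (1 - bary τ z (x + t • (x - a))) ^ m) =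
            fun t : ℝ => (1 - (bary τ z x + t * bary τ z x)) ^ m := by
          funext t
          rw [affine_eq (bary τ z) (x + t • (x - a)) x, add_sub_cancel_left, inner_smul_right,
            ← e3]
        rw [e2]
        have hq : HasDerivAt (fun t : ℝ => 1 - (bary τ z x + t * bary τ z x)) (-bary τ z x) 0 := by
          simpa using (((hasDerivAt_id (0 : ℝ)).mul_const (bary τ z x)).const_add
            (bary τ z x)).const_sub 1
        rw [(hq.fun_pow m).deriv]
        simp
      have hb0 := h.mem_cell.1 hx z hzτ
      have hb1 := h.bary_le_one hx hzτ
      rw [hgr]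
      have : 0 ≤ (m : ℝ) * (1 - bary τ z x) ^ (m - 1) * bary τ z x :=
        mul_nonneg (mul_nonneg (Nat.cast_nonneg _) (pow_nonneg (by linarith) _)) hb0
      linarith
  have hlim : Tendsto (fun m : ℕ => ‖affGrad (bary τ a)‖ *
      ∫ x in cell τ, d * (1 - bary τ z x) ^ m) atTop (𝓝 (‖affGrad (bary τ a)‖ *
      ∫ x in cell τ, (0 : ℝ))) := by
    refine Tendsto.const_mul _ (tendsto_integral_of_dominated_convergence (fun _ => (d : ℝ)) ?_ ?_ ?_ ?_)
    · intro m
      have := continuous_affine (bary τ z)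
      exact (by fun_prop : Continuous fun x => (d : ℝ) * (1 - bary τ z x) ^ m).aestronglyMeasurable
    · exact continuousOn_integrable_cell continuous_const τ
    · intro m
      filter_upwards [ae_restrict_mem (measurableSet_cell τ)] with x hx
      have hb0 := h.mem_cell.1 hx z hzτ
      have hb1 := h.bary_le_one hx hzτ
      rw [Real.norm_of_nonneg (by have := pow_nonneg (sub_nonneg.2 hb1) m; positivity)]
      exact mul_le_of_le_one_right (Nat.cast_nonneg _) (pow_le_one₀ (by linarith) (by linarith))
    · filter_upwards [ae_mem_interior_cell τ, ae_restrict_mem (measurableSet_cell τ)] with x hx hxc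
      have hb0 := h.mem_interior_cell.1 hx z hzτ
      have hb1 := h.bary_le_one hxc hzτ
      have := (tendsto_pow_atTop_nhds_zero_of_lt_one (r := 1 - bary τ z x) (by linarith)
        (by linarith)).const_mul (d : ℝ)
      simpa using this
  rw [integral_zero, mul_zero] at hlim
  have := ge_of_tendsto' hlim hle
  have h0 : σ.real S = 0 := le_antisymm this measureReal_nonneg
  rwa [measureReal_eq_zero_iff hfin.ne] at h0

end IsSimplex

/-! ### Geometry of conforming meshes -/

theorem centroid_mem_cell {s : Finset (E d)} (hs : s.Nonempty) : s.centroid ℝ id ∈ cell s := by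
  have := s.centroid_mem_convexHull (R := ℝ) hs
  simpa [cell] using this

namespace IsSimplex

variable {τ e : Finset (E d)} {a : E d} (h : IsSimplex τ)
include h

theorem bary_centroid_face_pos (hf : IsFace τ e a) {z : E d} (hz : z ∈ e) :
    0 < bary τ z (e.centroid ℝ id) := by
  rw [affine_centroid _ ⟨z, hz⟩]
  have hc : (0 : ℝ) < (e.card : ℝ)⁻¹ := by
    have := Finset.card_pos.2 ⟨z, hz⟩
    positivity
  refine Finset.sum_pos' (fun y hy => mul_nonneg hc.le ?_) ⟨z, hz, ?_⟩
  · exact h.mem_cell.1 (subset_cell τ (hf.subset hy)) z (hf.subset hz)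
  · rw [h.bary_self (hf.subset hz)]; simpa using hc

theorem frontier_of_bary_eq_zero {x : E d} (hx : x ∈ cell τ) {z : E d} (hz : z ∈ τ)
    (h0 : bary τ z x = 0) : x ∈ frontier (cell τ) :=
  ⟨subset_closure hx, fun hi => (h.mem_interior_cell.1 hi z hz).ne' h0⟩

/-- Two simplices with a common face have the same barycentric coordinates on it. -/
theorem bary_eq_on_face {τ' : Finset (E d)} (h' : IsSimplex τ') (hs : e ⊆ τ) (hs' : e ⊆ τ')
    {z x : E d} (hz : z ∈ e) (hx : x ∈ cell e) : bary τ' z x = bary τ z x := by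
  rw [h.affine_eq_sum (bary τ' z) x, Finset.sum_eq_single_of_mem z (hs hz), h'.bary_self (hs' hz),
    mul_one]
  intro y hy hyz
  by_cases hye : y ∈ e
  · rw [h'.bary_ne (hs' hz) (hs' hye) hyz.symm, mul_zero]
  · rw [((h.mem_cell_subset hs).1 hx).2 y hy hye, zero_mul]

end IsSimplex

namespace Mesh

variable (T : Mesh d) {τ τ' e : Finset (E d)} {a a' : E d}

theorem subset_of_isFace_eq (hτ : τ ∈ T.elements) (hτ' : τ' ∈ T.elements) (hf : IsFace τ e a)
    (he' : e ⊆ τ') (ha : a ∈ τ') : τ = τ' := by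
  refine Finset.eq_of_subset_of_card_le (fun z hz => ?_) ?_
  · rcases (T.isSimplex hτ).eq_or_mem hf hz with rfl | hze
    exacts [ha, he' hze]
  · rw [T.card_eq _ hτ, T.card_eq _ hτ']

/-- Some vertex $z$ of $\tau$ is not a vertex of $\tau'$. By conformity the intersection lies in the
hull of the common vertices, where the coordinate of $z$ vanishes. -/
theorem cell_inter_subset_frontier (hτ : τ ∈ T.elements) (hτ' : τ' ∈ T.elements) (hne : τ ≠ τ') :
    cell τ ∩ cell τ' ⊆ frontier (cell τ) := by
  have : ∃ z ∈ τ, z ∉ τ' := by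
    by_contra! H
    exact hne (Finset.eq_of_subset_of_card_le H (by rw [T.card_eq _ hτ, T.card_eq _ hτ']))
  obtain ⟨z, hz, hz'⟩ := this
  intro x hx
  have h1 := T.conforming τ hτ τ' hτ' hx
  have h := T.isSimplex hτ
  refine h.frontier_of_bary_eq_zero hx.1 hz ?_
  have hconv : Convex ℝ {y | bary τ z y = 0} :=
    (convex_singleton (0 : ℝ)).affine_preimage (bary τ z)
  refine convexHull_min ?_ hconv h1
  intro y hy
  exact h.bary_ne hz hy.1 (fun hzy => hz' (hzy ▸ hy.2))

theorem aedisjoint_cell (hτ : τ ∈ T.elements) (hτ' : τ' ∈ T.elements) (hne : τ ≠ τ') :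
    AEDisjoint volume (cell τ) (cell τ') :=
  measure_mono_null (T.cell_inter_subset_frontier hτ hτ' hne) (volume_frontier_cell τ)

theorem disjoint_interior_cell (hτ : τ ∈ T.elements) (hτ' : τ' ∈ T.elements) (hne : τ ≠ τ') :
    Disjoint (interior (cell τ)) (interior (cell τ')) := by
  rw [Set.disjoint_left]
  intro x hx hx'
  exact (T.cell_inter_subset_frontier hτ hτ' hne ⟨interior_subset hx, interior_subset hx'⟩).2 hx

/-- The integral over the union of the elements is the sum of the integrals over the elements. -/
theorem restrict_iUnion_cell : volume.restrict (⋃ τ ∈ T.elements, cell τ) =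
    ∑ τ ∈ T.elements, volume.restrict (cell τ) := by
  classical
  have key : ∀ s ⊆ T.elements, volume.restrict (⋃ τ ∈ s, cell τ) =
      ∑ τ ∈ s, volume.restrict (cell τ) := by
    intro s
    induction s using Finset.induction_on with
    | empty => intro _; simp
    | insert τ s hτ ih =>
      intro hs
      rw [Finset.set_biUnion_insert, Finset.sum_insert hτ, Measure.restrict_union₀, ih
        ((Finset.subset_insert _ _).trans hs)]
      · rw [AEDisjoint, inter_iUnion₂]
        refine (measure_biUnion_null_iff s.countable_toSet).2 fun τ' hτ' => ?_
        exact T.aedisjoint_cell (hs (Finset.mem_insert_self _ _))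
          (hs (Finset.mem_insert_of_mem hτ')) (fun H => hτ (H ▸ hτ'))
      · exact (Finset.measurableSet_biUnion _ fun τ _ => measurableSet_cell τ).nullMeasurableSet
  exact key _ subset_rfl

variable {T}

/-- Points of the closed union outside $\Omega$ lie on frontiers of elements. These are null sets,
as are the overlaps of distinct elements. -/
theorem Triangulates.restrict_eq {Ω : Set (E d)} (hΩ : T.Triangulates Ω) :
    volume.restrict Ω = ∑ τ ∈ T.elements, volume.restrict (cell τ) := by
  rw [← T.restrict_iUnion_cell]
  refine Measure.restrict_congr_set ?_
  set U := ⋃ τ ∈ T.elements, cell τ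
  have hsub : Ω ⊆ U := hΩ.exact ▸ interior_subset
  refine (LE.le.eventuallyLE hsub).antisymm ?_
  rw [ae_le_set]
  refine measure_mono_null (t := ⋃ τ ∈ T.elements, frontier (cell τ)) ?_
    ((measure_biUnion_null_iff T.elements.countable_toSet).2 fun τ _ => volume_frontier_cell τ)
  rintro x ⟨hxU, hxΩ⟩
  obtain ⟨τ, hτ, hx⟩ := mem_iUnion₂.1 hxU
  refine mem_iUnion₂.2 ⟨τ, hτ, subset_closure hx, fun hi => hxΩ ?_⟩
  rw [hΩ.exact]
  exact interior_mono (subset_biUnion_of_mem (u := fun τ => cell τ) hτ) hi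

theorem Triangulates.restrict_cell_le {Ω : Set (E d)} (hΩ : T.Triangulates Ω)
    (hτ : τ ∈ T.elements) : volume.restrict (cell τ) ≤ volume.restrict Ω := by
  rw [hΩ.restrict_eq]
  exact Finset.single_le_sum (f := fun τ => volume.restrict (cell τ)) (fun _ _ => Measure.zero_le _) hτ

theorem Triangulates.integral_eq {Ω : Set (E d)} (hΩ : T.Triangulates Ω) {f : E d → ℝ}
    (hf : ∀ τ ∈ T.elements, IntegrableOn f (cell τ)) :
    ∫ x in Ω, f x = ∑ τ ∈ T.elements, ∫ x in cell τ, f x := by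
  rw [hΩ.restrict_eq, integral_finsetSum_measure hf]

variable (T)

/-- Elements on the two sides of a common face: the barycentric coordinates of the opposite
vertices are negative multiples of each other. -/
theorem opposite_sides (hd : 1 ≤ d) (hτ : τ ∈ T.elements) (hτ' : τ' ∈ T.elements) (hne : τ ≠ τ')
    (hf : IsFace τ e a) (hf' : IsFace τ' e a') :
    bary τ a a' < 0 ∧ ∀ x, bary τ a x = bary τ a a' * bary τ' a' x := by
  have h := T.isSimplex hτ
  have h' := T.isSimplex hτ'
  -- The coordinate of $a$ vanishes at the vertices of $e$, so only $a'$ survives in its expansion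
  -- over the vertices of $\tau'$.
  have hprop : ∀ x, bary τ a x = bary τ a a' * bary τ' a' x := by
    intro x
    rw [h'.affine_eq_sum (bary τ a) x, Finset.sum_eq_single_of_mem a' hf'.mem, mul_comm]
    intro z hz hza
    have hze := (h'.eq_or_mem hf' hz).resolve_left hza
    rw [h.bary_ne hf.mem (hf.subset hze) (fun H => hf.notMem (H ▸ hze)), mul_zero]
  refine ⟨?_, hprop⟩
  by_contra! hc
  rcases hc.eq_or_lt with hc | hc
  · have := hprop a
    rw [h.bary_self hf.mem, ← hc, zero_mul] at this
    exact one_ne_zero this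
  -- If the factor were positive, a short step from the centroid of $e$ towards $a'$ would end in
  -- both elements, with a positive coordinate of $a$. Conformity puts the point into the hull of
  -- the common vertices; $a$ is not among them, so this coordinate is zero.
  · set x0 := e.centroid ℝ id
    have hene : e.Nonempty := by rw [← Finset.card_pos, hf.card_eq]; omega
    have hx0 : x0 ∈ cell e := centroid_mem_cell hene
    have hlin : ∀ (A : E d →ᵃ[ℝ] ℝ) (t : ℝ), A (AffineMap.lineMap x0 a' t) =
        (1 - t) * A x0 + t * A a' := by
      intro A t
      rw [AffineMap.apply_lineMap, AffineMap.lineMap_apply_ring]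
    have hev : ∀ᶠ t : ℝ in 𝓝[>] 0, ∀ z ∈ e, 0 ≤ bary τ z (AffineMap.lineMap x0 a' t) := by
      rw [Filter.eventually_all_finset]
      intro z hz
      have hpos := h.bary_centroid_face_pos hf hz
      have hcont : Tendsto (fun t : ℝ => (1 - t) * bary τ z x0 + t * bary τ z a') (𝓝[>] 0)
          (𝓝 ((1 - 0) * bary τ z x0 + 0 * bary τ z a')) :=
        ((by fun_prop : Continuous fun t : ℝ => (1 - t) * bary τ z x0 + t * bary τ z a').tendsto
          0).mono_left nhdsWithin_le_nhds
      have := hcont.eventually (lt_mem_nhds (by simpa using hpos : (0:ℝ) < _))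
      filter_upwards [this] with t ht
      rw [hlin]; exact ht.le
    have hev2 : ∀ᶠ t : ℝ in 𝓝[>] 0, t ∈ Ioo (0 : ℝ) 1 := Ioo_mem_nhdsGT one_pos
    obtain ⟨t, ht, ht01⟩ := (hev.and hev2).exists
    set xt := AffineMap.lineMap x0 a' t
    have hbx0 : bary τ a x0 = 0 := ((h.mem_face hf).1 hx0).2
    have hbxt : 0 < bary τ a xt := by
      rw [hlin, hbx0]; have := mul_pos ht01.1 hc; linarith
    have hxt : xt ∈ cell τ := by
      rw [h.mem_cell]
      intro z hz
      rcases h.eq_or_mem hf hz with rfl | hze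
      exacts [hbxt.le, ht z hze]
    have hxt' : xt ∈ cell τ' := (convex_cell τ').lineMap_mem ((h'.mem_face hf').1 hx0).1
      (subset_cell τ' hf'.mem) ⟨ht01.1.le, ht01.2.le⟩
    have hmem := T.conforming τ hτ τ' hτ' ⟨hxt, hxt'⟩
    have hconv : Convex ℝ {y | bary τ a y = 0} :=
      (convex_singleton (0 : ℝ)).affine_preimage (bary τ a)
    have h0 : xt ∈ {y | bary τ a y = 0} := by
      refine convexHull_min ?_ hconv hmem
      intro y hy
      refine h.bary_ne hf.mem hy.1 (fun H => ?_)
      exact hne (T.subset_of_isFace_eq hτ hτ' hf hf'.subset (H ▸ hy.2))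
    exact hbxt.ne' h0

/-- The negative proportionality in `opposite_sides` passes to the gradients, and normalization
removes the factor: the unit normals of the two sides are opposite. -/
theorem affGrad_opposite (hd : 1 ≤ d) (hτ : τ ∈ T.elements) (hτ' : τ' ∈ T.elements) (hne : τ ≠ τ')
    (hf : IsFace τ e a) (hf' : IsFace τ' e a') :
    ‖affGrad (bary τ a)‖⁻¹ • affGrad (bary τ a) =
      -(‖affGrad (bary τ' a')‖⁻¹ • affGrad (bary τ' a')) := by
  obtain ⟨hneg, hprop⟩ := T.opposite_sides hd hτ hτ' hne hf hf'
  set c := bary τ a a'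
  have hg : affGrad (bary τ a) = c • affGrad (bary τ' a') := by
    refine ext_inner_right ℝ fun w => ?_
    have e1 := affine_eq (bary τ a) w 0
    have e2 := affine_eq (bary τ' a') w 0
    rw [hprop w, hprop 0, sub_zero] at e1
    rw [sub_zero] at e2
    rw [inner_smul_left]
    simp only [conj_trivial]
    rw [e2] at e1
    linarith
  have h' := norm_pos_iff.2 ((T.isSimplex hτ').affGrad_ne_zero hf' hd)
  rw [hg, norm_smul, smul_smul, Real.norm_of_nonpos hneg.le, ← neg_smul]
  congr 1
  have := hneg.ne
  field_simp

/-- A sign argument: with three distinct elements on $e$ the coordinate of $a$ at $a''$ would be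
negative, yet also the product of two negative numbers. -/
theorem eq_of_shared_face (hd : 1 ≤ d) {τ'' : Finset (E d)} (hτ : τ ∈ T.elements)
    (hτ' : τ' ∈ T.elements) (hτ'' : τ'' ∈ T.elements) (he : e ⊆ τ) (he' : e ⊆ τ') (he'' : e ⊆ τ'')
    (hc : e.card = d) (hne : τ' ≠ τ) (hne' : τ'' ≠ τ) : τ' = τ'' := by
  obtain ⟨a, hf⟩ := (T.isSimplex hτ).exists_isFace he hc
  obtain ⟨a', hf'⟩ := (T.isSimplex hτ').exists_isFace he' hc
  obtain ⟨a'', hf''⟩ := (T.isSimplex hτ'').exists_isFace he'' hc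
  by_contra hne''
  obtain ⟨h1, e1⟩ := T.opposite_sides hd hτ hτ' hne.symm hf hf'
  obtain ⟨h2, -⟩ := T.opposite_sides hd hτ hτ'' hne'.symm hf hf''
  obtain ⟨h3, -⟩ := T.opposite_sides hd hτ' hτ'' hne'' hf' hf''
  have := e1 a''
  have := mul_pos_of_neg_of_neg h1 h3
  linarith

end Mesh

/-- A neighbourhood of the relative interior of a common face. -/
def faceNhd (τ τ' e : Finset (E d)) : Set (E d) :=
  {x | ∀ z ∈ e, 0 < bary τ z x ∧ 0 < bary τ' z x}

theorem isOpen_faceNhd (τ τ' e : Finset (E d)) : IsOpen (faceNhd τ τ' e) := by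
  have : faceNhd τ τ' e = ⋂ z ∈ e, {x | 0 < bary τ z x ∧ 0 < bary τ' z x} := by
    ext x; simp [faceNhd]
  rw [this]
  refine isOpen_biInter_finset fun z _ => ?_
  exact (isOpen_lt continuous_const (continuous_affine _)).inter
    (isOpen_lt continuous_const (continuous_affine _))

/-- The sign of the coordinate of $a$ decides the side; the other coordinates are positive on
`faceNhd`. Cut-offs supported there therefore see only the two elements at the face. -/
theorem Mesh.faceNhd_subset (T : Mesh d) {τ τ' e : Finset (E d)} {a a' : E d} (hd : 1 ≤ d)
    (hτ : τ ∈ T.elements) (hτ' : τ' ∈ T.elements) (hne : τ ≠ τ') (hf : IsFace τ e a)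
    (hf' : IsFace τ' e a') : faceNhd τ τ' e ⊆ cell τ ∪ cell τ' := by
  intro x hx
  have h := T.isSimplex hτ
  have h' := T.isSimplex hτ'
  obtain ⟨hneg, hprop⟩ := T.opposite_sides hd hτ hτ' hne hf hf'
  rcases le_or_gt 0 (bary τ a x) with h0 | h0
  · left
    rw [h.mem_cell]
    intro z hz
    rcases h.eq_or_mem hf hz with rfl | hze
    exacts [h0, (hx z hze).1.le]
  · right
    rw [h'.mem_cell]
    intro z hz
    rcases h'.eq_or_mem hf' hz with rfl | hze
    · rw [hprop x] at h0
      exact (pos_of_mul_neg_right h0 hneg.le).le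
    · exact (hx z hze).2.le

/-! ### Square integrable functions -/

section L2

variable {α F : Type*} [MeasurableSpace α] {μ : Measure α} [NormedAddCommGroup F]
  [InnerProductSpace ℝ F]

theorem integral_inner_eq_inner_toLp {u w : α → F} (hu : MemLp u 2 μ) (hw : MemLp w 2 μ) :
    ∫ x, inner ℝ (u x) (w x) ∂μ = inner ℝ (hu.toLp u) (hw.toLp w) := by
  rw [L2.inner_def]
  refine integral_congr_ae ?_
  filter_upwards [hu.coeFn_toLp, hw.coeFn_toLp] with x h1 h2
  rw [h1, h2]

theorem integral_norm_sq_eq_norm_toLp {u : α → F} (hu : MemLp u 2 μ) :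
    ∫ x, ‖u x‖ ^ 2 ∂μ = ‖hu.toLp u‖ ^ 2 := by
  rw [← real_inner_self_eq_norm_sq, ← integral_inner_eq_inner_toLp]
  simp_rw [real_inner_self_eq_norm_sq]

theorem integrable_inner_of_memLp {u w : α → F} (hu : MemLp u 2 μ) (hw : MemLp w 2 μ) :
    Integrable (fun x => inner ℝ (u x) (w x)) μ := by
  refine (L2.integrable_inner (𝕜 := ℝ) (hu.toLp u) (hw.toLp w)).congr ?_
  filter_upwards [hu.coeFn_toLp, hw.coeFn_toLp] with x h1 h2
  rw [h1, h2]

/-- The Cauchy-Schwarz inequality. -/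
theorem abs_integral_inner_le {u w : α → F} (hu : MemLp u 2 μ) (hw : MemLp w 2 μ) :
    |∫ x, inner ℝ (u x) (w x) ∂μ| ≤
      Real.sqrt (∫ x, ‖u x‖ ^ 2 ∂μ) * Real.sqrt (∫ x, ‖w x‖ ^ 2 ∂μ) := by
  rw [integral_inner_eq_inner_toLp hu hw, integral_norm_sq_eq_norm_toLp hu,
    integral_norm_sq_eq_norm_toLp hw, Real.sqrt_sq (norm_nonneg _), Real.sqrt_sq (norm_nonneg _)]
  exact abs_real_inner_le_norm _ _

theorem tendsto_integral_inner {u : ℕ → α → F} {v w : α → F} (hu : ∀ k, MemLp (u k) 2 μ)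
    (hv : MemLp v 2 μ) (hw : MemLp w 2 μ)
    (hlim : Tendsto (fun k => eLpNorm (u k - v) 2 μ) atTop (𝓝 0)) :
    Tendsto (fun k => ∫ x, inner ℝ (w x) (u k x) ∂μ) atTop (𝓝 (∫ x, inner ℝ (w x) (v x) ∂μ)) := by
  simp_rw [integral_inner_eq_inner_toLp hw (hu _), integral_inner_eq_inner_toLp hw hv]
  exact Tendsto.inner tendsto_const_nhds ((Lp.tendsto_Lp_iff_tendsto_eLpNorm'' u hu v hv).2 hlim)

theorem tendsto_integral_norm_sq {u : ℕ → α → F} {v : α → F} (hu : ∀ k, MemLp (u k) 2 μ)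
    (hv : MemLp v 2 μ) (hlim : Tendsto (fun k => eLpNorm (u k - v) 2 μ) atTop (𝓝 0)) :
    Tendsto (fun k => ∫ x, ‖u k x‖ ^ 2 ∂μ) atTop (𝓝 (∫ x, ‖v x‖ ^ 2 ∂μ)) := by
  simp_rw [integral_norm_sq_eq_norm_toLp (hu _), integral_norm_sq_eq_norm_toLp hv]
  exact (((Lp.tendsto_Lp_iff_tendsto_eLpNorm'' u hu v hv).2 hlim).norm).pow 2

end L2

theorem memLp_two_cell {F : Type*} [NormedAddCommGroup F] {f : E d → F} (hf : Continuous f)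
    {μ : Measure (E d)} {s : Finset (E d)} (hμ : μ (cell s) < ⊤) :
    MemLp f 2 (μ.restrict (cell s)) := by
  have : IsFiniteMeasure (μ.restrict (cell s)) := ⟨by simpa using hμ⟩
  obtain ⟨C, hC⟩ := (isCompact_cell s).exists_bound_of_continuousOn hf.continuousOn
  exact MemLp.of_bound hf.aestronglyMeasurable C
    ((ae_restrict_mem (measurableSet_cell s)).mono hC)

theorem inner_gradient (ψ : E d → ℝ) (x w : E d) :
    inner ℝ w (gradient ψ x) = fderiv ℝ ψ x w := by
  rw [real_inner_comm]; simp [gradient]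

theorem inner_gradient_mul {χ ψ : E d → ℝ} (hχ : ContDiff ℝ 1 χ) (hψ : ContDiff ℝ 1 ψ)
    (x w : E d) : inner ℝ w (gradient (fun y => χ y * ψ y) x) =
      inner ℝ w (gradient χ x) * ψ x + χ x * inner ℝ w (gradient ψ x) := by
  rw [inner_gradient, inner_gradient, inner_gradient,
    fderiv_fun_mul (hχ.differentiable one_ne_zero x) (hψ.differentiable one_ne_zero x)]
  simp; ring

/-! ### Approximation by smooth functions on an element -/

/-- `φ`, with gradient `G`, is the `H¹` limit of the smooth functions `Φ` on a cell. -/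
structure Approximates (s : Finset (E d)) (φ : E d → ℝ) (G : E d → E d)
    (Φ : ℕ → E d → ℝ) : Prop where
  contDiff : ∀ k, ContDiff ℝ 1 (Φ k)
  memLp : MemLp φ 2 (volume.restrict (cell s))
  grad_memLp : MemLp G 2 (volume.restrict (cell s))
  lim : Tendsto (fun k => eLpNorm (Φ k - φ) 2 (volume.restrict (cell s))) atTop (𝓝 0)
  grad_lim : Tendsto (fun k => eLpNorm (gradient (Φ k) - G) 2 (volume.restrict (cell s)))
    atTop (𝓝 0)

namespace Approximates

variable {s : Finset (E d)} {φ : E d → ℝ} {G : E d → E d} {Φ : ℕ → E d → ℝ}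
  (hA : Approximates s φ G Φ)
include hA

theorem memLp_apx (k : ℕ) : MemLp (Φ k) 2 (volume.restrict (cell s)) :=
  memLp_two_cell (hA.contDiff k).continuous (volume_cell_lt_top s)

theorem memLp_gradient (k : ℕ) : MemLp (gradient (Φ k)) 2 (volume.restrict (cell s)) :=
  memLp_two_cell (contDiff_one_continuous_gradient (hA.contDiff k)) (volume_cell_lt_top s)

/-- Continuous weights are square integrable on the cell. The form of the integrand covers face
means, cell means and the integrals with cut-offs. -/
theorem tendsto_integral {α : E d → ℝ} {β : E d → E d} (hα : Continuous α) (hβ : Continuous β) :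
    Tendsto (fun k => ∫ x in cell s, (α x * Φ k x + inner ℝ (β x) (gradient (Φ k) x))) atTop
      (𝓝 (∫ x in cell s, (α x * φ x + inner ℝ (β x) (G x)))) := by
  have hα2 : MemLp α 2 (volume.restrict (cell s)) := memLp_two_cell hα (volume_cell_lt_top s)
  have hβ2 : MemLp β 2 (volume.restrict (cell s)) := memLp_two_cell hβ (volume_cell_lt_top s)
  have h1 := tendsto_integral_inner hA.memLp_apx hA.memLp hα2 hA.lim
  have h2 := tendsto_integral_inner hA.memLp_gradient hA.grad_memLp hβ2 hA.grad_lim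
  have h3 := h1.add h2
  rw [← integral_add (integrable_inner_of_memLp hα2 hA.memLp)
    (integrable_inner_of_memLp hβ2 hA.grad_memLp)] at h3
  simp_rw [← integral_add (integrable_inner_of_memLp hα2 (hA.memLp_apx _))
    (integrable_inner_of_memLp hβ2 (hA.memLp_gradient _))] at h3
  simpa [mul_comm] using h3

theorem tendsto_faceMean (a : E d) : Tendsto (fun k => faceMean s a (Φ k) (gradient (Φ k))) atTop
    (𝓝 (faceMean s a φ G)) := by
  have h1 := hA.tendsto_integral (α := fun _ => 1) (β := fun x => (d : ℝ)⁻¹ • (x - a))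
    continuous_const (by fun_prop)
  simp only [one_mul, inner_smul_left, map_inv₀, conj_trivial] at h1
  exact h1.const_mul _

variable {e : Finset (E d)} {a : E d} (h : IsSimplex s)
include h

/-- The face formula turns the surface integral into a volume integral, which is continuous under
$H^1$ convergence. So `faceMean` is the mean of the trace. -/
theorem tendsto_surface_integral (hf : IsFace s e a) (hd : 1 ≤ d) :
    Tendsto (fun k => ∫ x in cell e, Φ k x ∂(μHE[d - 1] : Measure (E d))) atTop
      (𝓝 (surf e * faceMean s a φ G)) := by
  simp_rw [← fun k => h.surf_mul_faceMean hf hd (hA.contDiff k)]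
  exact (hA.tendsto_faceMean a).const_mul _

/-- The traces of the approximating functions on a face are bounded in `L²`. -/
theorem exists_trace_bound (hf : IsFace s e a) (hd : 1 ≤ d) :
    ∃ B : ℝ, ∀ k, ∫ x in cell e, ‖Φ k x‖ ^ 2 ∂(μHE[d - 1] : Measure (E d)) ≤ B := by
  set h_s := Metric.diam (cell s)
  obtain ⟨B1, hB1⟩ := (tendsto_integral_norm_sq hA.memLp_apx hA.memLp hA.lim).bddAbove_range
  obtain ⟨B2, hB2⟩ :=
    (tendsto_integral_norm_sq hA.memLp_gradient hA.grad_memLp hA.grad_lim).bddAbove_range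
  refine ⟨‖affGrad (bary s a)‖ * ((d + 1) * B1 + h_s ^ 2 * B2), fun k => ?_⟩
  have hc := hA.contDiff k
  have hsq : ContDiff ℝ 1 (fun x => Φ k x * Φ k x) := hc.mul hc
  have hgc := contDiff_one_continuous_gradient hc
  have hgsq := contDiff_one_continuous_gradient hsq
  have hcc := hc.continuous
  have e1 : ∀ x, ‖Φ k x‖ ^ 2 = Φ k x * Φ k x := fun x => by
    rw [Real.norm_eq_abs, sq_abs, sq]
  simp_rw [e1]
  rw [← h.face_formula hf hd hsq]
  refine mul_le_mul_of_nonneg_left ?_ (norm_nonneg _)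
  have hI1 : IntegrableOn (fun x => ‖Φ k x‖ ^ 2) (cell s) :=
    continuousOn_integrable_cell (by fun_prop) s
  have hI2 : IntegrableOn (fun x => ‖gradient (Φ k) x‖ ^ 2) (cell s) :=
    continuousOn_integrable_cell (by fun_prop) s
  -- The face formula for $\Phi_k^2$ with Young's inequality
  -- $2\Phi_k\,(x-a)\cdot\nabla\Phi_k\le\Phi_k^2+h^2|\nabla\Phi_k|^2$.
  have hle : ∫ x in cell s, (d * (Φ k x * Φ k x) +
      inner ℝ (x - a) (gradient (fun y => Φ k y * Φ k y) x)) ≤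
      ∫ x in cell s, ((d + 1) * ‖Φ k x‖ ^ 2 + h_s ^ 2 * ‖gradient (Φ k) x‖ ^ 2) := by
    refine setIntegral_mono_on (continuousOn_integrable_cell (by fun_prop) s)
      ((hI1.const_mul _).add (hI2.const_mul _)) (measurableSet_cell s) fun x hx => ?_
    rw [inner_gradient_mul hc hc, ← e1]
    have hxa := norm_sub_le_diam hx (subset_cell s hf.mem)
    have h1 := abs_real_inner_le_norm (x - a) (gradient (Φ k) x)
    have h2 : |inner ℝ (x - a) (gradient (Φ k) x)| ≤ h_s * ‖gradient (Φ k) x‖ :=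
      h1.trans (mul_le_mul_of_nonneg_right hxa (norm_nonneg _))
    have h3 := sq_le_sq' (neg_le_of_abs_le h2) (le_of_abs_le h2)
    have h4 := sq_nonneg (Φ k x - inner ℝ (x - a) (gradient (Φ k) x))
    rw [mul_pow] at h3
    rw [e1]
    nlinarith
  refine hle.trans ?_
  rw [integral_add (hI1.const_mul _) (hI2.const_mul _), integral_const_mul, integral_const_mul]
  have b1 := hB1 ⟨k, rfl⟩
  have b2 := hB2 ⟨k, rfl⟩
  dsimp only at b1 b2
  gcongr

/-- The mean value over a face is determined, up to the cut-off, by integrals against functions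
supported away from the other faces. -/
theorem exists_cutoff_bound (hf : IsFace s e a) (hd : 1 ≤ d) :
    ∃ B : ℝ, ∀ χ : E d → ℝ, ContDiff ℝ 1 χ → (∀ z ∈ e, ∀ x, bary s z x = 0 → χ x = 0) →
      |surf e * faceMean s a φ G + ∫ x in cell s,
        (inner ℝ (‖affGrad (bary s a)‖⁻¹ • affGrad (bary s a)) (gradient χ x) * φ x +
          inner ℝ (χ x • (‖affGrad (bary s a)‖⁻¹ • affGrad (bary s a))) (G x))| ≤
        Real.sqrt (∫ x in cell e, ‖1 - χ x‖ ^ 2 ∂(μHE[d - 1] : Measure (E d))) * B := by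
  obtain ⟨B, hB⟩ := hA.exists_trace_bound h hf hd
  refine ⟨Real.sqrt B, fun χ hχ h0 => ?_⟩
  set n := ‖affGrad (bary s a)‖⁻¹ • affGrad (bary s a)
  set σ : Measure (E d) := μHE[d - 1]
  have hσ := h.surf_lt_top hf hd
  have hgχ := contDiff_one_continuous_gradient hχ
  have hχc := hχ.continuous
  have l1 := hA.tendsto_surface_integral h hf hd
  have l2 := hA.tendsto_integral (α := fun x => inner ℝ n (gradient χ x))
    (β := fun x => χ x • n) (by fun_prop) (by fun_prop)
  refine le_of_tendsto (l1.add l2).abs (Eventually.of_forall fun k => ?_)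
  have hk := hA.contDiff k
  -- Since $\chi\Phi_k$ vanishes on the other faces, the volume term equals $-\int_e\chi\Phi_k$, and
  -- the whole expression is $\int_e(1-\chi)\Phi_k$. Cauchy-Schwarz and the trace bound give a
  -- constant that does not depend on $\chi$.
  have e1 := h.integral_face_eq_neg hf hd (hχ.mul hk) (fun z hz x hx => by rw [h0 z hz x hx, zero_mul])
  have e2 : ∫ x in cell s, (inner ℝ n (gradient χ x) * Φ k x
      + inner ℝ (χ x • n) (gradient (Φ k) x)) = -∫ x in cell e, χ x * Φ k x ∂σ := by
    rw [e1, neg_neg]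
    congr 1; funext x
    rw [inner_gradient_mul hχ hk, real_inner_smul_left n (gradient (Φ k) x) (χ x)]
  have m1 : MemLp (fun x => 1 - χ x) 2 (σ.restrict (cell e)) :=
    memLp_two_cell (by fun_prop) hσ
  have m2 : MemLp (Φ k) 2 (σ.restrict (cell e)) := memLp_two_cell hk.continuous hσ
  have hfin : IsFiniteMeasure (σ.restrict (cell e)) := ⟨by simpa using hσ⟩
  have m3 : MemLp (fun x => χ x * Φ k x) 2 (σ.restrict (cell e)) :=
    memLp_two_cell (hχc.mul hk.continuous) hσ
  rw [e2, ← sub_eq_add_neg, ← integral_sub (m2.integrable (by norm_num))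
    (m3.integrable (by norm_num))]
  have e3 : ∀ x, Φ k x - χ x * Φ k x = inner ℝ (1 - χ x) (Φ k x) := fun x => by
    simp; ring
  simp_rw [e3]
  exact (abs_integral_inner_le m1 m2).trans
    (mul_le_mul_of_nonneg_left (Real.sqrt_le_sqrt (hB k)) (Real.sqrt_nonneg _))

/-- If the traces tend to zero, then the mean value over the face is zero. -/
theorem faceMean_eq_zero (hf : IsFace s e a) (hd : 1 ≤ d)
    (h0 : Tendsto (fun k => eLpNorm (Φ k) 2 ((μHE[d - 1] : Measure (E d)).restrict (cell e)))
      atTop (𝓝 0)) : faceMean s a φ G = 0 := by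
  have hσ := h.surf_lt_top hf hd
  have l1 := hA.tendsto_surface_integral h hf hd
  have l2 := tendsto_integral_inner (v := (0 : E d → ℝ)) (w := fun _ => (1 : ℝ))
    (fun k => memLp_two_cell (hA.contDiff k).continuous hσ) MemLp.zero
    (memLp_two_cell continuous_const hσ) (by simpa using h0)
  simp at l2
  have := tendsto_nhds_unique l1 l2
  exact (mul_eq_zero.1 this).resolve_left (h.surf_pos hf hd).ne'

end Approximates

/-- Smooth cut-off functions for an open set with compact closure. -/
theorem exists_cutoff {U K : Set (E d)} (hU : IsOpen U) (hK : IsCompact K) (hUK : U ⊆ K) :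
    ∃ χ : ℕ → E d → ℝ, (∀ j, ContDiff ℝ ∞ (χ j)) ∧ (∀ j, HasCompactSupport (χ j)) ∧
      (∀ j, tsupport (χ j) ⊆ U) ∧ (∀ j x, 0 ≤ χ j x ∧ χ j x ≤ 1) ∧
      ∀ x ∈ U, Tendsto (fun j => χ j x) atTop (𝓝 1) := by
  -- With a smooth nonnegative $g$ whose support set is $U$, the function `smoothTransition (j * g -
  -- 1)` is zero where $jg\le1$ and one where $jg\ge2$.
  obtain ⟨g, hgs, hgd, hg0⟩ := hU.exists_contDiff_support_eq (n := ⊤)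
  have hts : ∀ j : ℕ, tsupport (fun x => Real.smoothTransition (j * g x - 1)) ⊆ U := by
    intro j
    have hcl : IsClosed {x | 1 ≤ (j : ℝ) * g x} :=
      isClosed_le continuous_const (hgd.continuous.const_mul _)
    refine (closure_minimal ?_ hcl).trans ?_
    · intro x hx
      by_contra hlt
      simp only [mem_ofPred_eq, not_le] at hlt
      exact hx (Real.smoothTransition.zero_of_nonpos (by linarith))
    · intro x hx
      rw [← hgs]
      intro h0
      simp only [mem_ofPred_eq, h0, mul_zero] at hx
      linarith
  refine ⟨fun j x => Real.smoothTransition (j * g x - 1), fun j => ?_, fun j => ?_, hts,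
    fun j x => ⟨Real.smoothTransition.nonneg _, Real.smoothTransition.le_one _⟩, fun x hx => ?_⟩
  · exact Real.smoothTransition.contDiff.comp ((contDiff_const.mul hgd).sub contDiff_const)
  · exact hK.of_isClosed_subset (isClosed_tsupport _) ((hts j).trans hUK)
  · have hpos : 0 < g x := by
      rw [← hgs] at hx
      exact lt_of_le_of_ne (hg0 ⟨x, rfl⟩).1 (Ne.symm hx)
    refine tendsto_const_nhds.congr' ?_
    filter_upwards [(tendsto_natCast_atTop_atTop (R := ℝ)).eventually_ge_atTop (2 / g x)] with j hj
    rw [div_le_iff₀ hpos] at hj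
    exact (Real.smoothTransition.one_of_one_le (by linarith)).symm

/-! ### Mean values of `H¹` functions over the faces of a mesh -/

namespace Mesh

variable {T : Mesh d} {Ω C : Set (E d)} {φ : E d → ℝ} {G : E d → E d}

theorem Triangulates.memLp_cell (hΩ : T.Triangulates Ω) {F : Type*} [NormedAddCommGroup F]
    {f : E d → F} (hf : MemLp f 2 (volume.restrict Ω)) {τ : Finset (E d)} (hτ : τ ∈ T.elements) :
    MemLp f 2 (volume.restrict (cell τ)) :=
  hf.mono_measure (hΩ.restrict_cell_le hτ)

theorem InVc.exists_approximates (hΩ : T.Triangulates Ω) (hφ : T.InVc Ω C φ G)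
    {τ : Finset (E d)} (hτ : τ ∈ T.elements) :
    ∃ Φ, Approximates τ φ G Φ ∧ Tendsto (fun k => eLpNorm (Φ k) 2
      ((μHE[d - 1] : Measure (E d)).restrict (C ∩ cell τ))) atTop (𝓝 0) := by
  obtain ⟨Φ, h1, h2, h3, h4⟩ := hφ.vanishes τ hτ
  exact ⟨Φ, ⟨fun k => (h1 k).of_le (by exact_mod_cast le_top), hΩ.memLp_cell hφ.isH1.memLp hτ,
    hΩ.memLp_cell hφ.isH1.grad_memLp hτ, h2, h3⟩, h4⟩

theorem InVc.faceMean_eq_zero (hΩ : T.Triangulates Ω) (hφ : T.InVc Ω C φ G) (hd : 1 ≤ d)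
    {τ e : Finset (E d)} {a : E d} (hτ : τ ∈ T.elements) (hf : IsFace τ e a) (heC : cell e ⊆ C) :
    faceMean τ a φ G = 0 := by
  obtain ⟨Φ, hA, h0⟩ := hφ.exists_approximates hΩ hτ
  refine hA.faceMean_eq_zero (T.isSimplex hτ) hf hd ?_
  refine tendsto_of_tendsto_of_tendsto_of_le_of_le tendsto_const_nhds h0 (fun _ => zero_le)
    fun k => eLpNorm_mono_measure _ (Measure.restrict_mono_set _ (subset_inter heC ?_))
  exact convexHull_mono (by exact_mod_cast hf.subset)

/-- A consequence of the weak gradient: integration by parts in a fixed direction over the two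
elements at a common face. -/
theorem integral_two_cells_eq_zero (hΩ : T.Triangulates Ω) (hφ : IsH1 Ω φ G)
    {τ τ' : Finset (E d)} (hτ : τ ∈ T.elements) (hτ' : τ' ∈ T.elements) (hne : τ ≠ τ')
    {U : Set (E d)} (hU : IsOpen U) (hUs : U ⊆ cell τ ∪ cell τ') {χ : E d → ℝ}
    (hχ : ContDiff ℝ ∞ χ) (hχc : HasCompactSupport χ) (hχU : tsupport χ ⊆ U) (n : E d) :
    (∫ x in cell τ, (inner ℝ n (gradient χ x) * φ x + inner ℝ (χ x • n) (G x))) +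
      ∫ x in cell τ', (inner ℝ n (gradient χ x) * φ x + inner ℝ (χ x • n) (G x)) = 0 := by
  have hχ1 : ContDiff ℝ 1 χ := hχ.of_le (by exact_mod_cast le_top)
  have hgc := contDiff_one_continuous_gradient hχ1
  have hcc := hχ1.continuous
  have hUΩ : U ⊆ Ω := by
    rw [hΩ.exact]
    refine interior_maximal (hUs.trans (union_subset ?_ ?_)) hU
    · exact subset_biUnion_of_mem (u := fun τ => cell τ) hτ
    · exact subset_biUnion_of_mem (u := fun τ => cell τ) hτ'
  set H : E d → ℝ := fun x => inner ℝ n (gradient χ x) * φ x + inner ℝ (χ x • n) (G x)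
  have hgs : HasCompactSupport (gradient χ) := by
    have : HasCompactSupport (fderiv ℝ χ) := hχc.fderiv ℝ
    refine this.comp_left (g := (InnerProductSpace.toDual ℝ (E d)).symm) (map_zero _)
  have hm1 : MemLp χ 2 (volume.restrict Ω) := (hcc.memLp_of_hasCompactSupport hχc).restrict _
  have hm2 : MemLp (gradient χ) 2 (volume.restrict Ω) :=
    (hgc.memLp_of_hasCompactSupport hgs).restrict _
  have hm3 : MemLp (fun x => inner ℝ n (gradient χ x)) 2 (volume.restrict Ω) := hm2.const_inner n
  have hm4 : MemLp (fun x => χ x • n) 2 (volume.restrict Ω) := by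
    have := (ContinuousLinearMap.smulRight (1 : ℝ →L[ℝ] ℝ) n).comp_memLp' hm1
    simpa [Function.comp_def] using this
  have hi1 : Integrable (fun x => inner ℝ n (gradient χ x) * φ x) (volume.restrict Ω) := by
    simpa [mul_comm] using integrable_inner_of_memLp hm3 hφ.memLp
  have hi2 : Integrable (fun x => inner ℝ (χ x • n) (G x)) (volume.restrict Ω) :=
    integrable_inner_of_memLp hm4 hφ.grad_memLp
  have hHi : Integrable H (volume.restrict Ω) := hi1.add hi2
  have hH0 : ∀ x, x ∉ U → H x = 0 := by
    intro x hx
    have hx' : x ∉ tsupport χ := fun H => hx (hχU H)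
    have h1 : χ x = 0 := image_eq_zero_of_notMem_tsupport hx'
    have h2 : gradient χ x = 0 := by
      have : fderiv ℝ χ x = 0 := by
        by_contra hne
        exact hx' (support_fderiv_subset ℝ hne)
      simp [gradient, this]
    simp only [H, h1, h2, inner_zero_right, zero_mul, zero_smul, inner_zero_left, add_zero]
  have e1 : ∫ x in Ω, H x = 0 := by
    have hw := congrArg (fun v => inner ℝ n v) (hφ.weak χ hχ hχc (hχU.trans hUΩ))
    have hv1 : Integrable (fun x => φ x • gradient χ x) (volume.restrict Ω) := by
      exact memLp_one_iff_integrable.1 (hm2.smul hφ.memLp)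
    have hv2 : Integrable (fun x => χ x • G x) (volume.restrict Ω) := by
      exact memLp_one_iff_integrable.1 (hφ.grad_memLp.smul hm1)
    simp only [inner_neg_right] at hw
    rw [← integral_inner hv1, ← integral_inner hv2] at hw
    simp only [H]
    rw [integral_add hi1 hi2]
    have e2 : ∀ x, inner ℝ n (φ x • gradient χ x) = inner ℝ n (gradient χ x) * φ x := fun x => by
      rw [inner_smul_right]; ring
    have e3 : ∀ x, inner ℝ n (χ x • G x) = inner ℝ (χ x • n) (G x) := fun x => by
      rw [inner_smul_right, inner_smul_left]; rfl
    simp_rw [e2, e3] at hw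
    rw [hw]; ring
  have hUm := hU.measurableSet
  have e4 : ∫ x in Ω, H x = ∫ x in U, H x :=
    setIntegral_eq_of_subset_of_forall_sdiff_eq_zero (by rw [hΩ.exact]; exact isOpen_interior.measurableSet)
      hUΩ fun x hx => hH0 x hx.2
  have e5 : ∫ x in cell τ ∪ cell τ', H x = ∫ x in U, H x :=
    setIntegral_eq_of_subset_of_forall_sdiff_eq_zero
      ((measurableSet_cell τ).union (measurableSet_cell τ')) hUs fun x hx => hH0 x hx.2
  change (∫ x in cell τ, H x) + ∫ x in cell τ', H x = 0
  rw [← setIntegral_union₀ (T.aedisjoint_cell hτ hτ' hne) (measurableSet_cell τ').nullMeasurableSet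
    (hHi.mono_measure (hΩ.restrict_cell_le hτ)) (hHi.mono_measure (hΩ.restrict_cell_le hτ')),
    e5, ← e4, e1]

/-- The mean values of an `H¹` function over a common face of two elements agree. -/
theorem InVc.faceMean_eq (hΩ : T.Triangulates Ω) (hφ : T.InVc Ω C φ G) (hd : 1 ≤ d)
    {τ τ' e : Finset (E d)} {a a' : E d} (hτ : τ ∈ T.elements) (hτ' : τ' ∈ T.elements)
    (hf : IsFace τ e a) (hf' : IsFace τ' e a') :
    faceMean τ a φ G = faceMean τ' a' φ G := by
  rcases eq_or_ne τ τ' with rfl | hne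
  · rcases (T.isSimplex hτ).eq_or_mem hf hf'.mem with rfl | hc
    · rfl
    · exact absurd hc hf'.notMem
  have h := T.isSimplex hτ
  have h' := T.isSimplex hτ'
  obtain ⟨Φ, hA, -⟩ := hφ.exists_approximates hΩ hτ
  obtain ⟨Φ', hA', -⟩ := hφ.exists_approximates hΩ hτ'
  obtain ⟨B, hB⟩ := hA.exists_cutoff_bound h hf hd
  obtain ⟨B', hB'⟩ := hA'.exists_cutoff_bound h' hf' hd
  have hUs := T.faceNhd_subset hd hτ hτ' hne hf hf'
  have hUo := isOpen_faceNhd τ τ' e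
  obtain ⟨χ, hχ, hχc, hχU, hχ01, hχ1⟩ :=
    exists_cutoff hUo ((isCompact_cell τ).union (isCompact_cell τ')) hUs
  set σ : Measure (E d) := μHE[d - 1]
  have hσ := h.surf_lt_top hf hd
  have hfin : IsFiniteMeasure (σ.restrict (cell e)) := ⟨by simpa using hσ⟩
  have hχ1d : ∀ j, ContDiff ℝ 1 (χ j) := fun j => (hχ j).of_le (by exact_mod_cast le_top)
  have hvan : ∀ j x, x ∉ faceNhd τ τ' e → χ j x = 0 := fun j x hx =>
    image_eq_zero_of_notMem_tsupport fun H => hx (hχU j H)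
  -- The cut-offs tend to $1$ in $L^2(e)$: they do so pointwise off the relative boundary of $e$,
  -- which is a null set by `surface_null`.
  have hlim : Tendsto (fun j => ∫ x in cell e, ‖1 - χ j x‖ ^ 2 ∂σ) atTop
      (𝓝 (∫ x in cell e, (0 : ℝ) ∂σ)) := by
    refine tendsto_integral_of_dominated_convergence (fun _ => (1 : ℝ)) ?_ (integrable_const _) ?_ ?_
    · intro j
      have := (hχ1d j).continuous
      exact (by fun_prop : Continuous fun x => ‖1 - χ j x‖ ^ 2).aestronglyMeasurable
    · refine fun j => Eventually.of_forall fun x => ?_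
      obtain ⟨h0, h1⟩ := hχ01 j x
      rw [Real.norm_of_nonneg (by positivity), Real.norm_of_nonneg (by linarith)]
      exact pow_le_one₀ (by linarith) (by linarith)
    · have hnull : ∀ᵐ x ∂(σ.restrict (cell e)), ∀ z ∈ e, bary τ z x ≠ 0 := by
        rw [Filter.eventually_all_finset]
        intro z hz
        have := h.surface_null hf hd hz
        rw [ae_iff, Measure.restrict_apply₀']
        · refine measure_mono_null ?_ this
          rintro x ⟨hx, hxe⟩
          exact ⟨hxe, not_not.1 hx⟩
        · exact (measurableSet_cell e).nullMeasurableSet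
      filter_upwards [hnull, ae_restrict_mem (measurableSet_cell e)] with x hx hxe
      have hxU : x ∈ faceNhd τ τ' e := by
        intro z hz
        have hp : 0 < bary τ z x := lt_of_le_of_ne
          (h.mem_cell.1 ((h.mem_face hf).1 hxe).1 z (hf.subset hz)) (hx z hz).symm
        exact ⟨hp, by rwa [h.bary_eq_on_face h' hf.subset hf'.subset hz hxe]⟩
      have := (((tendsto_const_nhds (x := (1 : ℝ))).sub (hχ1 x hxU)).norm).pow 2
      simpa using this
  rw [integral_zero] at hlim
  -- The unit normals of the two sides are opposite, so the volume terms in the two cut-off bounds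
  -- cancel by the definition of the weak gradient.
  have hest : ∀ j, |surf e * faceMean τ a φ G - surf e * faceMean τ' a' φ G| ≤
      Real.sqrt (∫ x in cell e, ‖1 - χ j x‖ ^ 2 ∂σ) * (B + B') := by
    intro j
    have b1 := hB (χ j) (hχ1d j) fun z hz x hx => hvan j x fun H => (H z hz).1.ne' hx
    have b2 := hB' (χ j) (hχ1d j) fun z hz x hx => hvan j x fun H => (H z hz).2.ne' hx
    rw [T.affGrad_opposite hd hτ hτ' hne hf hf'] at b1
    set n := ‖affGrad (bary τ' a')‖⁻¹ • affGrad (bary τ' a')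
    have hz := integral_two_cells_eq_zero hΩ hφ.isH1 hτ hτ' hne hUo hUs (hχ j) (hχc j) (hχU j) n
    have hneg : ∫ x in cell τ, (inner ℝ (-n) (gradient (χ j) x) * φ x
        + inner ℝ (χ j x • -n) (G x)) =
        -∫ x in cell τ, (inner ℝ n (gradient (χ j) x) * φ x + inner ℝ (χ j x • n) (G x)) := by
      rw [← integral_neg]
      congr 1; funext x
      rw [smul_neg, inner_neg_left, inner_neg_left]; ring
    rw [hneg] at b1
    have : surf e * faceMean τ a φ G - surf e * faceMean τ' a' φ G =
        (surf e * faceMean τ a φ G + -∫ x in cell τ, (inner ℝ n (gradient (χ j) x) * φ x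
          + inner ℝ (χ j x • n) (G x))) -
        (surf e * faceMean τ' a' φ G + ∫ x in cell τ', (inner ℝ n (gradient (χ j) x) * φ x
          + inner ℝ (χ j x • n) (G x))) := by linarith
    rw [this]
    refine (abs_sub _ _).trans ?_
    rw [mul_add]
    exact add_le_add b1 b2
  have hl2 : Tendsto (fun j => Real.sqrt (∫ x in cell e, ‖1 - χ j x‖ ^ 2 ∂σ) * (B + B')) atTop
      (𝓝 0) := by
    have := (hlim.sqrt).mul_const (B + B')
    simpa using this
  have h0 := ge_of_tendsto' hl2 hest
  have h1 := abs_nonpos_iff.1 h0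
  exact mul_left_cancel₀ (h.surf_pos hf hd).ne' (sub_eq_zero.1 h1)

end Mesh

/-! ### The Poincaré inequality on a simplex -/

/-- The map $x\mapsto x+t(y-x)$ sends the convex cell into itself and has Jacobian
$(1-t)^d\ge2^{-d}$. The restriction $t\le1/2$ keeps the Jacobian away from zero, which is why
differences are taken only up to midpoints. -/
theorem setIntegral_contraction_le {s : Finset (E d)} {g : E d → ℝ} (hg : Continuous g)
    (hg0 : ∀ x, 0 ≤ g x) {y : E d} (hy : y ∈ cell s) {t : ℝ} (ht0 : 0 ≤ t) (ht : t ≤ 1 / 2) :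
    ∫ x in cell s, g (x + t • (y - x)) ≤ 2 ^ d * ∫ x in cell s, g x := by
  set F : E d → ℝ := (cell s).indicator g
  have hFi : Integrable F :=
    (continuousOn_integrable_cell hg s).integrable_indicator (measurableSet_cell s)
  have hc : (1 - t) ≠ 0 := by linarith
  have hFc : Integrable (fun x => F ((1 - t) • x + t • y)) := by
    have h1 := hFi.comp_add_right (t • y)
    exact h1.comp_smul hc
  have e1 : ∫ x, F ((1 - t) • x + t • y) = ((1 - t) ^ d)⁻¹ * ∫ x in cell s, g x := by
    have := Measure.integral_comp_smul (volume : Measure (E d)) (fun x => F (x + t • y)) (1 - t)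
    rw [this, finrank_euclideanSpace_fin, integral_add_right_eq_self F, smul_eq_mul,
      abs_of_nonneg (inv_nonneg.2 (pow_nonneg (by linarith) _)),
      integral_indicator (measurableSet_cell s)]
  have e2 : ∀ x : E d, x + t • (y - x) = (1 - t) • x + t • y := fun x => by module
  calc ∫ x in cell s, g (x + t • (y - x)) = ∫ x in cell s, F ((1 - t) • x + t • y) := by
        refine setIntegral_congr_fun (measurableSet_cell s) fun x hx => ?_
        simp only [F, e2]
        rw [indicator_of_mem]
        exact convex_cell s hx hy (by linarith) ht0 (by ring)
    _ ≤ ∫ x, F ((1 - t) • x + t • y) :=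
        setIntegral_le_integral hFc (Eventually.of_forall fun x =>
          indicator_nonneg (fun z _ => hg0 z) _)
    _ = ((1 - t) ^ d)⁻¹ * ∫ x in cell s, g x := e1
    _ ≤ 2 ^ d * ∫ x in cell s, g x := by
        refine mul_le_mul_of_nonneg_right ?_ (integral_nonneg hg0)
        rw [← inv_pow]
        refine pow_le_pow_left₀ (inv_nonneg.2 (by linarith)) ?_ _
        rw [inv_le_comm₀ (by linarith) two_pos]
        linarith

/-- The fundamental theorem of calculus on the half segment from $x$ to the midpoint, with
Cauchy-Schwarz on an interval of length $1/2$. -/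
theorem sq_sub_half_le {s : Finset (E d)} {ψ : E d → ℝ} (hψ : ContDiff ℝ 1 ψ) {x y : E d}
    (hx : x ∈ cell s) (hy : y ∈ cell s) :
    (ψ (x + (1 / 2 : ℝ) • (y - x)) - ψ x) ^ 2 ≤ Metric.diam (cell s) ^ 2 / 2 *
      ∫ t in Ioc (0 : ℝ) (1 / 2), ‖gradient ψ (x + t • (y - x))‖ ^ 2 := by
  have hgc := contDiff_one_continuous_gradient hψ
  have hder : ∀ t ∈ uIcc (0 : ℝ) (1 / 2), HasDerivAt (fun t : ℝ => ψ (x + t • (y - x)))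
      (inner ℝ (y - x) (gradient ψ (x + t • (y - x)))) t := fun t _ =>
    hasDerivAt_comp_line hψ x (y - x) t
  have hFTC := intervalIntegral.integral_eq_sub_of_hasDerivAt hder
    (Continuous.intervalIntegrable (by fun_prop) _ _)
  rw [intervalIntegral.integral_of_le (by norm_num)] at hFTC
  simp only [zero_smul, add_zero] at hFTC
  rw [← hFTC]
  have hml : ∀ {F : Type} [NormedAddCommGroup F] {f : ℝ → F}, Continuous f →
      MemLp f 2 (volume.restrict (Ioc (0 : ℝ) (1 / 2))) := by
    intro F _ f hf
    obtain ⟨C, hC⟩ := (isCompact_Icc (a := (0 : ℝ)) (b := 1 / 2)).exists_bound_of_continuousOn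
      hf.continuousOn
    exact MemLp.of_bound hf.aestronglyMeasurable C ((ae_restrict_mem measurableSet_Ioc).mono
      fun t ht => hC t (Ioc_subset_Icc_self ht))
  have hcs := abs_integral_inner_le (hml (f := fun _ : ℝ => y - x) continuous_const)
    (hml (f := fun t : ℝ => gradient ψ (x + t • (y - x))) (by fun_prop))
  have hsq := pow_le_pow_left₀ (abs_nonneg _) hcs 2
  rw [sq_abs, mul_pow, Real.sq_sqrt (integral_nonneg fun _ => by positivity),
    Real.sq_sqrt (integral_nonneg fun _ => by positivity)] at hsq
  refine hsq.trans ?_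
  refine mul_le_mul_of_nonneg_right ?_ (integral_nonneg fun _ => by positivity)
  rw [setIntegral_const]
  simp only [Measure.real, Real.volume_Ioc, smul_eq_mul]
  rw [ENNReal.toReal_ofReal (by norm_num)]
  have := pow_le_pow_left₀ (norm_nonneg _) (norm_sub_le_diam hy hx) 2
  linarith

theorem integral_sq_sub_half_le {s : Finset (E d)} {ψ : E d → ℝ} (hψ : ContDiff ℝ 1 ψ) {y : E d}
    (hy : y ∈ cell s) :
    ∫ x in cell s, (ψ (x + (1 / 2 : ℝ) • (y - x)) - ψ x) ^ 2 ≤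
      Metric.diam (cell s) ^ 2 / 4 * (2 ^ d * ∫ x in cell s, ‖gradient ψ x‖ ^ 2) := by
  have hgc := contDiff_one_continuous_gradient hψ
  have hψc := hψ.continuous
  set I := Ioc (0 : ℝ) (1 / 2)
  have hunc : Integrable (Function.uncurry fun (x : E d) (t : ℝ) =>
      ‖gradient ψ (x + t • (y - x))‖ ^ 2) ((volume.restrict (cell s)).prod (volume.restrict I)) := by
    rw [Measure.prod_restrict]
    refine IntegrableOn.mono_set ?_ (prod_mono subset_rfl Ioc_subset_Icc_self)
    refine ContinuousOn.integrableOn_compact ((isCompact_cell s).prod isCompact_Icc) ?_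
    have hc : Continuous fun p : E d × ℝ => ‖gradient ψ (p.1 + p.2 • (y - p.1))‖ ^ 2 := by fun_prop
    exact hc.continuousOn
  have h1 : ∫ x in cell s, (ψ (x + (1 / 2 : ℝ) • (y - x)) - ψ x) ^ 2 ≤
      ∫ x in cell s, Metric.diam (cell s) ^ 2 / 2 *
        ∫ t in I, ‖gradient ψ (x + t • (y - x))‖ ^ 2 :=
    setIntegral_mono_on (continuousOn_integrable_cell (by fun_prop) s)
      (hunc.integral_prod_left.const_mul _)
      (measurableSet_cell s) fun x hx => sq_sub_half_le hψ hx hy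
  refine h1.trans ?_
  rw [integral_const_mul, integral_integral_swap hunc]
  have h2 : ∫ t in I, ∫ x in cell s, ‖gradient ψ (x + t • (y - x))‖ ^ 2 ≤
      ∫ t in I, 2 ^ d * ∫ x in cell s, ‖gradient ψ x‖ ^ 2 := by
    refine setIntegral_mono_on hunc.integral_prod_right (integrable_const _) measurableSet_Ioc
      fun t ht => ?_
    exact setIntegral_contraction_le (g := fun x => ‖gradient ψ x‖ ^ 2) (by fun_prop) (fun x => by positivity) hy ht.1.le ht.2
  rw [setIntegral_const] at h2
  have hI : volume.real I = 1 / 2 := by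
    simp [I, Measure.real]
  rw [hI, smul_eq_mul] at h2
  have := mul_le_mul_of_nonneg_left h2 (show (0:ℝ) ≤ Metric.diam (cell s) ^ 2 / 2 by positivity)
  linarith

theorem integral_quadratic {s : Finset (E d)} {φ : E d → ℝ} (hi : IntegrableOn φ (cell s))
    (hi2 : IntegrableOn (fun x => ‖φ x‖ ^ 2) (cell s)) (a b c : ℝ) :
    ∫ x in cell s, (a * ‖φ x‖ ^ 2 + b * φ x + c) =
      a * (∫ x in cell s, ‖φ x‖ ^ 2) + b * (∫ x in cell s, φ x) + volume.real (cell s) * c := by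
  have hfin : IsFiniteMeasure (volume.restrict (cell s)) := ⟨by simpa using volume_cell_lt_top s⟩
  rw [integral_add (f := fun x => a * ‖φ x‖ ^ 2 + b * φ x)
    ((hi2.const_mul a).add (hi.const_mul b)) (integrable_const c),
    integral_add (hi2.const_mul a) (hi.const_mul b), integral_const_mul, integral_const_mul,
    setIntegral_const, smul_eq_mul]

/-- The Poincaré inequality for smooth functions on a simplex. -/
theorem IsSimplex.poincare_smooth {τ : Finset (E d)} (h : IsSimplex τ) {ψ : E d → ℝ}
    (hψ : ContDiff ℝ 1 ψ) :
    (∫ x in cell τ, ‖ψ x‖ ^ 2) - (volume.real (cell τ))⁻¹ * (∫ x in cell τ, ψ x) ^ 2 ≤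
      2 ^ d * Metric.diam (cell τ) ^ 2 * ∫ x in cell τ, ‖gradient ψ x‖ ^ 2 := by
  have hψc := hψ.continuous
  have hV := h.volReal_pos
  set V := volume.real (cell τ)
  set K := Metric.diam (cell τ) ^ 2 / 4 * (2 ^ d * ∫ x in cell τ, ‖gradient ψ x‖ ^ 2)
  set S := ∫ x in cell τ, ‖ψ x‖ ^ 2
  set M := ∫ x in cell τ, ψ x
  have hiψ : IntegrableOn ψ (cell τ) := continuousOn_integrable_cell hψc τ
  have hiψ2 : IntegrableOn (fun x => ‖ψ x‖ ^ 2) (cell τ) :=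
    continuousOn_integrable_cell (by fun_prop) τ
  have hfin : IsFiniteMeasure (volume.restrict (cell τ)) := ⟨by simpa using volume_cell_lt_top τ⟩
  have hci : ∀ c : ℝ, IntegrableOn (fun _ : E d => c) (cell τ) := fun c => integrable_const c
  have hunc : Integrable (Function.uncurry fun (y x : E d) =>
      (ψ (x + (1 / 2 : ℝ) • (y - x)) - ψ y) ^ 2)
      ((volume.restrict (cell τ)).prod (volume.restrict (cell τ))) := by
    rw [Measure.prod_restrict]
    refine ContinuousOn.integrableOn_compact ((isCompact_cell τ).prod (isCompact_cell τ)) ?_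
    have hc : Continuous fun p : E d × E d => (ψ (p.2 + (1 / 2 : ℝ) • (p.1 - p.2)) - ψ p.1) ^ 2 := by
      fun_prop
    exact hc.continuousOn
  -- The difference $\psi(x)-\psi(y)$ is split at the midpoint of $x$ and $y$. The left side is
  -- $\int(\psi(x)-\psi(y))^2\,dx$, and the first half is bounded by `integral_sq_sub_half_le`.
  have key : ∀ y ∈ cell τ, S - 2 * ψ y * M + V * ψ y ^ 2 ≤ 2 * K +
      2 * ∫ x in cell τ, (ψ (x + (1 / 2 : ℝ) • (y - x)) - ψ y) ^ 2 := by
    intro y hy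
    have e1 : ∫ x in cell τ, (1 * ‖ψ x‖ ^ 2 + -(2 * ψ y) * ψ x + ψ y ^ 2) =
        S - 2 * ψ y * M + V * ψ y ^ 2 := by
      rw [integral_quadratic hiψ hiψ2]
      ring
    have hi1 : IntegrableOn (fun x => (ψ (x + (1 / 2 : ℝ) • (y - x)) - ψ x) ^ 2) (cell τ) :=
      continuousOn_integrable_cell (by fun_prop) τ
    have hi2 : IntegrableOn (fun x => (ψ (x + (1 / 2 : ℝ) • (y - x)) - ψ y) ^ 2) (cell τ) :=
      continuousOn_integrable_cell (by fun_prop) τ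
    rw [← e1]
    have h1 : ∫ x in cell τ, (1 * ‖ψ x‖ ^ 2 + -(2 * ψ y) * ψ x + ψ y ^ 2) ≤
        ∫ x in cell τ, (2 * (ψ (x + (1 / 2 : ℝ) • (y - x)) - ψ x) ^ 2 +
          2 * (ψ (x + (1 / 2 : ℝ) • (y - x)) - ψ y) ^ 2) := by
      refine integral_mono (((hiψ2.const_mul _).add (hiψ.const_mul _)).add (hci _))
        ((hi1.const_mul _).add (hi2.const_mul _)) fun x => ?_
      simp only [Real.norm_eq_abs, sq_abs]
      nlinarith [sq_nonneg ((ψ (x + (1 / 2 : ℝ) • (y - x)) - ψ x) +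
        (ψ (x + (1 / 2 : ℝ) • (y - x)) - ψ y))]
    rw [integral_add (hi1.const_mul _) (hi2.const_mul _), integral_const_mul,
      integral_const_mul] at h1
    have := integral_sq_sub_half_le hψ hy
    change _ ≤ K at this
    linarith
  have hil : Integrable (fun y => ∫ x in cell τ, (ψ (x + (1 / 2 : ℝ) • (y - x)) - ψ y) ^ 2)
      (volume.restrict (cell τ)) := hunc.integral_prod_left
  have hint : ∫ y in cell τ, (V * ‖ψ y‖ ^ 2 + -(2 * M) * ψ y + S) ≤
      ∫ y in cell τ, (2 * K +
        2 * ∫ x in cell τ, (ψ (x + (1 / 2 : ℝ) • (y - x)) - ψ y) ^ 2) := by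
    refine setIntegral_mono_on (((hiψ2.const_mul _).add (hiψ.const_mul _)).add (hci _))
      ((hci (2 * K)).add (hil.const_mul 2)) (measurableSet_cell τ)
      fun y hy => ?_
    have := key y hy
    simp only [Real.norm_eq_abs, sq_abs]
    linarith
  rw [integral_quadratic hiψ hiψ2, integral_add (hci (2 * K)) (hil.const_mul 2),
    integral_const_mul 2 fun y => ∫ x in cell τ, (ψ (x + (1 / 2 : ℝ) • (y - x)) - ψ y) ^ 2,
    setIntegral_const, smul_eq_mul] at hint
  -- The midpoint is symmetric in $x$ and $y$, so after exchanging the integrals the second half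
  -- obeys the same bound as the first.
  have hsw : ∫ y in cell τ, ∫ x in cell τ, (ψ (x + (1 / 2 : ℝ) • (y - x)) - ψ y) ^ 2 ≤ V * K := by
    rw [integral_integral_swap hunc]
    have : ∫ x in cell τ, ∫ y in cell τ, (ψ (x + (1 / 2 : ℝ) • (y - x)) - ψ y) ^ 2 ≤
        ∫ x in cell τ, K := by
      refine setIntegral_mono_on hunc.integral_prod_right (hci K) (measurableSet_cell τ)
        fun x hx => ?_
      have := integral_sq_sub_half_le hψ hx
      refine le_trans (le_of_eq ?_) this
      congr 1; funext y
      rw [show x + (1 / 2 : ℝ) • (y - x) = y + (1 / 2 : ℝ) • (x - y) by module]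
    rwa [setIntegral_const, smul_eq_mul] at this
  change V * S + -(2 * M) * M + V * S ≤ V * (2 * K) +
    2 * ∫ y in cell τ, ∫ x in cell τ, (ψ (x + (1 / 2 : ℝ) • (y - x)) - ψ y) ^ 2 at hint
  have h4 : V * S - M * M ≤ V * (2 * K) := by linarith
  have h5 : S - V⁻¹ * M ^ 2 ≤ 2 * K := by
    have : S - V⁻¹ * M ^ 2 = V⁻¹ * (V * S - M * M) := by field_simp
    rw [this, inv_mul_le_iff₀ hV]; exact h4
  have h6 : 0 ≤ ∫ x in cell τ, ‖gradient ψ x‖ ^ 2 := integral_nonneg fun _ => by positivity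
  refine h5.trans ?_
  have h7 : 0 ≤ 2 ^ d * Metric.diam (cell τ) ^ 2 * ∫ x in cell τ, ‖gradient ψ x‖ ^ 2 := by
    positivity
  simp only [K]
  linarith

/-- The mean value over an element. -/
def cellMean (s : Finset (E d)) (φ : E d → ℝ) : ℝ :=
  (volume.real (cell s))⁻¹ * ∫ x in cell s, φ x

theorem Approximates.poincare {τ : Finset (E d)} (h : IsSimplex τ) {φ : E d → ℝ} {G : E d → E d}
    {Φ : ℕ → E d → ℝ} (hA : Approximates τ φ G Φ) :
    ∫ x in cell τ, ‖φ x - cellMean τ φ‖ ^ 2 ≤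
      2 ^ d * Metric.diam (cell τ) ^ 2 * ∫ x in cell τ, ‖G x‖ ^ 2 := by
  have hV := h.volReal_pos
  have hfin : IsFiniteMeasure (volume.restrict (cell τ)) := ⟨by simpa using volume_cell_lt_top τ⟩
  have hi : IntegrableOn φ (cell τ) := hA.memLp.integrable (by norm_num)
  have hi2 : IntegrableOn (fun x => ‖φ x‖ ^ 2) (cell τ) := by
    exact hA.memLp.integrable_norm_pow (p := 2) (by norm_num)
  have e1 : ∫ x in cell τ, ‖φ x - cellMean τ φ‖ ^ 2 =
      (∫ x in cell τ, ‖φ x‖ ^ 2) - (volume.real (cell τ))⁻¹ * (∫ x in cell τ, φ x) ^ 2 := by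
    have : ∀ x, ‖φ x - cellMean τ φ‖ ^ 2 =
        1 * ‖φ x‖ ^ 2 + -(2 * cellMean τ φ) * φ x + cellMean τ φ ^ 2 := fun x => by
      simp only [Real.norm_eq_abs, sq_abs]; ring
    simp_rw [this]
    rw [integral_quadratic hi hi2, cellMean]
    field_simp; ring
  rw [e1]
  have l1 := tendsto_integral_norm_sq hA.memLp_apx hA.memLp hA.lim
  have l2 := tendsto_integral_norm_sq hA.memLp_gradient hA.grad_memLp hA.grad_lim
  have l3 := hA.tendsto_integral (α := fun _ => 1) (β := fun _ => 0) continuous_const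
    continuous_const
  simp only [one_mul, inner_zero_left, add_zero] at l3
  exact le_of_tendsto_of_tendsto' (l1.sub ((l3.pow 2).const_mul _)) (l2.const_mul _)
    fun k => h.poincare_smooth (hA.contDiff k)

/-- Mean values over an element and over one of its faces. -/
theorem IsSimplex.abs_faceMean_sub_cellMean_le {τ : Finset (E d)} (h : IsSimplex τ) {a : E d}
    (ha : a ∈ τ) {φ : E d → ℝ} {G : E d → E d} (hφ : MemLp φ 2 (volume.restrict (cell τ)))
    (hG : MemLp G 2 (volume.restrict (cell τ))) :
    (faceMean τ a φ G - cellMean τ φ) ^ 2 ≤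
      Metric.diam (cell τ) ^ 2 / volume.real (cell τ) * ∫ x in cell τ, ‖G x‖ ^ 2 := by
  have hV := h.volReal_pos
  have hfin : IsFiniteMeasure (volume.restrict (cell τ)) := ⟨by simpa using volume_cell_lt_top τ⟩
  have hi : IntegrableOn φ (cell τ) := hφ.integrable (by norm_num)
  have hm : MemLp (fun x : E d => x - a) 2 (volume.restrict (cell τ)) :=
    memLp_two_cell (by fun_prop) (volume_cell_lt_top τ)
  have hi2 := integrable_inner_of_memLp hm hG
  have e1 : faceMean τ a φ G - cellMean τ φ =
      (volume.real (cell τ))⁻¹ * ((d : ℝ)⁻¹ * ∫ x in cell τ, inner ℝ (x - a) (G x)) := by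
    rw [faceMean, cellMean, integral_add hi (hi2.const_mul _), integral_const_mul]; ring
  have hcs := pow_le_pow_left₀ (abs_nonneg _) (abs_integral_inner_le hm hG) 2
  rw [sq_abs, mul_pow, Real.sq_sqrt (integral_nonneg fun _ => by positivity),
    Real.sq_sqrt (integral_nonneg fun _ => by positivity)] at hcs
  have hdiam : ∫ x in cell τ, ‖x - a‖ ^ 2 ≤ volume.real (cell τ) * Metric.diam (cell τ) ^ 2 := by
    have : ∫ x in cell τ, ‖x - a‖ ^ 2 ≤ ∫ x in cell τ, Metric.diam (cell τ) ^ 2 :=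
      setIntegral_mono_on (continuousOn_integrable_cell (by fun_prop) τ)
        (integrable_const _) (measurableSet_cell τ)
        fun x hx => pow_le_pow_left₀ (norm_nonneg _) (norm_sub_le_diam hx (subset_cell τ ha)) 2
    rwa [setIntegral_const, smul_eq_mul] at this
  -- For $d=0$ the inverse is zero by convention.
  have hd1 : ((d : ℝ)⁻¹) ^ 2 ≤ 1 := by
    rw [inv_pow]
    rcases Nat.eq_zero_or_pos d with h0 | h0
    · simp [h0]
    · exact inv_le_one_of_one_le₀ (one_le_pow₀ (by exact_mod_cast h0))
  rw [e1, mul_pow, mul_pow]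
  have hG0 : 0 ≤ ∫ x in cell τ, ‖G x‖ ^ 2 := integral_nonneg fun _ => by positivity
  calc (volume.real (cell τ))⁻¹ ^ 2 * ((d : ℝ)⁻¹ ^ 2 * (∫ x in cell τ, inner ℝ (x - a) (G x)) ^ 2)
      ≤ (volume.real (cell τ))⁻¹ ^ 2 * (1 * ((volume.real (cell τ) * Metric.diam (cell τ) ^ 2) *
          ∫ x in cell τ, ‖G x‖ ^ 2)) := by
        refine mul_le_mul_of_nonneg_left ?_ (by positivity)
        refine mul_le_mul hd1 (hcs.trans (mul_le_mul_of_nonneg_right hdiam hG0)) (sq_nonneg _)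
          zero_le_one
    _ = _ := by field_simp

/-! ### Shape regularity -/

/-- The simplex contains a ball whose radius is comparable with its diameter. -/
def RegularWith (k : ℝ) (τ : Finset (E d)) : Prop :=
  ∃ x, Metric.closedBall x (Metric.diam (cell τ) / k) ⊆ cell τ

theorem volume_real_ball (x : E d) {r : ℝ} (hr : 0 < r) :
    volume.real (Metric.ball x r) = r ^ d * volume.real (Metric.ball (0 : E d) 1) := by
  rw [Measure.real, Measure.addHaar_ball_of_pos _ _ hr, ENNReal.toReal_mul, finrank_euclideanSpace_fin,
    ENNReal.toReal_ofReal (pow_nonneg hr.le _), Measure.real]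

theorem volume_real_unitBall_pos : 0 < volume.real (Metric.ball (0 : E d) 1) :=
  ENNReal.toReal_pos (Metric.measure_ball_pos _ _ one_pos).ne' measure_ball_lt_top.ne

namespace IsSimplex

variable {τ e : Finset (E d)} {a : E d} (h : IsSimplex τ)
include h

theorem one_le_norm_affGrad_mul {y z : E d} (hy : y ∈ τ) (hz : z ∈ τ) (hne : y ≠ z) :
    1 ≤ ‖affGrad (bary τ y)‖ * ‖y - z‖ := by
  have h1 := affine_eq (bary τ y) y z
  rw [h.bary_self hy, h.bary_ne hy hz hne, zero_add] at h1
  rw [h1]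
  exact (le_abs_self _).trans (abs_real_inner_le_norm _ _)

theorem exists_ne (hd : 1 ≤ d) {y : E d} : ∃ z ∈ τ, y ≠ z := by
  have : 1 < τ.card := by rw [h.card_eq]; omega
  obtain ⟨z, hz, hne⟩ := Finset.exists_mem_ne this y
  exact ⟨z, hz, hne.symm⟩

theorem diam_pos (hd : 1 ≤ d) : 0 < Metric.diam (cell τ) := by
  obtain ⟨y, hy⟩ := h.nonempty
  obtain ⟨z, hz, hne⟩ := h.exists_ne hd (y := y)
  exact (norm_pos_iff.2 (sub_ne_zero.2 hne)).trans_le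
    (norm_sub_le_diam (subset_cell τ hy) (subset_cell τ hz))

/-- `inDiam` is a supremum that need not be known to be attained; giving up a factor $2$ makes the
inequality strict and yields an actual ball. A further factor $2$ passes from diameter to radius. -/
theorem regularWith (hd : 1 ≤ d) {c : ℝ} (hc : 0 < c) (hs : Metric.diam (cell τ) ≤ c * inDiam τ) :
    RegularWith (4 * c) τ := by
  have hpos := h.diam_pos hd
  have hin : Metric.diam (cell τ) / (2 * c) < inDiam τ := by
    rw [div_lt_iff₀ (by positivity)]
    nlinarith
  obtain ⟨y, hy⟩ := h.nonempty
  obtain ⟨δ, ⟨-, x, hx⟩, hδ⟩ := exists_lt_of_lt_csSup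
    (s := {δ : ℝ | 0 ≤ δ ∧ ∃ x : E d, Metric.closedBall x (δ / 2) ⊆ cell τ})
    ⟨0, le_rfl, y, by simpa using subset_cell τ hy⟩ hin
  refine ⟨x, (Metric.closedBall_subset_closedBall ?_).trans hx⟩
  have : Metric.diam (cell τ) / (4 * c) = Metric.diam (cell τ) / (2 * c) / 2 := by
    field_simp; norm_num
  rw [this]
  linarith

theorem volReal_le (hd : 1 ≤ d) : volume.real (cell τ) ≤
    (2 * Metric.diam (cell τ)) ^ d * volume.real (Metric.ball (0 : E d) 1) := by
  have hpos := h.diam_pos hd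
  obtain ⟨y, hy⟩ := h.nonempty
  rw [← volume_real_ball y (by positivity)]
  refine measureReal_mono (fun x hx => ?_) measure_ball_lt_top.ne
  rw [Metric.mem_ball, dist_eq_norm]
  have := norm_sub_le_diam hx (subset_cell τ hy)
  linarith

variable {k : ℝ} (hk : 0 < k) (hr : RegularWith k τ)
include hk hr

theorem le_volReal (hd : 1 ≤ d) : (Metric.diam (cell τ) / k) ^ d *
    volume.real (Metric.ball (0 : E d) 1) ≤ volume.real (cell τ) := by
  have hpos := h.diam_pos hd
  obtain ⟨x, hx⟩ := hr
  rw [← volume_real_ball x (by positivity)]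
  exact measureReal_mono (Metric.ball_subset_closedBall.trans hx) (volume_cell_lt_top τ).ne

/-- Moving from the centre of the inscribed ball by its radius in the direction of the gradient
raises the coordinate by radius times gradient length, while the coordinate stays between $0$ and
$1$. -/
theorem norm_affGrad_le (hd : 1 ≤ d) {y : E d} (hy : y ∈ τ) :
    ‖affGrad (bary τ y)‖ ≤ k / Metric.diam (cell τ) := by
  have hpos := h.diam_pos hd
  obtain ⟨x, hx⟩ := hr
  set g := affGrad (bary τ y)
  set r := Metric.diam (cell τ) / k
  have hr0 : 0 < r := by positivity
  rcases eq_or_ne g 0 with hg | hg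
  · rw [hg, norm_zero]; positivity
  have hg0 := norm_pos_iff.2 hg
  have hmem : x + (r / ‖g‖) • g ∈ cell τ := by
    refine hx ?_
    rw [mem_closedBall_iff_norm, add_sub_cancel_left, norm_smul, Real.norm_of_nonneg (by positivity)]
    exact (div_mul_cancel₀ r hg0.ne').le
  have h1 := h.bary_le_one hmem hy
  have h2 := h.mem_cell.1 (hx (Metric.mem_closedBall_self hr0.le)) y hy
  rw [affine_eq (bary τ y) _ x, add_sub_cancel_left, inner_smul_right,
    real_inner_self_eq_norm_sq] at h1
  have h3 : r / ‖g‖ * ‖g‖ ^ 2 = r * ‖g‖ := by field_simp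
  have h4 : r * ‖g‖ ≤ 1 := by linarith
  have : k / Metric.diam (cell τ) = 1 / r := by simp [r]
  rw [this, le_div_iff₀ hr0]
  linarith

/-- As $d\ge2$, the face has two vertices. Between them a barycentric coordinate drops from $1$ to
$0$ with slope at most $k/h_\tau$, so they are at least $h_\tau/k$ apart. -/
theorem diam_le_face (hd : 2 ≤ d) (he : e ⊆ τ) (hc : e.card = d) :
    Metric.diam (cell τ) ≤ k * Metric.diam (cell e) := by
  have hpos := h.diam_pos (by omega)
  obtain ⟨y, hy, z, hz, hne⟩ := Finset.one_lt_card.1 (show 1 < e.card by omega)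
  have h1 := h.one_le_norm_affGrad_mul (he hy) (he hz) hne
  have h2 := h.norm_affGrad_le hk hr (by omega) (he hy)
  have h3 := norm_sub_le_diam (subset_cell e hy) (subset_cell e hz)
  have h4 : 1 ≤ k / Metric.diam (cell τ) * Metric.diam (cell e) :=
    h1.trans (mul_le_mul h2 h3 (norm_nonneg _) (by positivity))
  rw [div_mul_eq_mul_div, le_div_iff₀ hpos, one_mul] at h4
  exact h4

end IsSimplex

theorem diam_face_le {τ e : Finset (E d)} (he : e ⊆ τ) :
    Metric.diam (cell e) ≤ Metric.diam (cell τ) :=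
  Metric.diam_mono (convexHull_mono (by exact_mod_cast he)) (isCompact_cell τ).isBounded

/-! ### The elements at a node: their number and their sizes -/

namespace Mesh

variable (T : Mesh d)

open Classical in
/-- The elements with the vertex `z`. -/
def star (z : E d) : Finset (Finset (E d)) := T.elements.filter (fun τ => z ∈ τ)

variable {T}

theorem mem_star {z : E d} {τ : Finset (E d)} : τ ∈ T.star z ↔ τ ∈ T.elements ∧ z ∈ τ := by
  simp [star]

/-- The number of elements at a node is bounded in terms of the shape regularity. -/
theorem card_star_le (hd : 1 ≤ d) {k : ℝ} (hk : 0 < k)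
    (hr : ∀ τ ∈ T.elements, RegularWith k τ) (z : E d) :
    ((T.star z).card : ℝ) ≤ (k + 1) ^ d := by
  classical
  rcases (T.star z).eq_empty_or_nonempty with h0 | hne
  · rw [h0]; simp only [Finset.card_empty, Nat.cast_zero]; positivity
  obtain ⟨σ, hσ, hmin⟩ := Finset.exists_min_image (T.star z) (fun τ => Metric.diam (cell τ)) hne
  set s := Metric.diam (cell σ)
  have hs : 0 < s := (T.isSimplex (mem_star.1 hσ).1).diam_pos hd
  -- Each element is shrunk towards $z$ to the smallest diameter $s$ in the star. By convexity the
  -- shrunk element stays inside the original one, and it contains a ball of radius $s/k$ with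
  -- centre within $s$ of $z$. These balls are disjoint and lie in the ball of radius
  -- $s+s/k=(k+1)s/k$ about $z$.
  have hcen : ∀ τ ∈ T.star z, ∃ y : E d, Metric.ball y (s / k) ⊆ interior (cell τ) ∧
      ‖y - z‖ ≤ s := by
    intro τ hτ
    obtain ⟨hτT, hz⟩ := mem_star.1 hτ
    obtain ⟨x, hx⟩ := hr τ hτT
    have hpos := (T.isSimplex hτT).diam_pos hd
    set D := Metric.diam (cell τ)
    have hsD : s ≤ D := hmin τ hτ
    have hxc : x ∈ cell τ := hx (Metric.mem_closedBall_self (by positivity))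
    refine ⟨z + (s / D) • (x - z), interior_maximal ?_ Metric.isOpen_ball, ?_⟩
    · intro w hw
      rw [mem_ball_iff_norm] at hw
      have hv : z + (D / s) • (w - z) ∈ cell τ := by
        refine hx ?_
        rw [mem_closedBall_iff_norm]
        have e1 : z + (D / s) • (w - z) - x = (D / s) • (w - (z + (s / D) • (x - z))) := by
          have : (D / s) * (s / D) = 1 := by field_simp
          have e2 : (D / s) • (w - (z + (s / D) • (x - z))) =
              (D / s) • (w - z) - ((D / s) * (s / D)) • (x - z) := by module
          rw [e2, this]; module
        rw [e1, norm_smul, Real.norm_of_nonneg (by positivity)]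
        calc D / s * ‖w - (z + (s / D) • (x - z))‖ ≤ D / s * (s / k) :=
              mul_le_mul_of_nonneg_left hw.le (by positivity)
          _ = D / k := by field_simp
      have e3 : w = (1 - s / D) • z + (s / D) • (z + (D / s) • (w - z)) := by
        have : (s / D) * (D / s) = 1 := by field_simp
        have e2 : (1 - s / D) • z + (s / D) • (z + (D / s) • (w - z)) =
            z + ((s / D) * (D / s)) • (w - z) := by module
        rw [e2, this]; module
      rw [e3]
      have hle : s / D ≤ 1 := (div_le_one hpos).2 hsD
      exact convex_cell τ (subset_cell τ hz) hv (by linarith) (by positivity) (by ring)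
    · rw [add_sub_cancel_left, norm_smul, Real.norm_of_nonneg (by positivity)]
      have := norm_sub_le_diam hxc (subset_cell τ hz)
      calc s / D * ‖x - z‖ ≤ s / D * D := mul_le_mul_of_nonneg_left this (by positivity)
        _ = s := by field_simp
  choose! y hy hyz using hcen
  set b₁ := volume.real (Metric.ball (0 : E d) 1)
  have hb : 0 < b₁ := volume_real_unitBall_pos
  have hdisj : Set.PairwiseDisjoint (↑(T.star z)) fun τ => Metric.ball (y τ) (s / k) := by
    intro τ hτ τ' hτ' hne
    exact (T.disjoint_interior_cell (mem_star.1 hτ).1 (mem_star.1 hτ').1 hne).mono (hy τ hτ)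
      (hy τ' hτ')
  have hsum : ∑ τ ∈ T.star z, volume.real (Metric.ball (y τ) (s / k)) ≤
      volume.real (Metric.ball z (s + s / k)) := by
    rw [← measureReal_biUnion_finset hdisj (fun τ _ => measurableSet_ball)
      (fun τ _ => measure_ball_lt_top.ne)]
    refine measureReal_mono (iUnion₂_subset fun τ hτ => Metric.ball_subset_ball' ?_)
      measure_ball_lt_top.ne
    have := hyz τ hτ
    rw [dist_eq_norm]; linarith
  have hsk : 0 < s / k := by positivity
  rw [Finset.sum_congr rfl fun τ _ => volume_real_ball (y τ) hsk,
    volume_real_ball z (by positivity), Finset.sum_const, nsmul_eq_mul, ← mul_assoc] at hsum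
  have h1 := le_of_mul_le_mul_right hsum hb
  have h2 : s + s / k = (k + 1) * (s / k) := by field_simp
  rw [h2, mul_pow] at h1
  exact le_of_mul_le_mul_right h1 (by positivity)

/-- Bounds along chains of neighbours at a node. -/
theorem Triangulates.abs_sub_le_of_neighbours {Ω : Set (E d)} (hΩ : T.Triangulates Ω) {z : E d}
    {f : Finset (E d) → ℝ} {D : ℝ} (hf : ∀ σ σ', T.NeighboursAt z σ σ' → |f σ - f σ'| ≤ D)
    {τ τ' : Finset (E d)} (hτ : τ ∈ T.star z) (hτ' : τ' ∈ T.star z) :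
    |f τ - f τ'| ≤ (T.star z).card * D := by
  classical
  let V := {σ // σ ∈ T.star z}
  have hrefl : T.NeighboursAt z τ τ := by
    obtain ⟨hτT, hz⟩ := mem_star.1 hτ
    refine ⟨hτT, hτT, hz, hz, ?_⟩
    obtain ⟨e, he, hc⟩ := Finset.exists_subset_card_eq (s := τ) (n := d)
      (by rw [T.card_eq _ hτT]; omega)
    exact ⟨e, hc, he, he⟩
  have hD : 0 ≤ D := (abs_nonneg _).trans (hf τ τ hrefl)
  let Gr : SimpleGraph V := SimpleGraph.fromRel fun σ σ' => T.NeighboursAt z σ.1 σ'.1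
  have hsymm : ∀ σ σ', T.NeighboursAt z σ σ' → T.NeighboursAt z σ' σ := by
    rintro σ σ' ⟨h1, h2, h3, h4, e, h5, h6, h7⟩
    exact ⟨h2, h1, h4, h3, e, h5, h7, h6⟩
  have hreach : ∀ σ, Relation.ReflTransGen (T.NeighboursAt z) τ σ → ∀ hσ : σ ∈ T.star z,
      Gr.Reachable ⟨τ, hτ⟩ ⟨σ, hσ⟩ := by
    intro σ hr
    induction hr with
    | refl => intro _; exact SimpleGraph.Reachable.refl _
    | @tail b c hab hbc ih =>
      intro hc
      have hb : b ∈ T.star z := mem_star.2 ⟨hbc.1, hbc.2.2.1⟩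
      by_cases hbc' : b = c
      · subst hbc'; exact ih hc
      · refine (ih hb).trans (SimpleGraph.Adj.reachable ?_)
        rw [SimpleGraph.fromRel_adj]
        exact ⟨fun H => hbc' (congrArg Subtype.val H), Or.inl hbc⟩
  have hwalk : ∀ (u v : V) (p : Gr.Walk u v), |f u.1 - f v.1| ≤ p.length * D := by
    intro u v p
    induction p with
    | nil => simp
    | @cons u v w huv p ih =>
      have h1 : |f u.1 - f v.1| ≤ D := by
        rw [SimpleGraph.fromRel_adj] at huv
        rcases huv.2 with h | h
        exacts [hf _ _ h, hf _ _ (hsymm _ _ h)]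
      rw [SimpleGraph.Walk.length_cons, Nat.cast_add, Nat.cast_one, add_mul, one_mul]
      have := abs_sub_le (f u.1) (f v.1) (f w.1)
      linarith
  obtain ⟨hτT, hz⟩ := mem_star.1 hτ
  obtain ⟨hτT', hz'⟩ := mem_star.1 hτ'
  obtain ⟨p⟩ := hreach τ' (hΩ.linked z τ hτT τ' hτT' hz hz') hτ'
  have hlen : p.toPath.1.length < Fintype.card V := p.toPath.2.length_lt
  refine (hwalk _ _ p.toPath.1).trans (mul_le_mul_of_nonneg_right ?_ hD)
  rw [Fintype.card_coe] at hlen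
  exact_mod_cast hlen.le

/-- Elements at a common node have comparable diameters. -/
theorem Triangulates.diam_le {Ω : Set (E d)} (hΩ : T.Triangulates Ω) (hd : 2 ≤ d) {k : ℝ}
    (hk : 1 ≤ k) (hr : ∀ τ ∈ T.elements, RegularWith k τ) {z : E d} {τ τ' : Finset (E d)}
    (hτ : τ ∈ T.star z) (hτ' : τ' ∈ T.star z) :
    Metric.diam (cell τ) ≤ Real.exp ((k + 1) ^ d * Real.log k) * Metric.diam (cell τ') := by
  have hk0 : 0 < k := by linarith
  have hpos : ∀ σ ∈ T.elements, 0 < Metric.diam (cell σ) := fun σ hσ =>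
    (T.isSimplex hσ).diam_pos (by omega)
  -- Logarithms make the comparison additive along chains. For neighbours with common face $e$ one
  -- has $h_\sigma\le k\,h_e\le k\,h_{\sigma'}$.
  have hhalf : ∀ σ σ', T.NeighboursAt z σ σ' →
      Real.log (Metric.diam (cell σ)) - Real.log (Metric.diam (cell σ')) ≤ Real.log k := by
    rintro σ σ' ⟨h1, h2, h3, h4, e, h5, h6, h7⟩
    have h8 := (T.isSimplex h1).diam_le_face hk0 (hr σ h1) hd h6 h5
    have h9 := h8.trans (mul_le_mul_of_nonneg_left (diam_face_le h7) hk0.le)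
    have := Real.log_le_log (hpos σ h1) h9
    rw [Real.log_mul hk0.ne' (hpos σ' h2).ne'] at this
    linarith
  have h1 := hΩ.abs_sub_le_of_neighbours (z := z) (f := fun σ => Real.log (Metric.diam (cell σ)))
    (D := Real.log k) (fun σ σ' hn => abs_sub_le_iff.2 ⟨hhalf σ σ' hn, hhalf σ' σ (by
      obtain ⟨h1, h2, h3, h4, e, h5, h6, h7⟩ := hn
      exact ⟨h2, h1, h4, h3, e, h5, h7, h6⟩)⟩) hτ hτ'
  have h2 : Real.log (Metric.diam (cell τ)) - Real.log (Metric.diam (cell τ')) ≤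
      (k + 1) ^ d * Real.log k :=
    (le_abs_self _).trans (h1.trans (mul_le_mul_of_nonneg_right
      (card_star_le (by omega) hk0 hr z) (Real.log_nonneg hk)))
  have hp := hpos τ (mem_star.1 hτ).1
  have hp' := hpos τ' (mem_star.1 hτ').1
  rw [← Real.exp_log hp, ← Real.exp_log hp', ← Real.exp_add, Real.exp_le_exp]
  linarith

end Mesh

/-! ### Finite element functions with given nodal values -/

/-- The affine function with the values `c` at the vertices of a simplex. -/
def nodalAffine (τ : Finset (E d)) (c : E d → ℝ) : E d →ᵃ[ℝ] ℝ := ∑ z ∈ τ, c z • bary τ z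

theorem affineMap_sum_apply {ι : Type*} (s : Finset ι) (f : ι → E d →ᵃ[ℝ] ℝ) (x : E d) :
    (∑ i ∈ s, f i) x = ∑ i ∈ s, f i x := by
  classical
  induction s using Finset.induction_on with
  | empty => simp
  | insert i s hi ih => rw [Finset.sum_insert hi, Finset.sum_insert hi, AffineMap.coe_add, Pi.add_apply, ih]

theorem nodalAffine_apply (τ : Finset (E d)) (c : E d → ℝ) (x : E d) :
    nodalAffine τ c x = ∑ z ∈ τ, c z * bary τ z x := by
  rw [nodalAffine, affineMap_sum_apply]; rfl

theorem IsSimplex.nodalAffine_vertex {τ : Finset (E d)} (h : IsSimplex τ) (c : E d → ℝ) {z : E d}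
    (hz : z ∈ τ) : nodalAffine τ c z = c z := by
  rw [nodalAffine_apply, Finset.sum_eq_single_of_mem z hz, h.bary_self hz, mul_one]
  intro y hy hyz
  rw [h.bary_ne hy hz hyz, mul_zero]

theorem convex_eqOn_affine (A B : E d →ᵃ[ℝ] ℝ) : Convex ℝ {y | A y = B y} := by
  have : {y | A y = B y} = (A - B) ⁻¹' {0} := by
    ext y; simp [sub_eq_zero]
  rw [this]
  exact (convex_singleton (0 : ℝ)).affine_preimage (A - B)

namespace Mesh

variable {T : Mesh d}

/-- Both affine functions take the values $c$ at the common vertices, and by conformity a common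
point lies in their hull. -/
theorem nodalAffine_eqOn {τ τ' : Finset (E d)} (hτ : τ ∈ T.elements) (hτ' : τ' ∈ T.elements)
    (c : E d → ℝ) {x : E d} (hx : x ∈ cell τ) (hx' : x ∈ cell τ') :
    nodalAffine τ c x = nodalAffine τ' c x := by
  refine convexHull_min ?_ (convex_eqOn_affine _ _) (T.conforming τ hτ τ' hτ' ⟨hx, hx'⟩)
  intro z hz
  change nodalAffine τ c z = nodalAffine τ' c z
  rw [(T.isSimplex hτ).nodalAffine_vertex c hz.1, (T.isSimplex hτ').nodalAffine_vertex c hz.2]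

variable (T) in
theorem exists_feFunction (c : E d → ℝ) :
    ∃ w : E d → ℝ, ∀ τ ∈ T.elements, EqOn w (nodalAffine τ c) (cell τ) := by
  classical
  refine ⟨fun x => if h : ∃ τ ∈ T.elements, x ∈ cell τ then nodalAffine h.choose c x else 0, ?_⟩
  intro τ hτ x hx
  have h : ∃ τ ∈ T.elements, x ∈ cell τ := ⟨τ, hτ, hx⟩
  simp only [dif_pos h]
  exact nodalAffine_eqOn h.choose_spec.1 hτ c h.choose_spec.2 hx

/-- A node in a closed element is one of its vertices. -/
theorem mem_of_mem_cell {τ τ' : Finset (E d)} (hτ : τ ∈ T.elements) (hτ' : τ' ∈ T.elements)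
    {z : E d} (hz : z ∈ τ) (hz' : z ∈ cell τ') : z ∈ τ' := by
  by_contra hn
  have h := T.isSimplex hτ
  have hconv : Convex ℝ {y | bary τ z y = 0} :=
    (convex_singleton (0 : ℝ)).affine_preimage (bary τ z)
  have h0 : z ∈ {y | bary τ z y = 0} := by
    refine convexHull_min ?_ hconv (T.conforming τ hτ τ' hτ' ⟨subset_cell τ hz, hz'⟩)
    intro y hy
    exact h.bary_ne hz hy.1 (fun H => hn (H ▸ hy.2))
  have := h.bary_self hz
  rw [mem_ofPred_eq] at h0
  rw [h0] at this
  exact zero_ne_one this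

/-! ### Estimates at a node -/

/-- The energy of a gradient in the elements with the vertex `z`. -/
def starEnergy (T : Mesh d) (G : E d → E d) (z : E d) : ℝ :=
  ∑ σ ∈ T.star z, ∫ x in cell σ, ‖G x‖ ^ 2

/-- The energy of a gradient in the elements that touch the element `τ`, with multiplicities. -/
def patchEnergy (T : Mesh d) (G : E d → E d) (τ : Finset (E d)) : ℝ :=
  ∑ z ∈ τ, T.starEnergy G z

theorem integral_norm_sq_nonneg (G : E d → E d) (s : Set (E d)) : 0 ≤ ∫ x in s, ‖G x‖ ^ 2 :=
  integral_nonneg fun _ => by positivity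

theorem starEnergy_nonneg (G : E d → E d) (z : E d) : 0 ≤ T.starEnergy G z :=
  Finset.sum_nonneg fun _ _ => integral_norm_sq_nonneg _ _

theorem patchEnergy_nonneg (G : E d → E d) (τ : Finset (E d)) : 0 ≤ T.patchEnergy G τ :=
  Finset.sum_nonneg fun _ _ => starEnergy_nonneg _ _

theorem integral_le_starEnergy (G : E d → E d) {z : E d} {σ : Finset (E d)} (hσ : σ ∈ T.star z) :
    ∫ x in cell σ, ‖G x‖ ^ 2 ≤ T.starEnergy G z :=
  Finset.single_le_sum (f := fun σ => ∫ x in cell σ, ‖G x‖ ^ 2)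
    (fun _ _ => integral_norm_sq_nonneg _ _) hσ

theorem integral_le_patchEnergy (G : E d → E d) {τ : Finset (E d)} (hτ : τ ∈ T.elements) :
    ∫ x in cell τ, ‖G x‖ ^ 2 ≤ T.patchEnergy G τ := by
  obtain ⟨z, hz⟩ := (T.isSimplex hτ).nonempty
  exact (integral_le_starEnergy G (mem_star.2 ⟨hτ, hz⟩)).trans
    (Finset.single_le_sum (f := fun z => T.starEnergy G z) (fun _ _ => starEnergy_nonneg _ _) hz)

/-- The patches overlap finitely often. -/
theorem sum_patchEnergy_le {Ω : Set (E d)} (hΩ : T.Triangulates Ω) (hd : 1 ≤ d) {k : ℝ}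
    (hk : 0 < k) (hr : ∀ τ ∈ T.elements, RegularWith k τ) {G : E d → E d}
    (hG : MemLp G 2 (volume.restrict Ω)) :
    ∑ τ ∈ T.elements, T.patchEnergy G τ ≤ (d + 1) * (k + 1) ^ d * ∫ x in Ω, ‖G x‖ ^ 2 := by
  classical
  set I : Finset (E d) → ℝ := fun σ => ∫ x in cell σ, ‖G x‖ ^ 2
  have hI : ∀ σ, 0 ≤ I σ := fun σ => integral_norm_sq_nonneg _ _
  have e1 : ∀ τ ∈ T.elements, T.patchEnergy G τ =
      ∑ σ ∈ T.elements, ∑ z ∈ τ, if z ∈ σ then I σ else 0 := by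
    intro τ _
    rw [Finset.sum_comm]
    refine Finset.sum_congr rfl fun z _ => ?_
    rw [starEnergy, star, Finset.sum_filter]
  rw [Finset.sum_congr rfl e1, Finset.sum_comm, hΩ.integral_eq
    (fun τ hτ => (hΩ.memLp_cell hG hτ).integrable_norm_pow (p := 2) (by norm_num)), Finset.mul_sum]
  refine Finset.sum_le_sum fun σ hσ => ?_
  have e2 : ∑ τ ∈ T.elements, ∑ z ∈ τ, (if z ∈ σ then I σ else 0) =
      ∑ z ∈ σ, ∑ τ ∈ T.star z, I σ := by
    simp_rw [star, Finset.sum_filter]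
    rw [Finset.sum_comm]
    refine Finset.sum_congr rfl fun τ _ => ?_
    rw [← Finset.sum_filter, ← Finset.sum_filter]
    refine Finset.sum_congr ?_ fun _ _ => rfl
    ext z; simp [and_comm]
  rw [e2]
  calc ∑ z ∈ σ, ∑ τ ∈ T.star z, I σ ≤ ∑ z ∈ σ, (k + 1) ^ d * I σ := by
        refine Finset.sum_le_sum fun z _ => ?_
        rw [Finset.sum_const, nsmul_eq_mul]
        exact mul_le_mul_of_nonneg_right (card_star_le hd hk hr z) (hI σ)
    _ = (d + 1) * (k + 1) ^ d * I σ := by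
        rw [Finset.sum_const, T.card_eq _ hσ, nsmul_eq_mul]; push_cast; ring

/-- The constant in the comparison of the diameters of the elements at a node. -/
def sizeConst (d : ℕ) (k : ℝ) : ℝ := Real.exp ((k + 1) ^ d * Real.log k)

/-- The constant in the estimate of nodal values. -/
def nodeConst (d : ℕ) (k : ℝ) : ℝ :=
  (2 * (k + 1) ^ d + 1) ^ 2 * (sizeConst d k ^ 2 * (2 * sizeConst d k * k) ^ d)

theorem sizeConst_pos (d : ℕ) (k : ℝ) : 0 < sizeConst d k := Real.exp_pos _

theorem nodeConst_pos (d : ℕ) {k : ℝ} (hk : 0 < k) : 0 < nodeConst d k := by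
  have := sizeConst_pos d k
  unfold nodeConst
  positivity

section

variable {Ω : Set (E d)} (hΩ : T.Triangulates Ω) (hd : 2 ≤ d) {k : ℝ} (hk : 1 ≤ k)
  (hr : ∀ τ ∈ T.elements, RegularWith k τ)
include hΩ hd hk hr

/-- With $\Lambda$ the size constant, $h_\sigma\le\Lambda h_\tau$, while $\tau$ lies in a ball of
radius $2h_\tau\le2\Lambda h_\sigma$ and $\sigma$ contains one of radius $h_\sigma/k$. The ratio of
these radii gives $(2\Lambda k)^d$. -/
theorem Triangulates.diam_sq_div_le {z : E d} {τ σ : Finset (E d)} (hτ : τ ∈ T.star z)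
    (hσ : σ ∈ T.star z) : Metric.diam (cell σ) ^ 2 / volume.real (cell σ) ≤
      sizeConst d k ^ 2 * (2 * sizeConst d k * k) ^ d *
        (Metric.diam (cell τ) ^ 2 / volume.real (cell τ)) := by
  have hk0 : 0 < k := by linarith
  have h1 := hΩ.diam_le hd hk hr hσ hτ
  have h2 := hΩ.diam_le hd hk hr hτ hσ
  rw [← sizeConst] at h1 h2
  have hs := T.isSimplex (mem_star.1 hσ).1
  have ht := T.isSimplex (mem_star.1 hτ).1
  have hΛ := sizeConst_pos d k
  set Λ := sizeConst d k
  set b := volume.real (Metric.ball (0 : E d) 1)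
  have hb : 0 < b := volume_real_unitBall_pos
  have v1 := ht.volReal_le (by omega)
  have v2 := hs.le_volReal hk0 (hr _ (mem_star.1 hσ).1) (by omega)
  have p1 := hs.volReal_pos
  have p2 := ht.volReal_pos
  have p3 := hs.diam_pos (by omega)
  have p4 := ht.diam_pos (by omega)
  have v3 : volume.real (cell τ) ≤ (2 * Λ * k) ^ d * volume.real (cell σ) := by
    refine v1.trans (le_trans ?_ (mul_le_mul_of_nonneg_left v2 (by positivity)))
    rw [← mul_assoc, ← mul_pow]
    refine mul_le_mul_of_nonneg_right (pow_le_pow_left₀ (by positivity) ?_ _) hb.le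
    have : 2 * Λ * k * (Metric.diam (cell σ) / k) = 2 * (Λ * Metric.diam (cell σ)) := by
      field_simp
    rw [this]; linarith
  rw [div_le_iff₀ p1]
  have h3 : Metric.diam (cell σ) ^ 2 ≤ Λ ^ 2 * Metric.diam (cell τ) ^ 2 := by
    rw [← mul_pow]; exact pow_le_pow_left₀ p3.le h1 2
  have h4 : 1 ≤ (2 * Λ * k) ^ d * volume.real (cell σ) / volume.real (cell τ) := by
    rw [le_div_iff₀ p2, one_mul]; exact v3
  calc Metric.diam (cell σ) ^ 2 ≤ Λ ^ 2 * Metric.diam (cell τ) ^ 2 * 1 := by rw [mul_one]; exact h3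
    _ ≤ Λ ^ 2 * Metric.diam (cell τ) ^ 2 *
        ((2 * Λ * k) ^ d * volume.real (cell σ) / volume.real (cell τ)) :=
      mul_le_mul_of_nonneg_left h4 (by positivity)
    _ = _ := by ring

variable {C : Set (E d)} {φ : E d → ℝ} {G : E d → E d} (hφ : T.InVc Ω C φ G)
include hφ

/-- The bound is scaled with a fixed reference element $\tau$, so that the same number serves for
every $\sigma$ in the star. -/
theorem InVc.face_deviation_le {z : E d} {τ σ e : Finset (E d)} {a : E d} (hτ : τ ∈ T.star z)
    (hσ : σ ∈ T.star z) (hf : IsFace σ e a) :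
    |faceMean σ a φ G - cellMean σ φ| ≤
      Real.sqrt (sizeConst d k ^ 2 * (2 * sizeConst d k * k) ^ d *
        (Metric.diam (cell τ) ^ 2 / volume.real (cell τ)) * T.starEnergy G z) := by
  refine Real.abs_le_sqrt ?_
  have hσT := (mem_star.1 hσ).1
  refine ((T.isSimplex hσT).abs_faceMean_sub_cellMean_le hf.mem (hΩ.memLp_cell hφ.isH1.memLp hσT)
    (hΩ.memLp_cell hφ.isH1.grad_memLp hσT)).trans ?_
  have := sizeConst_pos d k
  exact mul_le_mul (hΩ.diam_sq_div_le hd hk hr hτ hσ) (integral_le_starEnergy G hσ)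
    (integral_norm_sq_nonneg _ _) (by positivity)

/-- The mean values over the elements at a node, and over their faces, are close to each other. -/
theorem InVc.node_deviation_le {z : E d} {τ σ : Finset (E d)} (hτ : τ ∈ T.star z)
    (hσ : σ ∈ T.star z) {c : ℝ}
    (hc : c = cellMean σ φ ∨ ∃ e a, IsFace σ e a ∧ c = faceMean σ a φ G) :
    (c - cellMean τ φ) ^ 2 ≤ nodeConst d k *
      (Metric.diam (cell τ) ^ 2 / volume.real (cell τ)) * T.starEnergy G z := by
  set K := sizeConst d k ^ 2 * (2 * sizeConst d k * k) ^ d *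
    (Metric.diam (cell τ) ^ 2 / volume.real (cell τ)) * T.starEnergy G z
  set D := Real.sqrt K
  have hD : 0 ≤ D := Real.sqrt_nonneg _
  have hK : 0 ≤ K := by
    have := sizeConst_pos d k
    have := starEnergy_nonneg (T := T) G z
    positivity
  -- Neighbours share the mean value over their common face; each cell mean deviates from it by at
  -- most `D`.
  have hn : ∀ σ σ', T.NeighboursAt z σ σ' → |cellMean σ φ - cellMean σ' φ| ≤ 2 * D := by
    rintro σ σ' ⟨h1, h2, h3, h4, e, h5, h6, h7⟩
    obtain ⟨a, hf⟩ := (T.isSimplex h1).exists_isFace h6 h5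
    obtain ⟨a', hf'⟩ := (T.isSimplex h2).exists_isFace h7 h5
    have b1 := hφ.face_deviation_le hΩ hd hk hr hτ (mem_star.2 ⟨h1, h3⟩) hf
    have b2 := hφ.face_deviation_le hΩ hd hk hr hτ (mem_star.2 ⟨h2, h4⟩) hf'
    rw [hφ.faceMean_eq hΩ (by omega) h1 h2 hf hf', abs_sub_comm] at b1
    have := abs_sub_le (cellMean σ φ) (faceMean σ' a' φ G) (cellMean σ' φ)
    change _ ≤ D at b1 b2
    linarith
  have hchain := hΩ.abs_sub_le_of_neighbours (f := fun σ => cellMean σ φ) hn hσ hτ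
  have hcard := card_star_le (T := T) (by omega) (by linarith) hr z
  have h1 : |c - cellMean σ φ| ≤ D := by
    rcases hc with rfl | ⟨e, a, hf, rfl⟩
    · simpa using hD
    · exact hφ.face_deviation_le hΩ hd hk hr hτ hσ hf
  -- At most $(k+1)^d$ chain steps of size $2D$, and one further $D$ if $c$ is a face mean. Squaring
  -- gives `nodeConst`.
  have h2 : |c - cellMean τ φ| ≤ (2 * (k + 1) ^ d + 1) * D := by
    have := abs_sub_le c (cellMean σ φ) (cellMean τ φ)
    have h3 : ((T.star z).card : ℝ) * (2 * D) ≤ (k + 1) ^ d * (2 * D) :=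
      mul_le_mul_of_nonneg_right hcard (by positivity)
    linarith
  have h3 := pow_le_pow_left₀ (abs_nonneg _) h2 2
  rw [sq_abs, mul_pow, Real.sq_sqrt hK] at h3
  refine h3.trans (le_of_eq ?_)
  simp only [K, nodeConst]; ring

/-- The quasi-interpolant: nodal values close to the local mean values, and zero on the crack. -/
theorem InVc.exists_nodal_values {w : E d → ℝ} {tol : ℝ} (hC : T.crackSet w tol ⊆ C) :
    ∃ c : E d → ℝ, (∀ z ∈ T.nodes, z ∈ T.crackSet w tol → c z = 0) ∧
      ∀ τ ∈ T.elements, ∀ z ∈ τ, (c z - cellMean τ φ) ^ 2 ≤ nodeConst d k *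
        (Metric.diam (cell τ) ^ 2 / volume.real (cell τ)) * T.starEnergy G z := by
  classical
  have key : ∀ z ∈ T.nodes, ∃ c : ℝ, (z ∈ T.crackSet w tol → c = 0) ∧
      ∀ τ ∈ T.star z, (c - cellMean τ φ) ^ 2 ≤ nodeConst d k *
        (Metric.diam (cell τ) ^ 2 / volume.real (cell τ)) * T.starEnergy G z := by
    rintro z ⟨σ, hσ, hz⟩
    by_cases hzC : z ∈ T.crackSet w tol
    -- The value $0$ at a crack node is the face mean over a crack face $e$ containing $z$. The
    -- element $\sigma'$ with this face has $z$ as a vertex by conformity, so it belongs to the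
    -- star.
    · obtain ⟨e, ⟨⟨hec, σ', hσ', heσ⟩, hew⟩, hze⟩ := mem_iUnion₂.1 hzC
      have hecr : cell e ⊆ T.crackSet w tol := fun x hx =>
        mem_iUnion₂.2 ⟨e, ⟨⟨hec, σ', hσ', heσ⟩, hew⟩, hx⟩
      obtain ⟨a, hf⟩ := (T.isSimplex hσ').exists_isFace heσ hec
      have hzσ' : z ∈ σ' := mem_of_mem_cell hσ hσ' hz
        (convexHull_mono (by exact_mod_cast heσ) hze)
      refine ⟨0, fun _ => rfl, fun τ hτ => ?_⟩
      exact hφ.node_deviation_le hΩ hd hk hr hτ (mem_star.2 ⟨hσ', hzσ'⟩)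
        (Or.inr ⟨e, a, hf, (hφ.faceMean_eq_zero hΩ (by omega) hσ' hf (hecr.trans hC)).symm⟩)
    · exact ⟨cellMean σ φ, fun H => absurd H hzC, fun τ hτ =>
        hφ.node_deviation_le hΩ hd hk hr hτ (mem_star.2 ⟨hσ, hz⟩) (Or.inl rfl)⟩
  choose! c hc0 hc using key
  exact ⟨c, hc0, fun τ hτ z hz => hc z ⟨τ, hτ, hz⟩ τ (mem_star.2 ⟨hτ, hz⟩)⟩

end

end Mesh

/-! ### Estimates on an element -/

section

variable {τ : Finset (E d)} (h : IsSimplex τ) (c : E d → ℝ) (m : ℝ)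
include h

/-- The barycentric coordinates sum to $1$, so the difference is $\sum_z(c_z-m)\lambda_z$. Use
Cauchy-Schwarz and $\sum\lambda_z^2\le\sum\lambda_z=1$. -/
theorem IsSimplex.nodalAffine_sub_sq_le {x : E d} (hx : x ∈ cell τ) :
    (nodalAffine τ c x - m) ^ 2 ≤ ∑ z ∈ τ, (c z - m) ^ 2 := by
  have e1 : nodalAffine τ c x - m = ∑ z ∈ τ, (c z - m) * bary τ z x := by
    simp_rw [sub_mul]
    rw [Finset.sum_sub_distrib, ← Finset.mul_sum, h.sum_bary, nodalAffine_apply, mul_one]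
  rw [e1]
  refine (Finset.sum_mul_sq_le_sq_mul_sq _ _ _).trans
    (mul_le_of_le_one_right (Finset.sum_nonneg fun _ _ => sq_nonneg _) ?_)
  rw [← h.sum_bary x]
  refine Finset.sum_le_sum fun z hz => ?_
  have h0 := h.mem_cell.1 hx z hz
  have h1 := h.bary_le_one hx hz
  nlinarith

/-- An inverse estimate: $m$ may be subtracted because constants have no gradient, and $d+1$ comes
from Cauchy-Schwarz over the vertices. -/
theorem IsSimplex.norm_affGrad_nodalAffine_sq_le (hd : 1 ≤ d) {k : ℝ} (hk : 0 < k)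
    (hr : RegularWith k τ) : ‖affGrad (nodalAffine τ c)‖ ^ 2 ≤
      (d + 1) * (k / Metric.diam (cell τ)) ^ 2 * ∑ z ∈ τ, (c z - m) ^ 2 := by
  have e1 : affGrad (nodalAffine τ c) = ∑ z ∈ τ, (c z - m) • affGrad (bary τ z) := by
    simp_rw [sub_smul]
    rw [Finset.sum_sub_distrib, ← Finset.smul_sum, h.sum_affGrad_bary, smul_zero, sub_zero,
      h.affGrad_eq_sum]
    exact Finset.sum_congr rfl fun z hz => by rw [h.nodalAffine_vertex c hz]
  have hkd : 0 ≤ k / Metric.diam (cell τ) := by have := h.diam_pos hd; positivity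
  have h1 : ‖affGrad (nodalAffine τ c)‖ ≤ ∑ z ∈ τ, |c z - m| * (k / Metric.diam (cell τ)) := by
    rw [e1]
    refine (norm_sum_le _ _).trans (Finset.sum_le_sum fun z hz => ?_)
    rw [norm_smul, Real.norm_eq_abs]
    exact mul_le_mul_of_nonneg_left (h.norm_affGrad_le hk hr hd hz) (abs_nonneg _)
  refine (pow_le_pow_left₀ (norm_nonneg _) h1 2).trans
    ((Finset.sum_mul_sq_le_sq_mul_sq _ _ _).trans (le_of_eq ?_))
  simp only [sq_abs, Finset.sum_const, h.card_eq, nsmul_eq_mul]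
  push_cast; ring

end

/-! ### Interpolation estimates on an element -/

/-- The constant in the interpolation estimates. -/
def interpConst (d : ℕ) (k : ℝ) : ℝ :=
  2 * 2 ^ d + 2 + 2 * Mesh.nodeConst d k * (1 + (d + 1) * k ^ 2)

theorem interpConst_pos (d : ℕ) {k : ℝ} (hk : 0 < k) : 0 < interpConst d k := by
  have := Mesh.nodeConst_pos d hk
  unfold interpConst
  positivity

/-- The nodal values `c` are close to the mean value of `φ` on the element `τ`. -/
def CloseNodalValues (T : Mesh d) (k : ℝ) (τ : Finset (E d)) (φ : E d → ℝ) (G : E d → E d)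
    (c : E d → ℝ) : Prop :=
  ∀ z ∈ τ, (c z - cellMean τ φ) ^ 2 ≤ Mesh.nodeConst d k *
    (Metric.diam (cell τ) ^ 2 / volume.real (cell τ)) * T.starEnergy G z

section

variable {T : Mesh d} {τ : Finset (E d)} (hτ : τ ∈ T.elements) (hd : 2 ≤ d) {k : ℝ} (hk : 1 ≤ k)
  (hr : RegularWith k τ) {φ : E d → ℝ} {G : E d → E d} {Φ : ℕ → E d → ℝ}
  (hA : Approximates τ φ G Φ) {c : E d → ℝ} (hc : CloseNodalValues T k τ φ G c)
include hτ hc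

theorem CloseNodalValues.sum_le : volume.real (cell τ) * ∑ z ∈ τ, (c z - cellMean τ φ) ^ 2 ≤
    Mesh.nodeConst d k * Metric.diam (cell τ) ^ 2 * T.patchEnergy G τ := by
  have hV := (T.isSimplex hτ).volReal_pos
  have := Finset.sum_le_sum hc
  rw [← Finset.mul_sum] at this
  refine (mul_le_mul_of_nonneg_left this hV.le).trans (le_of_eq ?_)
  rw [Mesh.patchEnergy]
  field_simp

include hd hk hA

/-- Both functions are compared with the mean value of $\varphi$: Poincaré for $\varphi$, closeness
of the nodal values for the interpolant. -/
theorem CloseNodalValues.integral_sub_sq_le :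
    ∫ x in cell τ, ‖φ x - nodalAffine τ c x‖ ^ 2 ≤
      interpConst d k * Metric.diam (cell τ) ^ 2 * T.patchEnergy G τ := by
  have h := T.isSimplex hτ
  have hk0 : 0 < k := by linarith
  have hN := Mesh.nodeConst_pos d hk0
  have hP := Mesh.patchEnergy_nonneg (T := T) G τ
  have hfin : IsFiniteMeasure (volume.restrict (cell τ)) := ⟨by simpa using volume_cell_lt_top τ⟩
  set m := cellMean τ φ
  set S := ∑ z ∈ τ, (c z - m) ^ 2
  have hAm : MemLp (nodalAffine τ c) 2 (volume.restrict (cell τ)) :=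
    memLp_two_cell (continuous_affine _) (volume_cell_lt_top τ)
  have hi1 : IntegrableOn (fun x => ‖φ x - nodalAffine τ c x‖ ^ 2) (cell τ) :=
    (hA.memLp.sub hAm).integrable_norm_pow (p := 2) (by norm_num)
  have hi2 : IntegrableOn (fun x => ‖φ x - m‖ ^ 2) (cell τ) :=
    (hA.memLp.sub (memLp_const m)).integrable_norm_pow (p := 2) (by norm_num)
  have h1 : ∫ x in cell τ, ‖φ x - nodalAffine τ c x‖ ^ 2 ≤
      ∫ x in cell τ, (2 * ‖φ x - m‖ ^ 2 + 2 * S) := by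
    refine setIntegral_mono_on hi1 ((hi2.const_mul 2).add (integrable_const _))
      (measurableSet_cell τ) fun x hx => ?_
    have := h.nodalAffine_sub_sq_le c m hx
    simp only [Real.norm_eq_abs, sq_abs]
    nlinarith [sq_nonneg ((φ x - m) + (nodalAffine τ c x - m))]
  rw [integral_add (hi2.const_mul 2) (integrable_const _), integral_const_mul, setIntegral_const,
    smul_eq_mul] at h1
  have h2 := hA.poincare h
  have h3 := hc.sum_le hτ
  have h4 := Mesh.integral_le_patchEnergy G hτ
  have h5 : 2 ^ d * Metric.diam (cell τ) ^ 2 * ∫ x in cell τ, ‖G x‖ ^ 2 ≤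
      2 ^ d * Metric.diam (cell τ) ^ 2 * T.patchEnergy G τ :=
    mul_le_mul_of_nonneg_left h4 (by positivity)
  have h6 : (2 * 2 ^ d + 2 * Mesh.nodeConst d k) * (Metric.diam (cell τ) ^ 2 * T.patchEnergy G τ) ≤
      interpConst d k * (Metric.diam (cell τ) ^ 2 * T.patchEnergy G τ) := by
    refine mul_le_mul_of_nonneg_right ?_ (by positivity)
    unfold interpConst
    have : 0 ≤ 2 * Mesh.nodeConst d k * ((d + 1) * k ^ 2) := by positivity
    nlinarith
  change volume.real (cell τ) * S ≤ _ at h3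
  linarith

include hr

/-- Stability of the interpolant in $H^1$: the factor $h_\tau^{-2}$ of the inverse estimate cancels
the $h_\tau^2$ in the deviation of the nodal values. -/
theorem CloseNodalValues.integral_grad_sub_sq_le :
    ∫ x in cell τ, ‖G x - affGrad (nodalAffine τ c)‖ ^ 2 ≤
      interpConst d k * T.patchEnergy G τ := by
  have h := T.isSimplex hτ
  have hk0 : 0 < k := by linarith
  have hN := Mesh.nodeConst_pos d hk0
  have hP := Mesh.patchEnergy_nonneg (T := T) G τ
  have hD := h.diam_pos (by omega)
  have hV := h.volReal_pos
  have hfin : IsFiniteMeasure (volume.restrict (cell τ)) := ⟨by simpa using volume_cell_lt_top τ⟩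
  set m := cellMean τ φ
  set S := ∑ z ∈ τ, (c z - m) ^ 2
  set g := affGrad (nodalAffine τ c)
  have hi1 : IntegrableOn (fun x => ‖G x - g‖ ^ 2) (cell τ) :=
    (hA.grad_memLp.sub (memLp_const g)).integrable_norm_pow (p := 2) (by norm_num)
  have hi2 : IntegrableOn (fun x => ‖G x‖ ^ 2) (cell τ) :=
    hA.grad_memLp.integrable_norm_pow (p := 2) (by norm_num)
  have h1 : ∫ x in cell τ, ‖G x - g‖ ^ 2 ≤ ∫ x in cell τ, (2 * ‖G x‖ ^ 2 + 2 * ‖g‖ ^ 2) := by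
    refine integral_mono hi1 ((hi2.const_mul 2).add (integrable_const _)) fun x => ?_
    have := pow_le_pow_left₀ (norm_nonneg _) (norm_sub_le (G x) g) 2
    dsimp only
    nlinarith [sq_nonneg (‖G x‖ - ‖g‖)]
  rw [integral_add (hi2.const_mul 2) (integrable_const _), integral_const_mul, setIntegral_const,
    smul_eq_mul] at h1
  have h2 := h.norm_affGrad_nodalAffine_sq_le c m (by omega) hk0 hr
  have h3 := hc.sum_le hτ
  change volume.real (cell τ) * S ≤ _ at h3
  have h4 := Mesh.integral_le_patchEnergy G hτ
  have h5 : volume.real (cell τ) * ‖g‖ ^ 2 ≤ (d + 1) * k ^ 2 * Mesh.nodeConst d k * T.patchEnergy G τ := by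
    calc volume.real (cell τ) * ‖g‖ ^ 2
        ≤ volume.real (cell τ) * ((d + 1) * (k / Metric.diam (cell τ)) ^ 2 * S) :=
          mul_le_mul_of_nonneg_left h2 hV.le
      _ = (d + 1) * (k / Metric.diam (cell τ)) ^ 2 * (volume.real (cell τ) * S) := by ring
      _ ≤ (d + 1) * (k / Metric.diam (cell τ)) ^ 2 *
          (Mesh.nodeConst d k * Metric.diam (cell τ) ^ 2 * T.patchEnergy G τ) :=
          mul_le_mul_of_nonneg_left h3 (by positivity)
      _ = _ := by field_simp
  have h6 : (2 + 2 * Mesh.nodeConst d k * ((d + 1) * k ^ 2)) * T.patchEnergy G τ ≤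
      interpConst d k * T.patchEnergy G τ := by
    refine mul_le_mul_of_nonneg_right ?_ hP
    unfold interpConst
    have : (0 : ℝ) < 2 ^ d := by positivity
    nlinarith
  linarith

/-- The mean values of the interpolation error over the faces. -/
theorem CloseNodalValues.surf_mul_faceMean_sq_le {e : Finset (E d)} {a : E d}
    (hf : IsFace τ e a) : surf e / Metric.diam (cell e) *
      faceMean τ a (fun x => φ x - nodalAffine τ c x) (fun x => G x - affGrad (nodalAffine τ c)) ^ 2
      ≤ 4 * d * k ^ 2 * interpConst d k * T.patchEnergy G τ := by
  have h := T.isSimplex hτ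
  have hk0 : 0 < k := by linarith
  have hC := interpConst_pos d hk0
  have hP := Mesh.patchEnergy_nonneg (T := T) G τ
  have hD := h.diam_pos (by omega)
  have hV := h.volReal_pos
  have hfin : IsFiniteMeasure (volume.restrict (cell τ)) := ⟨by simpa using volume_cell_lt_top τ⟩
  have b1 := hc.integral_sub_sq_le hτ hd hk hA
  have b2 := hc.integral_grad_sub_sq_le hτ hd hk hr hA
  set W : E d → ℝ := fun x => φ x - nodalAffine τ c x
  set H : E d → E d := fun x => G x - affGrad (nodalAffine τ c)
  set D := Metric.diam (cell τ)
  set V := volume.real (cell τ)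
  set P := T.patchEnergy G τ
  have hW : MemLp W 2 (volume.restrict (cell τ)) :=
    hA.memLp.sub (memLp_two_cell (continuous_affine _) (volume_cell_lt_top τ))
  have hH : MemLp H 2 (volume.restrict (cell τ)) := hA.grad_memLp.sub (memLp_const _)
  have h1 := h.abs_faceMean_sub_cellMean_le hf.mem hW hH
  have h2 : cellMean τ W ^ 2 ≤ V⁻¹ * ∫ x in cell τ, ‖W x‖ ^ 2 := by
    have hm : MemLp (fun _ : E d => (1 : ℝ)) 2 (volume.restrict (cell τ)) := memLp_const 1
    have hcs := pow_le_pow_left₀ (abs_nonneg _) (abs_integral_inner_le hm hW) 2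
    rw [sq_abs, mul_pow, Real.sq_sqrt (integral_nonneg fun _ => by positivity),
      Real.sq_sqrt (integral_nonneg fun _ => by positivity), setIntegral_const] at hcs
    simp only [norm_one, one_pow, smul_eq_mul, mul_one] at hcs
    have e1 : ∀ x, inner ℝ (1 : ℝ) (W x) = W x := fun x => by simp
    simp_rw [e1] at hcs
    rw [cellMean, mul_pow]
    calc V⁻¹ ^ 2 * (∫ x in cell τ, W x) ^ 2 ≤ V⁻¹ ^ 2 * (V * ∫ x in cell τ, ‖W x‖ ^ 2) :=
          mul_le_mul_of_nonneg_left hcs (by positivity)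
      _ = _ := by field_simp
  -- The square of the face mean is at most twice the squared distance to the cell mean plus twice
  -- the squared cell mean. Each square is at most `interpConst` times $h_\tau^2/|\tau|$ times the
  -- patch energy, whence the $4$.
  have h3 : faceMean τ a W H ^ 2 ≤ 4 * interpConst d k * (D ^ 2 / V) * P := by
    have e1 : D ^ 2 / V * ∫ x in cell τ, ‖H x‖ ^ 2 ≤ D ^ 2 / V * (interpConst d k * P) :=
      mul_le_mul_of_nonneg_left b2 (by positivity)
    have e2 : V⁻¹ * ∫ x in cell τ, ‖W x‖ ^ 2 ≤ V⁻¹ * (interpConst d k * D ^ 2 * P) :=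
      mul_le_mul_of_nonneg_left b1 (by positivity)
    have e3 : V⁻¹ * (interpConst d k * D ^ 2 * P) = D ^ 2 / V * (interpConst d k * P) := by
      field_simp
    nlinarith [sq_nonneg ((faceMean τ a W H - cellMean τ W) - cellMean τ W)]
  have h4 := h.diam_le_face hk0 hr hd hf.subset hf.card_eq
  have hDe : 0 < Metric.diam (cell e) := by
    by_contra hcon
    nlinarith
  -- Use $|e|=d|\tau||\nabla\lambda_a|$, then $|\nabla\lambda_a|h_\tau\le k$ and $h_\tau\le k\,h_e$.
  have h5 : surf e / Metric.diam (cell e) ≤ d * k ^ 2 * V / D ^ 2 := by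
    have g1 := h.norm_affGrad_le hk0 hr (by omega) hf.mem
    rw [div_le_div_iff₀ hDe (by positivity), h.surf_eq hf (by omega)]
    have g2 : ‖affGrad (bary τ a)‖ * D ≤ k := (le_div_iff₀ hD).1 g1
    calc d * V * ‖affGrad (bary τ a)‖ * D ^ 2 = d * V * (‖affGrad (bary τ a)‖ * D) * D := by ring
      _ ≤ d * V * k * (k * Metric.diam (cell e)) := by gcongr
      _ = _ := by ring
  calc surf e / Metric.diam (cell e) * faceMean τ a W H ^ 2
      ≤ d * k ^ 2 * V / D ^ 2 * (4 * interpConst d k * (D ^ 2 / V) * P) := by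
        refine mul_le_mul h5 h3 (sq_nonneg _) (by positivity)
    _ = _ := by field_simp

end

/-! ### Jumps of the normal derivative -/

open Classical in
/-- The vertex of `τ` opposite to the face `e`. -/
def opposite (τ e : Finset (E d)) : E d := if h : ∃ a, IsFace τ e a then h.choose else 0

theorem IsSimplex.isFace_opposite {τ e : Finset (E d)} (h : IsSimplex τ) (he : e ⊆ τ)
    (hc : e.card = d) : IsFace τ e (opposite τ e) := by
  have hex := h.exists_isFace he hc
  rw [opposite, dif_pos hex]
  exact hex.choose_spec

/-- The inner unit normal of the simplex `τ` on its face `e`. -/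
def innerNormal (τ e : Finset (E d)) : E d :=
  ‖affGrad (bary τ (opposite τ e))‖⁻¹ • affGrad (bary τ (opposite τ e))

theorem IsSimplex.norm_innerNormal {τ e : Finset (E d)} (h : IsSimplex τ) (hd : 1 ≤ d)
    (he : e ⊆ τ) (hc : e.card = d) : ‖innerNormal τ e‖ = 1 := by
  have := norm_pos_iff.2 (h.affGrad_ne_zero (h.isFace_opposite he hc) hd)
  rw [innerNormal, norm_smul, norm_inv, norm_norm, inv_mul_cancel₀ this.ne']

theorem IsSimplex.innerNormal_mem_orthogonal {τ e : Finset (E d)} (h : IsSimplex τ) (he : e ⊆ τ)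
    (hc : e.card = d) : innerNormal τ e ∈ (vectorSpan ℝ (e : Set (E d)))ᗮ := by
  have hf := h.isFace_opposite he hc
  refine Submodule.smul_mem _ _ ?_
  rw [Submodule.mem_orthogonal', vectorSpan_def]
  intro w hw
  induction hw using Submodule.span_induction with
  | mem w hw =>
    obtain ⟨x, hx, y, hy, rfl⟩ := hw
    have hx0 := ((h.mem_face hf).1 (subset_cell e hx)).2
    have hy0 := ((h.mem_face hf).1 (subset_cell e hy)).2
    have := affine_eq (bary τ (opposite τ e)) x y
    rw [hx0, hy0, zero_add] at this
    simpa using this.symm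
  | zero => simp
  | add x y _ _ hx hy => rw [inner_add_right, hx, hy, add_zero]
  | smul a x _ hx => rw [inner_smul_right, hx, mul_zero]

/-- The sum over the vertices of a simplex, as a sum over its faces. -/
theorem IsSimplex.sum_eq_sum_faces {τ : Finset (E d)} (h : IsSimplex τ) (F : E d → ℝ) :
    ∑ z ∈ τ, F z = ∑ e ∈ τ.powersetCard d, F (opposite τ e) := by
  classical
  have hface : ∀ e ∈ τ.powersetCard d, IsFace τ e (opposite τ e) := fun e he =>
    h.isFace_opposite (Finset.mem_powersetCard.1 he).1 (Finset.mem_powersetCard.1 he).2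
  have hera : ∀ z ∈ τ, τ.erase z ∈ τ.powersetCard d := fun z hz =>
    Finset.mem_powersetCard.2 ⟨Finset.erase_subset _ _, by
      rw [Finset.card_erase_of_mem hz, h.card_eq]; rfl⟩
  have hopp : ∀ z ∈ τ, opposite τ (τ.erase z) = z := by
    intro z hz
    have hf := hface _ (hera z hz)
    by_contra hne
    exact hf.notMem (Finset.mem_erase.2 ⟨hne, hf.mem⟩)
  refine Finset.sum_bij' (fun z _ => τ.erase z) (fun e _ => opposite τ e) hera
    (fun e he => (hface e he).mem) hopp (fun e he => ?_) fun z hz => by rw [hopp z hz]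
  have hf := hface e he
  symm
  refine Finset.eq_of_subset_of_card_le (fun y hy => ?_) ?_
  · exact Finset.mem_erase.2 ⟨fun H => hf.notMem (H ▸ hy), hf.subset hy⟩
  · rw [Finset.card_erase_of_mem hf.mem, h.card_eq, hf.card_eq]; rfl

namespace Mesh

variable {T : Mesh d}

theorem jumpSq_nonneg (v : E d → ℝ) (τ e : Finset (E d)) : 0 ≤ T.jumpSq v τ e := by
  unfold jumpSq
  split_ifs
  · exact Finset.sum_nonneg fun _ _ => sq_nonneg _
  · exact sq_nonneg _

open Classical in
/-- The sum over the elements at an edge, for a factor that does not depend on the side, is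
controlled by the jump. -/
theorem abs_sum_normal_le (hd : 1 ≤ d) (v : E d → ℝ) {e : Finset (E d)} (hc : e.card = d)
    {m : Finset (E d) → ℝ}
    (hm : ∀ τ ∈ T.elements, ∀ τ' ∈ T.elements, e ⊆ τ → e ⊆ τ' → m τ = m τ') :
    |∑ τ ∈ T.elements with e ⊆ τ, inner ℝ (elemGrad v τ) (innerNormal τ e) * m τ| ≤
      ∑ τ ∈ T.elements with e ⊆ τ, Real.sqrt (T.jumpSq v τ e) * |m τ| := by
  set S := T.elements.filter (fun τ => e ⊆ τ)
  have hS : ∀ τ, τ ∈ S ↔ τ ∈ T.elements ∧ e ⊆ τ := fun τ => by simp [S]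
  have hnn : ∀ τ ∈ S, 0 ≤ Real.sqrt (T.jumpSq v τ e) * |m τ| := fun τ _ => by positivity
  rcases S.eq_empty_or_nonempty with h0 | ⟨τ, hτS⟩
  · rw [h0]; simp
  obtain ⟨hτ, he⟩ := (hS τ).1 hτS
  have h := T.isSimplex hτ
  by_cases hex : ∃ τ' ∈ S, τ' ≠ τ
  · obtain ⟨τ', hτS', hne⟩ := hex
    obtain ⟨hτ', he'⟩ := (hS τ').1 hτS'
    have hSe : S = {τ, τ'} := by
      ext σ
      rw [Finset.mem_insert, Finset.mem_singleton]
      refine ⟨fun hσ => ?_, ?_⟩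
      · by_contra! hcon
        obtain ⟨hσT, heσ⟩ := (hS σ).1 hσ
        exact hcon.2 (T.eq_of_shared_face hd hτ hτ' hσT he he' heσ hc hne hcon.1).symm
      · rintro (rfl | rfl)
        exacts [hτS, hτS']
    have hac : T.across τ e = {τ'} := by
      ext σ
      rw [across, Finset.mem_filter, Finset.mem_singleton]
      constructor
      · rintro ⟨hσT, hσne, heσ⟩
        exact (T.eq_of_shared_face hd hτ hτ' hσT he he' heσ hc hne hσne).symm
      · rintro rfl
        exact ⟨hτ', hne, he'⟩
    have hJ : T.jumpSq v τ e = ‖elemGrad v τ - elemGrad v τ'‖ ^ 2 := by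
      rw [jumpSq, hac, if_pos (Finset.singleton_nonempty _), Finset.sum_singleton]
    have hn : innerNormal τ' e = -innerNormal τ e :=
      T.affGrad_opposite hd hτ' hτ hne ((T.isSimplex hτ').isFace_opposite he' hc)
        (h.isFace_opposite he hc)
    -- Opposite normals and a common factor turn the two terms into the jump. The estimate then
    -- needs the term of one side only; the other one is nonnegative.
    have hsum : ∑ σ ∈ S, inner ℝ (elemGrad v σ) (innerNormal σ e) * m σ =
        inner ℝ (elemGrad v τ - elemGrad v τ') (innerNormal τ e) * m τ := by
      rw [hSe, Finset.sum_pair hne.symm, hn, hm τ' hτ' τ hτ he' he, inner_neg_right, inner_sub_left]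
      ring
    rw [hsum, abs_mul]
    refine le_trans ?_ (Finset.single_le_sum hnn hτS)
    rw [hJ, Real.sqrt_sq (norm_nonneg _)]
    refine mul_le_mul_of_nonneg_right ((abs_real_inner_le_norm _ _).trans ?_) (abs_nonneg _)
    rw [h.norm_innerNormal hd he hc, mul_one]
  · push Not at hex
    have hSe : S = {τ} := by
      ext σ
      rw [Finset.mem_singleton]
      exact ⟨hex σ, fun H => H ▸ hτS⟩
    have hac : T.across τ e = ∅ := by
      ext σ
      simp only [across, Finset.mem_filter, Finset.notMem_empty, iff_false]
      rintro ⟨hσT, hσne, heσ⟩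
      exact hσne (hex σ ((hS σ).2 ⟨hσT, heσ⟩))
    rw [hSe, Finset.sum_singleton, Finset.sum_singleton, abs_mul]
    refine mul_le_mul_of_nonneg_right ?_ (abs_nonneg _)
    rw [jumpSq, hac, if_neg Finset.not_nonempty_empty, Real.sqrt_sq (norm_nonneg _)]
    set P := (vectorSpan ℝ (e : Set (E d)))ᗮ
    -- On a boundary edge the normal is orthogonal to the directions of $e$, so only the projected
    -- gradient contributes.
    have h1 : inner ℝ (elemGrad v τ) (innerNormal τ e) =
        inner ℝ (P.starProjection (elemGrad v τ)) (innerNormal τ e) := by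
      rw [Submodule.inner_starProjection_left_eq_right,
        Submodule.starProjection_eq_self_iff.2 (h.innerNormal_mem_orthogonal he hc)]
    rw [h1]
    refine (abs_real_inner_le_norm _ _).trans ?_
    rw [h.norm_innerNormal hd he hc, mul_one]

end Mesh

/-! ### The residual on an element -/

theorem gradient_eq_of_eqOn {v : E d → ℝ} {A : E d →ᵃ[ℝ] ℝ} {s : Finset (E d)}
    (hv : EqOn v A (cell s)) {x : E d} (hx : x ∈ interior (cell s)) :
    gradient v x = affGrad A := by
  have : v =ᶠ[𝓝 x] A := by
    filter_upwards [mem_interior_iff_mem_nhds.1 hx] with y hy using hv hy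
  rw [← gradient_affine A x]
  simp [gradient, this.fderiv_eq]

theorem IsSimplex.elemGrad_eq {τ : Finset (E d)} (h : IsSimplex τ) {v : E d → ℝ}
    {A : E d →ᵃ[ℝ] ℝ} (hv : EqOn v A (cell τ)) : Mesh.elemGrad v τ = affGrad A :=
  gradient_eq_of_eqOn hv h.centroid_mem_interior

namespace Params

variable (p : Params)

/-- The strong residual on an element, for affine functions `A` (displacement) and `B` (phase
field). -/
def bulkResidual (A B : E d →ᵃ[ℝ] ℝ) (x : E d) : ℝ :=
  p.mu * (1 - p.kappa) * ‖affGrad A‖ ^ 2 * B x - p.nu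

theorem continuous_bulkResidual (A B : E d →ᵃ[ℝ] ℝ) : Continuous (p.bulkResidual A B) := by
  have := continuous_affine B
  unfold bulkResidual
  fun_prop

/-- The contribution of an element to the derivative of the energy. -/
theorem integrand_eq {τ : Finset (E d)} {u v : E d → ℝ} {A B : E d →ᵃ[ℝ] ℝ}
    (hu : EqOn u A (cell τ)) (hv : EqOn v B (cell τ)) (f : E d → ℝ) (F : E d → E d) :
    (fun x => p.rho * inner ℝ (gradient v x) (F x) - p.nu * f x
      + p.mu * (1 - p.kappa) * (v x * f x) * ‖gradient u x‖ ^ 2) =ᵐ[volume.restrict (cell τ)]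
    fun x => p.rho * inner ℝ (affGrad B) (F x) + p.bulkResidual A B x * f x := by
  filter_upwards [ae_mem_interior_cell τ] with x hx
  rw [gradient_eq_of_eqOn hu hx, gradient_eq_of_eqOn hv hx, hv (interior_subset hx), bulkResidual]
  ring

theorem integrable_integrand {τ : Finset (E d)} (A B : E d →ᵃ[ℝ] ℝ) {f : E d → ℝ} {F : E d → E d}
    (hf : MemLp f 2 (volume.restrict (cell τ))) (hF : MemLp F 2 (volume.restrict (cell τ))) :
    IntegrableOn (fun x => p.rho * inner ℝ (affGrad B) (F x) + p.bulkResidual A B x * f x)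
      (cell τ) := by
  have h1 := integrable_inner_of_memLp
    (memLp_two_cell (continuous_const (y := affGrad B)) (volume_cell_lt_top τ)) hF
  have h2 := integrable_inner_of_memLp
    (memLp_two_cell (p.continuous_bulkResidual A B) (volume_cell_lt_top τ)) hf
  refine (h1.const_mul p.rho).add (h2.congr (Eventually.of_forall fun x => ?_))
  simp [mul_comm]

theorem energyDeriv_eq_sum {T : Mesh d} {Ω : Set (E d)} (hΩ : T.Triangulates Ω) {u v : E d → ℝ}
    {A B : Finset (E d) → E d →ᵃ[ℝ] ℝ} (hu : ∀ τ ∈ T.elements, EqOn u (A τ) (cell τ))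
    (hv : ∀ τ ∈ T.elements, EqOn v (B τ) (cell τ)) {f : E d → ℝ} {F : E d → E d}
    (hf : ∀ τ ∈ T.elements, MemLp f 2 (volume.restrict (cell τ)))
    (hF : ∀ τ ∈ T.elements, MemLp F 2 (volume.restrict (cell τ))) :
    p.energyDeriv Ω (gradient u) v (gradient v) f F = ∑ τ ∈ T.elements,
      ∫ x in cell τ, (p.rho * inner ℝ (affGrad (B τ)) (F x)
        + p.bulkResidual (A τ) (B τ) x * f x) := by
  rw [energyDeriv, hΩ.integral_eq]
  · exact Finset.sum_congr rfl fun τ hτ => integral_congr_ae (p.integrand_eq (hu τ hτ) (hv τ hτ) f F)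
  · exact fun τ hτ => (p.integrable_integrand (A τ) (B τ) (hf τ hτ) (hF τ hτ)).congr
      (p.integrand_eq (hu τ hτ) (hv τ hτ) f F).symm

theorem indicatorSq_eq {T : Mesh d} {τ : Finset (E d)} {u v : E d → ℝ} {A B : E d →ᵃ[ℝ] ℝ}
    (hu : EqOn u A (cell τ)) (hv : EqOn v B (cell τ)) :
    p.indicatorSq T u v τ =
      Metric.diam (cell τ) ^ 2 * (∫ x in cell τ, ‖p.bulkResidual A B x‖ ^ 2) +
        ∑ e ∈ τ.powersetCard d, p.rho ^ 2 * Metric.diam (cell e) * T.jumpSq v τ e * surf e := by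
  rw [indicatorSq, ← integral_const_mul]
  congr 1
  · refine integral_congr_ae ?_
    filter_upwards [ae_mem_interior_cell τ] with x hx
    rw [gradient_eq_of_eqOn hu hx, hv (interior_subset hx), bulkResidual, Real.norm_eq_abs]
  · refine Finset.sum_congr rfl fun e _ => ?_
    rw [setIntegral_const, smul_eq_mul, surf, mul_comm]

end Params

/-! ### The residual estimate -/

theorem faceMean_sub {τ : Finset (E d)} (a : E d) {f g : E d → ℝ} {F G : E d → E d}
    (hf : MemLp f 2 (volume.restrict (cell τ))) (hg : MemLp g 2 (volume.restrict (cell τ)))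
    (hF : MemLp F 2 (volume.restrict (cell τ))) (hG : MemLp G 2 (volume.restrict (cell τ))) :
    faceMean τ a (fun x => f x - g x) (fun x => F x - G x) =
      faceMean τ a f F - faceMean τ a g G := by
  have hfin : IsFiniteMeasure (volume.restrict (cell τ)) := ⟨by simpa using volume_cell_lt_top τ⟩
  have hid : MemLp (fun x : E d => x - a) 2 (volume.restrict (cell τ)) :=
    memLp_two_cell (by fun_prop) (volume_cell_lt_top τ)
  have h1 : ∀ {f : E d → ℝ} {F : E d → E d}, MemLp f 2 (volume.restrict (cell τ)) →
      MemLp F 2 (volume.restrict (cell τ)) →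
      IntegrableOn (fun x => f x + (d : ℝ)⁻¹ * inner ℝ (x - a) (F x)) (cell τ) := fun hf hF =>
    (hf.integrable (by norm_num)).add ((integrable_inner_of_memLp hid hF).const_mul _)
  rw [faceMean, faceMean, faceMean, ← mul_sub, ← integral_sub (h1 hf hF) (h1 hg hG)]
  congr 2
  funext x
  rw [inner_sub_right]
  ring

namespace Mesh

variable {T : Mesh d}

/-- A finite element function that vanishes at the nodes of the crack vanishes on the crack. -/
theorem mem_FEVanishing_of_nodal {c u w : E d → ℝ} {tol : ℝ}
    (hc : ∀ z ∈ T.nodes, z ∈ T.crackSet w tol → c z = 0)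
    (hu : ∀ τ ∈ T.elements, EqOn u (nodalAffine τ c) (cell τ)) :
    u ∈ T.FEVanishing (T.crackSet w tol) := by
  refine ⟨fun τ hτ => ⟨_, hu τ hτ⟩, fun x hx => ?_⟩
  rw [crackSet, mem_iUnion₂] at hx
  obtain ⟨e, he, hxe⟩ := hx
  obtain ⟨-, τ, hτ, heτ⟩ := he.1
  obtain ⟨hxτ, h0⟩ := ((T.isSimplex hτ).mem_cell_subset heτ).1 hxe
  rw [hu τ hτ hxτ, nodalAffine_apply]
  refine Finset.sum_eq_zero fun z hz => ?_
  by_cases hze : z ∈ e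
  · have hz' : z ∈ T.crackSet w tol := mem_iUnion₂.2 ⟨e, he, subset_cell e hze⟩
    rw [hc z ⟨τ, hτ, hz⟩ hz', zero_mul]
  · rw [h0 z hz hze, mul_zero]

/-- Multiplied by the measure of $e$, both sides are integrals over $e$ of affine functions that
agree there. -/
theorem faceMean_nodalAffine_eq (hd : 1 ≤ d) (c : E d → ℝ) {τ τ' e : Finset (E d)} {a a' : E d}
    (hτ : τ ∈ T.elements) (hτ' : τ' ∈ T.elements) (hf : IsFace τ e a) (hf' : IsFace τ' e a') :
    faceMean τ a (nodalAffine τ c) (fun _ => affGrad (nodalAffine τ c)) =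
      faceMean τ' a' (nodalAffine τ' c) (fun _ => affGrad (nodalAffine τ' c)) := by
  have h := T.isSimplex hτ
  have h' := T.isSimplex hτ'
  have hg : ∀ A : E d →ᵃ[ℝ] ℝ, (fun _ => affGrad A) = gradient A := fun A =>
    funext fun x => (gradient_affine A x).symm
  have hs : ∀ A : E d →ᵃ[ℝ] ℝ, ContDiff ℝ 1 A := fun A =>
    (contDiff_affine A).of_le (by exact_mod_cast le_top)
  refine mul_left_cancel₀ (h.surf_pos hf hd).ne' ?_
  rw [hg, hg, h.surf_mul_faceMean hf hd (hs _), h'.surf_mul_faceMean hf' hd (hs _)]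
  refine setIntegral_congr_fun (measurableSet_cell e) fun x hx => ?_
  exact T.nodalAffine_eqOn hτ hτ' c ((h.mem_face hf).1 hx).1 ((h'.mem_face hf').1 hx).1

open Classical in
/-- The faces of the elements can be visited edge by edge. -/
theorem sum_faces_comm (F : Finset (E d) → Finset (E d) → ℝ) :
    ∑ τ ∈ T.elements, ∑ e ∈ τ.powersetCard d, F τ e =
      ∑ e ∈ T.elements.biUnion (fun τ => τ.powersetCard d),
        ∑ τ ∈ T.elements with e ⊆ τ, F τ e := by
  refine Finset.sum_comm' fun τ e => ?_
  simp only [Finset.mem_powersetCard, Finset.mem_filter, Finset.mem_biUnion]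
  constructor
  · rintro ⟨hτ, he, hc⟩
    exact ⟨⟨hτ, he⟩, τ, hτ, he, hc⟩
  · rintro ⟨⟨hτ, he⟩, _, _, _, hc⟩
    exact ⟨hτ, he, hc⟩

/-- Reordering the sum by edges brings the two sides of an interior edge together, so that they
cancel up to the jump. -/
theorem abs_sum_faces_le (hd : 1 ≤ d) (v : E d → ℝ) {m : Finset (E d) → Finset (E d) → ℝ}
    (hm : ∀ e : Finset (E d), e.card = d → ∀ τ ∈ T.elements, ∀ τ' ∈ T.elements, e ⊆ τ → e ⊆ τ' →
      m τ e = m τ' e) :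
    |∑ τ ∈ T.elements, ∑ e ∈ τ.powersetCard d,
        surf e * (inner ℝ (elemGrad v τ) (innerNormal τ e) * m τ e)| ≤
      ∑ τ ∈ T.elements, ∑ e ∈ τ.powersetCard d,
        surf e * (Real.sqrt (T.jumpSq v τ e) * |m τ e|) := by
  classical
  rw [sum_faces_comm, sum_faces_comm]
  refine (Finset.abs_sum_le_sum_abs _ _).trans (Finset.sum_le_sum fun e he => ?_)
  obtain ⟨τ, -, he⟩ := Finset.mem_biUnion.1 he
  have hc := (Finset.mem_powersetCard.1 he).2
  rw [← Finset.mul_sum, ← Finset.mul_sum, abs_mul,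
    abs_of_nonneg (show 0 ≤ surf e from measureReal_nonneg)]
  refine mul_le_mul_of_nonneg_left ?_ measureReal_nonneg
  convert abs_sum_normal_le hd v hc (hm e hc)

end Mesh

namespace Params

variable (p : Params) {T : Mesh d}

theorem rho_pos : 0 < p.rho := by
  have h1 := p.lamc_pos
  have h2 := p.eps_pos
  have h3 := p.cw_pos
  unfold rho
  positivity

theorem sum_jump_nonneg (v : E d → ℝ) (τ : Finset (E d)) : ∀ e ∈ τ.powersetCard d,
    0 ≤ p.rho ^ 2 * Metric.diam (cell e) * T.jumpSq v τ e * surf e := fun _ _ =>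
  mul_nonneg (mul_nonneg (mul_nonneg (sq_nonneg _) Metric.diam_nonneg) (Mesh.jumpSq_nonneg _ _ _))
    measureReal_nonneg

/-- The constant in the estimate of the residual on an element. -/
def elementConst (d : ℕ) (k : ℝ) : ℝ := interpConst d k * (1 + 4 * d * k ^ 2)

theorem elementConst_pos (d : ℕ) {k : ℝ} (hk : 0 < k) : 0 < elementConst d k := by
  have := interpConst_pos d hk
  unfold elementConst
  positivity

section

variable {τ : Finset (E d)} (hτ : τ ∈ T.elements) {u v : E d → ℝ}
  {A B : E d →ᵃ[ℝ] ℝ} (hu : EqOn u A (cell τ)) (hv : EqOn v B (cell τ)) (hd : 2 ≤ d)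
  {k : ℝ} (hk : 1 ≤ k) {φ : E d → ℝ} {G : E d → E d} {Φ : ℕ → E d → ℝ}
  (hA : Approximates τ φ G Φ) {c : E d → ℝ} (hc : CloseNodalValues T k τ φ G c)
include hτ hu hv hd hk hA hc

/-- The $h_\tau$ gained by interpolation is the weight of the volume part of the indicator. -/
theorem abs_integral_bulkResidual_le :
    |∫ x in cell τ, p.bulkResidual A B x * (φ x - nodalAffine τ c x)| ≤
      Real.sqrt (p.indicatorSq T u v τ) *
        Real.sqrt (elementConst d k * T.patchEnergy G τ) := by
  have hk0 : 0 < k := by linarith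
  have hP := Mesh.patchEnergy_nonneg (T := T) G τ
  have hC := interpConst_pos d hk0
  have hW : MemLp (fun x => φ x - nodalAffine τ c x) 2 (volume.restrict (cell τ)) :=
    hA.memLp.sub (memLp_two_cell (continuous_affine _) (volume_cell_lt_top τ))
  have h1 := abs_integral_inner_le hW
    (memLp_two_cell (p.continuous_bulkResidual A B) (volume_cell_lt_top τ))
  simp only [RCLike.inner_apply, conj_trivial] at h1
  refine h1.trans ?_
  have hI : 0 ≤ ∫ x in cell τ, ‖p.bulkResidual A B x‖ ^ 2 :=
    integral_nonneg fun _ => by positivity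
  have h2 : Metric.diam (cell τ) ^ 2 * (∫ x in cell τ, ‖p.bulkResidual A B x‖ ^ 2) ≤
      p.indicatorSq T u v τ := by
    rw [p.indicatorSq_eq hu hv]
    exact le_add_of_nonneg_right (Finset.sum_nonneg (p.sum_jump_nonneg v τ))
  have h3 := hc.integral_sub_sq_le hτ hd hk hA
  have h4 : interpConst d k * T.patchEnergy G τ ≤ elementConst d k * T.patchEnergy G τ := by
    refine mul_le_mul_of_nonneg_right ?_ hP
    have : 0 ≤ interpConst d k * (4 * d * k ^ 2) := by positivity
    unfold elementConst
    linarith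
  rw [← Real.sqrt_mul (integral_nonneg fun _ => by positivity),
    ← Real.sqrt_mul ((by positivity : (0 : ℝ) ≤ _).trans h2)]
  refine Real.sqrt_le_sqrt ?_
  calc (∫ x in cell τ, ‖φ x - nodalAffine τ c x‖ ^ 2) * ∫ x in cell τ, ‖p.bulkResidual A B x‖ ^ 2
      ≤ (interpConst d k * Metric.diam (cell τ) ^ 2 * T.patchEnergy G τ) *
        ∫ x in cell τ, ‖p.bulkResidual A B x‖ ^ 2 := mul_le_mul_of_nonneg_right h3 hI
    _ = Metric.diam (cell τ) ^ 2 * (∫ x in cell τ, ‖p.bulkResidual A B x‖ ^ 2) *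
        (interpConst d k * T.patchEnergy G τ) := by ring
    _ ≤ _ := mul_le_mul h2 h4 (by positivity) ((by positivity : (0 : ℝ) ≤ _).trans h2)

theorem surf_mul_jump_le (hr : RegularWith k τ) {e : Finset (E d)} (he : e ∈ τ.powersetCard d) :
    p.rho * (surf e * (Real.sqrt (T.jumpSq v τ e) *
      |faceMean τ (opposite τ e) (fun x => φ x - nodalAffine τ c x)
        (fun x => G x - affGrad (nodalAffine τ c))|)) ≤
      Real.sqrt (p.indicatorSq T u v τ) *
        Real.sqrt (elementConst d k * T.patchEnergy G τ) := by
  have hk0 : 0 < k := by linarith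
  have h := T.isSimplex hτ
  have hP := Mesh.patchEnergy_nonneg (T := T) G τ
  have hC := interpConst_pos d hk0
  have hρ := p.rho_pos
  obtain ⟨hes, hec⟩ := Finset.mem_powersetCard.1 he
  have hf := h.isFace_opposite hes hec
  have h1 := hc.surf_mul_faceMean_sq_le hτ hd hk hr hA hf
  set m := faceMean τ (opposite τ e) (fun x => φ x - nodalAffine τ c x)
    (fun x => G x - affGrad (nodalAffine τ c))
  have hJ := T.jumpSq_nonneg v τ e
  set J := T.jumpSq v τ e with hJdef
  have hs := h.surf_pos hf (by omega)
  have hDe : 0 < Metric.diam (cell e) := by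
    have g1 := h.diam_pos (by omega)
    have g2 := h.diam_le_face hk0 hr hd hes hec
    by_contra hcon
    nlinarith
  have h2 : p.rho ^ 2 * Metric.diam (cell e) * J * surf e ≤ p.indicatorSq T u v τ := by
    rw [p.indicatorSq_eq hu hv]
    have g1 := Finset.single_le_sum (f := fun e => p.rho ^ 2 * Metric.diam (cell e) *
      T.jumpSq v τ e * surf e) (p.sum_jump_nonneg (T := T) v τ) he
    have g2 : 0 ≤ Metric.diam (cell τ) ^ 2 * (∫ x in cell τ, ‖p.bulkResidual A B x‖ ^ 2) :=
      mul_nonneg (sq_nonneg _) (integral_nonneg fun _ => by positivity)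
    linarith
  have h3 : 4 * d * k ^ 2 * interpConst d k * T.patchEnergy G τ ≤
      elementConst d k * T.patchEnergy G τ := by
    refine mul_le_mul_of_nonneg_right ?_ hP
    unfold elementConst
    linarith
  have h0 : 0 ≤ p.rho ^ 2 * Metric.diam (cell e) * J * surf e := by positivity
  rw [← Real.sqrt_mul (h0.trans h2)]
  refine Real.le_sqrt_of_sq_le ?_
  -- The weight $h_e$ is distributed so that the first factor is the edge part of the indicator and
  -- the second is bounded by `surf_mul_faceMean_sq_le`.
  calc (p.rho * (surf e * (Real.sqrt J * |m|))) ^ 2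
      = (p.rho ^ 2 * Metric.diam (cell e) * J * surf e) *
        (surf e / Metric.diam (cell e) * m ^ 2) := by
        rw [mul_pow, mul_pow, mul_pow, Real.sq_sqrt hJ, sq_abs]; field_simp
    _ ≤ _ := mul_le_mul h2 (h1.trans h3) (by positivity) (h0.trans h2)

/-- One volume term and $d+1$ faces, each with the same bound, give $d+2$. -/
theorem element_residual_le (hr : RegularWith k τ) :
    |∫ x in cell τ, p.bulkResidual A B x * (φ x - nodalAffine τ c x)| +
      ∑ e ∈ τ.powersetCard d, p.rho * (surf e * (Real.sqrt (T.jumpSq v τ e) *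
        |faceMean τ (opposite τ e) (fun x => φ x - nodalAffine τ c x)
          (fun x => G x - affGrad (nodalAffine τ c))|)) ≤
      (d + 2) * (Real.sqrt (p.indicatorSq T u v τ) *
        Real.sqrt (elementConst d k * T.patchEnergy G τ)) := by
  have h1 := p.abs_integral_bulkResidual_le hτ hu hv hd hk hA hc
  have h2 := Finset.sum_le_sum fun e he => p.surf_mul_jump_le hτ hu hv hd hk hA hc hr (e := e) he
  rw [Finset.sum_const, Finset.card_powersetCard, (T.isSimplex hτ).card_eq,
    Nat.choose_succ_self_right, nsmul_eq_mul] at h2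
  push_cast at h2
  linarith

end

/-- The constant in the residual estimate. -/
def residualConst (d : ℕ) (k : ℝ) : ℝ :=
  (d + 2) * Real.sqrt (elementConst d k * ((d + 1) * (k + 1) ^ d))

theorem residualConst_pos (d : ℕ) {k : ℝ} (hk : 0 < k) : 0 < residualConst d k := by
  have := elementConst_pos d hk
  unfold residualConst
  positivity

section

variable {Ω C : Set (E d)} (hΩ : T.Triangulates Ω) {u v : E d → ℝ} (hd : 2 ≤ d) {φ : E d → ℝ} {G : E d → E d} (hφ : T.InVc Ω C φ G)
include hΩ hd hφ

/-- The residual tested with the difference of `φ` and a finite element function, element by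
element. -/
theorem abs_energyDeriv_le_sum {A B : Finset (E d) → E d →ᵃ[ℝ] ℝ}
    (hA : ∀ τ ∈ T.elements, EqOn u (A τ) (cell τ))
    (hB : ∀ τ ∈ T.elements, EqOn v (B τ) (cell τ)) {c w : E d → ℝ}
    (hw : ∀ τ ∈ T.elements, EqOn w (nodalAffine τ c) (cell τ))
    (h0 : p.energyDeriv Ω (gradient u) v (gradient v) w (gradient w) = 0) :
    |p.energyDeriv Ω (gradient u) v (gradient v) φ G| ≤ ∑ τ ∈ T.elements,
      (|∫ x in cell τ, p.bulkResidual (A τ) (B τ) x * (φ x - nodalAffine τ c x)| +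
        ∑ e ∈ τ.powersetCard d, p.rho * (surf e * (Real.sqrt (T.jumpSq v τ e) *
          |faceMean τ (opposite τ e) (fun x => φ x - nodalAffine τ c x)
            (fun x => G x - affGrad (nodalAffine τ c))|))) := by
  have hfin : ∀ τ : Finset (E d), IsFiniteMeasure (volume.restrict (cell τ)) := fun τ =>
    ⟨by simpa using volume_cell_lt_top τ⟩
  have hρ := p.rho_pos
  have hf := fun τ (hτ : τ ∈ T.elements) => hΩ.memLp_cell hφ.isH1.memLp hτ
  have hF := fun τ (hτ : τ ∈ T.elements) => hΩ.memLp_cell hφ.isH1.grad_memLp hτ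
  have ha : ∀ τ : Finset (E d), MemLp (nodalAffine τ c) 2 (volume.restrict (cell τ)) := fun τ =>
    memLp_two_cell (continuous_affine _) (volume_cell_lt_top τ)
  have hga : ∀ τ : Finset (E d), MemLp (fun _ => affGrad (nodalAffine τ c)) 2
    (volume.restrict (cell τ)) := fun τ => memLp_const _
  have hwa : ∀ τ ∈ T.elements, w =ᵐ[volume.restrict (cell τ)] nodalAffine τ c := fun τ hτ =>
    (ae_restrict_mem (measurableSet_cell τ)).mono fun x hx => hw τ hτ hx
  have hgwa : ∀ τ ∈ T.elements, gradient w =ᵐ[volume.restrict (cell τ)]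
      fun _ => affGrad (nodalAffine τ c) := fun τ hτ =>
    (ae_mem_interior_cell τ).mono fun x hx => gradient_eq_of_eqOn (hw τ hτ) hx
  have hwL := fun τ hτ => (memLp_congr_ae (hwa τ hτ)).2 (ha τ)
  have hgwL := fun τ hτ => (memLp_congr_ae (hgwa τ hτ)).2 (hga τ)
  set m : Finset (E d) → Finset (E d) → ℝ := fun τ e => faceMean τ (opposite τ e)
    (fun x => φ x - nodalAffine τ c x) (fun x => G x - affGrad (nodalAffine τ c))
  have hm : ∀ e : Finset (E d), e.card = d → ∀ τ ∈ T.elements, ∀ τ' ∈ T.elements, e ⊆ τ → e ⊆ τ' →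
      m τ e = m τ' e := by
    intro e hec τ hτ τ' hτ' he he'
    have f1 := (T.isSimplex hτ).isFace_opposite he hec
    have f2 := (T.isSimplex hτ').isFace_opposite he' hec
    simp only [m]
    rw [faceMean_sub _ (hf τ hτ) (ha τ) (hF τ hτ) (hga τ),
      faceMean_sub _ (hf τ' hτ') (ha τ') (hF τ' hτ') (hga τ'),
      hφ.faceMean_eq hΩ (by omega) hτ hτ' f1 f2,
      T.faceMean_nodalAffine_eq (by omega) c hτ hτ' f1 f2]
  -- Criticality allows the finite element function to be subtracted. As the gradient of $v$ is
  -- constant on each element, integration by parts leaves only face means, with a minus sign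
  -- because the normals point inwards.
  have key : p.energyDeriv Ω (gradient u) v (gradient v) φ G = ∑ τ ∈ T.elements,
      ((∫ x in cell τ, p.bulkResidual (A τ) (B τ) x * (φ x - nodalAffine τ c x)) -
        p.rho * ∑ e ∈ τ.powersetCard d,
          surf e * (inner ℝ (Mesh.elemGrad v τ) (innerNormal τ e) * m τ e)) := by
    rw [← sub_zero (p.energyDeriv Ω (gradient u) v (gradient v) φ G), ← h0,
      p.energyDeriv_eq_sum hΩ hA hB hf hF, p.energyDeriv_eq_sum hΩ hA hB hwL hgwL,
      ← Finset.sum_sub_distrib]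
    refine Finset.sum_congr rfl fun τ hτ => ?_
    have h := T.isSimplex hτ
    have hW : MemLp (fun x => φ x - nodalAffine τ c x) 2 (volume.restrict (cell τ)) :=
      (hf τ hτ).sub (ha τ)
    have hH : MemLp (fun x => G x - affGrad (nodalAffine τ c)) 2 (volume.restrict (cell τ)) :=
      (hF τ hτ).sub (hga τ)
    have e1 : ∫ x in cell τ, inner ℝ (affGrad (B τ)) (G x - affGrad (nodalAffine τ c)) =
        -∑ e ∈ τ.powersetCard d,
          surf e * (inner ℝ (Mesh.elemGrad v τ) (innerNormal τ e) * m τ e) := by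
      rw [h.integral_inner_grad (by omega) (hW.integrable (by norm_num))
        (hH.integrable (by norm_num)) (affGrad (B τ)), h.sum_eq_sum_faces]
      congr 1
      refine Finset.sum_congr rfl fun e he => ?_
      obtain ⟨hes, hec⟩ := Finset.mem_powersetCard.1 he
      have hfe := h.isFace_opposite hes hec
      have hg := norm_pos_iff.2 (h.affGrad_ne_zero hfe (by omega))
      rw [h.surf_eq hfe (by omega), h.elemGrad_eq (hB τ hτ), innerNormal, inner_smul_right]
      simp only [m]
      field_simp
    have i1 : IntegrableOn (fun x => p.rho * inner ℝ (affGrad (B τ))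
        (G x - affGrad (nodalAffine τ c))) (cell τ) :=
      (integrable_inner_of_memLp (memLp_const _) hH).const_mul _
    have i2 : IntegrableOn (fun x => p.bulkResidual (A τ) (B τ) x * (φ x - nodalAffine τ c x))
        (cell τ) := by
      refine (integrable_inner_of_memLp hW (memLp_two_cell
        (p.continuous_bulkResidual (A τ) (B τ)) (volume_cell_lt_top τ))).congr
        (Eventually.of_forall fun x => ?_)
      simp
    rw [← integral_sub (p.integrable_integrand (A τ) (B τ) (hf τ hτ) (hF τ hτ))
      (p.integrable_integrand (A τ) (B τ) (hwL τ hτ) (hgwL τ hτ))]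
    have e2 : ∫ x in cell τ, ((p.rho * inner ℝ (affGrad (B τ)) (G x)
        + p.bulkResidual (A τ) (B τ) x * φ x) - (p.rho * inner ℝ (affGrad (B τ)) (gradient w x)
        + p.bulkResidual (A τ) (B τ) x * w x)) =
        ∫ x in cell τ, (p.rho * inner ℝ (affGrad (B τ)) (G x - affGrad (nodalAffine τ c)) +
          p.bulkResidual (A τ) (B τ) x * (φ x - nodalAffine τ c x)) := by
      refine integral_congr_ae ?_
      filter_upwards [hwa τ hτ, hgwa τ hτ] with x h1 h2
      rw [h1, h2, inner_sub_right]
      ring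
    rw [e2, integral_add i1 i2, integral_const_mul, e1]
    ring
  rw [key, Finset.sum_sub_distrib, ← Finset.mul_sum, Finset.sum_add_distrib]
  refine (abs_sub _ _).trans (add_le_add (Finset.abs_sum_le_sum_abs _ _) ?_)
  simp_rw [← Finset.mul_sum]
  rw [abs_mul, abs_of_pos hρ]
  exact mul_le_mul_of_nonneg_left (Mesh.abs_sum_faces_le (by omega) v hm) hρ.le

theorem abs_energyDeriv_le (hu : u ∈ T.FESpace) (hv : v ∈ T.FESpace) {k : ℝ} (hk : 1 ≤ k) (hr : ∀ τ ∈ T.elements, RegularWith k τ)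
    {w₀ : E d → ℝ} {tol : ℝ} (hC : T.crackSet w₀ tol ⊆ C)
    (hcrit : ∀ w ∈ T.FEVanishing (T.crackSet w₀ tol),
      p.energyDeriv Ω (gradient u) v (gradient v) w (gradient w) = 0) :
    |p.energyDeriv Ω (gradient u) v (gradient v) φ G| ≤
      residualConst d k * (p.estimator T u v * gradNorm Ω G) := by
  have hk0 : 0 < k := by linarith
  have hE := elementConst_pos d hk0
  obtain ⟨c, hc0, hc⟩ := hφ.exists_nodal_values hΩ hd hk hr hC
  obtain ⟨w, hw⟩ := T.exists_feFunction c
  choose! A hA using hu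
  choose! B hB using hv
  have hI : ∀ τ ∈ T.elements, 0 ≤ p.indicatorSq T u v τ := by
    intro τ hτ
    rw [p.indicatorSq_eq (hA τ hτ) (hB τ hτ)]
    exact add_nonneg (mul_nonneg (sq_nonneg _) (integral_nonneg fun _ => by positivity))
      (Finset.sum_nonneg (p.sum_jump_nonneg v τ))
  refine (p.abs_energyDeriv_le_sum hΩ hd hφ hA hB hw (hcrit w (T.mem_FEVanishing_of_nodal hc0 hw))).trans ?_
  calc _ ≤ ∑ τ ∈ T.elements, (d + 2) * (Real.sqrt (p.indicatorSq T u v τ) *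
        Real.sqrt (elementConst d k * T.patchEnergy G τ)) := by
        refine Finset.sum_le_sum fun τ hτ => ?_
        obtain ⟨Φ, hΦ, -⟩ := hφ.exists_approximates hΩ hτ
        exact p.element_residual_le hτ (hA τ hτ) (hB τ hτ) hd hk hΦ (hc τ hτ) (hr τ hτ)
    _ ≤ (d + 2) * (Real.sqrt (∑ τ ∈ T.elements, p.indicatorSq T u v τ) *
        Real.sqrt (∑ τ ∈ T.elements, elementConst d k * T.patchEnergy G τ)) := by
        rw [← Finset.mul_sum]
        refine mul_le_mul_of_nonneg_left ?_ (by positivity)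
        have := Real.sum_mul_le_sqrt_mul_sqrt T.elements
          (fun τ => Real.sqrt (p.indicatorSq T u v τ))
          (fun τ => Real.sqrt (elementConst d k * T.patchEnergy G τ))
        rwa [Finset.sum_congr rfl fun τ hτ => Real.sq_sqrt (hI τ hτ),
          Finset.sum_congr rfl fun τ _ => Real.sq_sqrt
            (mul_nonneg hE.le (Mesh.patchEnergy_nonneg G τ))] at this
    _ ≤ (d + 2) * (p.estimator T u v * Real.sqrt (elementConst d k * ((d + 1) * (k + 1) ^ d) *
        ∫ x in Ω, ‖G x‖ ^ 2)) := by
        rw [estimator]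
        gcongr
        rw [← Finset.mul_sum, mul_assoc]
        exact mul_le_mul_of_nonneg_left
          (Mesh.sum_patchEnergy_le hΩ (by omega) hk0 hr hφ.isH1.grad_memLp) hE.le
    _ = _ := by
        rw [Real.sqrt_mul (by positivity), residualConst, gradNorm]
        ring

end

/-- The gradient norm is at most the $H^1$ norm. A function of norm zero contributes $0$, the value
of a division by zero. -/
theorem dualNorm_le {Ω C : Set (E d)} {u v : E d → ℝ} {K : ℝ} (hK : 0 ≤ K)
    (h : ∀ (φ : E d → ℝ) (G : E d → E d), T.InVc Ω C φ G →
      |p.energyDeriv Ω (gradient u) v (gradient v) φ G| ≤ K * gradNorm Ω G) :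
    p.dualNorm T Ω C u v ≤ ENNReal.ofReal K := by
  refine iSup_le fun φ => iSup_le fun G => iSup_le fun hφ => ENNReal.ofReal_le_ofReal ?_
  refine div_le_of_le_mul₀ (Real.sqrt_nonneg _) hK ((h φ G hφ).trans ?_)
  refine mul_le_mul_of_nonneg_left (Real.sqrt_le_sqrt ?_) hK
  exact le_add_of_nonneg_left (integral_nonneg fun _ => sq_nonneg _)

end Params

end PhaseField

end

/-! ### The main theorem -/

theorem mainTheorem2 (d : ℕ) (hd : 2 ≤ d) (creg : ℝ) (hcreg : 0 < creg) :
    ∃ c44 : ℝ, 0 < c44 ∧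
      ∀ (P : PhaseField.Problem d) (_ : ∀ m ≤ P.N, (P.mesh m).ShapeRegular creg)
        (u v : ℕ → PhaseField.E d → ℝ) (w0 : PhaseField.E d → ℝ)
        (_ : ∀ m ≤ P.N, v m ∈ (P.mesh m).FESpace)
        (_ : P.IsWaveSolution u v w0)
        (n : ℕ) (_ : 1 ≤ n) (_ : n ≤ P.N)
        (_ : P.IsCritical u v n)
        (CR : Set (PhaseField.E d)) (_ : P.CRh v n ⊆ CR),
        (∀ (φ : PhaseField.E d → ℝ) (G : PhaseField.E d → PhaseField.E d),
          (P.mesh n).InVc P.Ω CR φ G →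
          |P.p.energyDeriv P.Ω (gradient (u n)) (v n) (gradient (v n)) φ G| ≤
            c44 * (P.p.estimator (P.mesh n) (u n) (v n) * PhaseField.gradNorm P.Ω G)) ∧
        P.p.dualNorm (P.mesh n) P.Ω CR (u n) (v n) ≤
          ENNReal.ofReal (c44 * P.p.estimator (P.mesh n) (u n) (v n)) := by
  -- `regularWith` provides the constant $4c_\varrho$. Adding $1$ only shrinks the ball, and it
  -- ensures $k\ge1$, so that $\log k\ge0$ in the comparison of diameters.
  have hk : 1 ≤ 4 * creg + 1 := by linarith
  refine ⟨PhaseField.Params.residualConst d (4 * creg + 1),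
    PhaseField.Params.residualConst_pos d (by linarith), ?_⟩
  intro P hP u v w0 hv hu n hn1 hnN hcrit CR hCR
  have hr : ∀ τ ∈ (P.mesh n).elements, PhaseField.RegularWith (4 * creg + 1) τ := by
    intro τ hτ
    obtain ⟨x, hx⟩ := ((P.mesh n).isSimplex hτ).regularWith (by omega) hcreg (hP n hnN τ hτ)
    refine ⟨x, (Metric.closedBall_subset_closedBall ?_).trans hx⟩
    exact div_le_div_of_nonneg_left Metric.diam_nonneg (by linarith) (by linarith)
  have h : ∀ (φ : PhaseField.E d → ℝ) (G : PhaseField.E d → PhaseField.E d),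
      (P.mesh n).InVc P.Ω CR φ G →
      |P.p.energyDeriv P.Ω (gradient (u n)) (v n) (gradient (v n)) φ G| ≤
        PhaseField.Params.residualConst d (4 * creg + 1) *
          (P.p.estimator (P.mesh n) (u n) (v n) * PhaseField.gradNorm P.Ω G) := fun φ G hφ =>
    P.p.abs_energyDeriv_le (P.triangulates n hnN) hd hφ (hu.mem n hn1 hnN).1 (hv n hnN) hk hr hCR
      hcrit.2
  refine ⟨h, P.p.dualNorm_le ?_ fun φ G hφ => (h φ G hφ).trans_eq (mul_assoc _ _ _).symm⟩
  exact mul_nonneg (PhaseField.Params.residualConst_pos d (by linarith)).le (Real.sqrt_nonneg _)
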